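/- Let $v^{\rm init}:\mathbb R^3\to\mathbb R^3$ be a $C^1$, divergence-free vector field, $2\pi$-periodic in each coordinate, whose vorticity $\omega=\nabla\times v^{\rm init}$ has an absolutely summable Fourier series, $\Gamma:=\sum_{p\in\mathbb Z^3}|\widehat\omega_p|<\infty$. For scalar periodic $f$ put $\|f\|=\sum_p|\widehat f_p|$, and for a periodic vector field $u$ put $\|\nabla u\|=\max_{i,j}\|\partial_iu_j\|$. (1) There is a unique sequence of $C^1$, $2\pi$-periodic fields $\xi^{(s)}:\mathbb R^3\to\mathbb R^3$ ($s\ge1$) such that $\xi^{(1)}$ has the mean of $v^{\rm init}$, $\xi^{(s)}$ has mean zero for $s\ge2$, and for all $s\ge1$ $$\nabla\times\xi^{(s)}=\omega\,\delta^s_1-\sum_{k=1}^3\sum_{0<m<s}\frac ms\,\nabla\xi^{(m)}_k\times\nabla\xi^{(s-m)}_k,$$ $$\nabla\cdot\xi^{(s)}=\sum_{1\le i<j\le3}\sum_{0<m<s}\bigl(\partial_j\xi^{(m)}_i\,\partial_i\xi^{(s-m)}_j-\partial_i\xi^{(m)}_i\,\partial_j\xi^{(s-m)}_j\bigr)-\sum_{i,j,k}\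 \sum_{l+m+n=s;\ l,m,n\ge1}\varepsilon_{ijk}\,\partial_i\xi^{(l)}_1\,\partial_j\xi^{(m)}_2\,\partial_k\xi^{(n)}_3 .$$ Moreover $\xi^{(1)}=v^{\rm init}$. (2) Let $T_c=(8-5\sqrt2)/3\approx0.3096$. If $t\ge0$ and $T:=t\Gamma<T_c$, then $\zeta(t)=\sum_{s\ge1}\bigl(\sum_p|p|\,|\widehat\xi^{(s)}_p|\bigr)t^s$ converges, $\zeta(t)\le T+\zeta(t)^2/\sqrt2+\zeta(t)^3/6$, and $\zeta(t)\le\zeta_2$, where $\zeta_2$ is the smallest non-negative root of $z^3/6+z^2/\sqrt2-z+T$. For every $a\in\mathbb R^3$ and every complex $t$ with $|t|\Gamma<T_c$ (that is, $|t|<T_c/\Gamma$; all $t$ if $\Gamma=0$), the Taylor series $\xi(a,t)=\sum_{s\ge1}\xi^{(s)}(a)t^s$ and the double series $\sum_{s,p}\widehat\xi^{(s)}_p e^{ip\cdot a}t^s$ converge absolutely, to the same sum. (3) On the disk $|t|\Gamma<T_c$, for real as well as complex $t$, the map $x(a,t)=a+\xi(a,t)$ is a classical solution of Cauchy's Lagrangian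 equations, analytic in $t$: for each $a$ the trajectory $t\mapsto x(a,t)$ is analytic; $x$ and $\dot x$ are $C^1$ jointly in $(a,t)$; $x(a,t)-a$ is $2\pi$-periodic in $a$; $x(a,0)=a$, $\dot x(a,0)=v^{\rm init}(a)$; and $$\sum_{k=1}^3\nabla\dot x_k\times\nabla x_k=\omega,\qquad\det(\nabla x)=1 .$$ (4) (Normed-space variant.) Let $N=\|\nabla v^{\rm init}\|$ and $\widetilde T_c=3\sqrt2-\tfrac{38}9\approx0.0204$. All norms $\|\nabla\xi^{(s)}\|$ are finite. If $t\ge0$ and $tN<\widetilde T_c$, then $\widetilde\zeta(t)=\sum_{s\ge1}\|\nabla\xi^{(s)}\|t^s$ converges, $\widetilde\zeta(t)\le tN+12\,\widetilde\zeta(t)^2+6\,\widetilde\zeta(t)^3$, and $\widetilde\zeta(t)$ is at most the smallest non-negative root of $6z^3+12z^2-z+tN$. The conclusions of (3) hold on the disk $|t|N<\widetilde T_c$. This second time is the weaker one: $N\le\Gamma\le6N$ and $6\widetilde T_c<T_c$. -/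

import Mathlib

namespace EulerLagrange

noncomputable section

/-! Periodic fields on `ℝ³`, modelled as functions on `Fin 3 → ℝ`. Euclidean norms are taken
explicitly through `WithLp.toLp 2` wherever a norm of a vector matters. -/

/-- The space `ℝ³` of Lagrangian positions, also the value space of real vector fields. -/
abbrev R3 : Type := Fin 3 → ℝ

/-! ### Vector calculus -/

/-- The partial derivative `∂f/∂a_i` at `a`. -/
def pd {F : Type*} [NormedAddCommGroup F] [NormedSpace ℝ F] (i : Fin 3) (f : R3 → F) (a : R3) : F :=
  fderiv ℝ f a (Pi.single i 1)

/-- The gradient of a scalar (real or complex valued) function. -/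
def grad {𝕜 : Type*} [RCLike 𝕜] (f : R3 → 𝕜) (a : R3) : Fin 3 → 𝕜 :=
  fun i => pd i f a

/-- The curl of a vector field. -/
def curl (u : R3 → R3) (a : R3) : R3 :=
  ![pd 1 (fun b => u b 2) a - pd 2 (fun b => u b 1) a,
    pd 2 (fun b => u b 0) a - pd 0 (fun b => u b 2) a,
    pd 0 (fun b => u b 1) a - pd 1 (fun b => u b 0) a]

/-- The divergence of a vector field. -/
def divergence (u : R3 → R3) (a : R3) : ℝ :=
  ∑ i, pd i (fun b => u b i) a

/-- `2π`-periodicity in each of the three coordinates. -/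
def IsPeriodic {F : Type*} (f : R3 → F) : Prop :=
  ∀ (a : R3) (n : Fin 3 → ℤ), f (fun i => a i + 2 * Real.pi * (n i : ℝ)) = f a

/-! ### Spatial Fourier series -/

/-- The phase factor `e^{i p·a}`. -/
def wave (p : Fin 3 → ℤ) (a : R3) : ℂ :=
  Complex.exp (Complex.I * ((∑ i, (p i : ℝ) * a i : ℝ) : ℂ))

/-- The Fourier coefficient `(2π)⁻³ ∫_{[0,2π]³} f(a) e^{-i p·a} da` of a scalar function. -/
def fCoeff (f : R3 → ℝ) (p : Fin 3 → ℤ) : ℂ :=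
  (((2 * Real.pi) ^ 3 : ℝ) : ℂ)⁻¹ *
    ∫ a in Set.Icc (0 : R3) (fun _ => 2 * Real.pi), (f a : ℂ) * wave (-p) a

/-- The vector Fourier coefficient in `ℂ³` of a vector field. -/
def vCoeff (u : R3 → R3) (p : Fin 3 → ℤ) : EuclideanSpace ℂ (Fin 3) :=
  WithLp.toLp 2 (fun j => fCoeff (fun a => u a j) p)

/-- The Euclidean length `|p|` of a wave vector. -/
def waveNorm (p : Fin 3 → ℤ) : ℝ :=
  ‖(WithLp.toLp 2 (fun i => (p i : ℝ)) : EuclideanSpace ℝ (Fin 3))‖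

/-- The sum `∑_p |û_p|`; for the initial vorticity this is `Γ`. -/
def fourierSum (u : R3 → R3) : ℝ :=
  ∑' p : Fin 3 → ℤ, ‖vCoeff u p‖

/-- The norm `‖f‖ = ∑_p |f̂_p|` of a scalar function. -/
def wienerNorm (f : R3 → ℝ) : ℝ :=
  ∑' p : Fin 3 → ℤ, ‖fCoeff f p‖

/-- The norm `‖∇u‖ = max_{i,j} ‖∂_i u_j‖` of the gradient of a vector field. -/
def gradNorm (u : R3 → R3) : ℝ :=
  ⨆ ij : Fin 3 × Fin 3, wienerNorm (fun a => pd ij.1 (fun b => u b ij.2) a)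

/-! ### The recurrence relations for the time-Taylor coefficients -/

/-- The right-hand side of the recurrence relation for the curl of the coefficient of order `s`. -/
def curlRHS (v0 : R3 → R3) (ξ : ℕ → R3 → R3) (s : ℕ) (a : R3) : R3 :=
  (if s = 1 then curl v0 a else 0) -
    ∑ k : Fin 3, ∑ m ∈ Finset.Ioo 0 s,
      ((m : ℝ) / (s : ℝ)) •
        crossProduct (grad (fun b => ξ m b k) a) (grad (fun b => ξ (s - m) b k) a)

/-- The right-hand side of the recurrence relation for the divergence of the coefficient of
order `s`. The last sum runs over positive `l, m, n = s - l - m`, and its summand is the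
contraction of the three gradients with the unit antisymmetric tensor. -/
def divRHS (ξ : ℕ → R3 → R3) (s : ℕ) (a : R3) : ℝ :=
  (∑ ij : Fin 3 × Fin 3 with ij.1 < ij.2, ∑ m ∈ Finset.Ioo 0 s,
      (pd ij.2 (fun b => ξ m b ij.1) a * pd ij.1 (fun b => ξ (s - m) b ij.2) a -
        pd ij.1 (fun b => ξ m b ij.1) a * pd ij.2 (fun b => ξ (s - m) b ij.2) a)) -
    ∑ l ∈ Finset.Ioo 0 s, ∑ m ∈ Finset.Ioo 0 (s - l),
      dotProduct (grad (fun b => ξ l b 0) a)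
        (crossProduct (grad (fun b => ξ m b 1) a) (grad (fun b => ξ (s - l - m) b 2) a))

/-- `ξ 1, ξ 2, …` are the time-Taylor coefficients of the displacement for the initial velocity
`v0`: periodic `C¹` fields solving the recurrence relations, the mean of the displacement being
that of a motion with conserved mean velocity. The series has no term of order `0`. -/
structure IsTaylorCoeffs (v0 : R3 → R3) (ξ : ℕ → R3 → R3) : Prop where
  zero : ξ 0 = 0
  contDiff : ∀ s, 1 ≤ s → ContDiff ℝ 1 (ξ s)
  periodic : ∀ s, 1 ≤ s → IsPeriodic (ξ s)
  mean : ∀ s, 1 ≤ s → vCoeff (ξ s) 0 = if s = 1 then vCoeff v0 0 else 0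
  curl_eq : ∀ s, 1 ≤ s → ∀ a, curl (ξ s) a = curlRHS v0 ξ s a
  div_eq : ∀ s, 1 ≤ s → ∀ a, divergence (ξ s) a = divRHS ξ s a

/-! ### The Lagrangian map and Cauchy's equations -/

/-- The sum `∑_s ξ^{(s)}(a) t^s` of the Taylor series, for real or complex time `t`. -/
def displacement (𝕜 : Type*) [RCLike 𝕜] (ξ : ℕ → R3 → R3) (a : R3) (t : 𝕜) : Fin 3 → 𝕜 :=
  fun i => ∑' s : ℕ, (ξ s a i : 𝕜) * t ^ s

/-- The Lagrangian map `x(a,t) = a + ξ(a,t)`. -/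
def lagrangianMap (𝕜 : Type*) [RCLike 𝕜] (ξ : ℕ → R3 → R3) (a : R3) (t : 𝕜) : Fin 3 → 𝕜 :=
  fun i => (a i : 𝕜) + displacement 𝕜 ξ a t i

/-- `x` is a classical solution, for times in the set `D` of real or complex numbers and analytic
in time, of Cauchy's Lagrangian equations with initial velocity `v0`. -/
structure IsAnalyticCauchySolution {𝕜 : Type*} [RCLike 𝕜] (v0 : R3 → R3) (D : Set 𝕜)
    (x : R3 → 𝕜 → Fin 3 → 𝕜) : Prop where
  isOpen : IsOpen D
  zero_mem : (0 : 𝕜) ∈ D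
  /-- Initial position and initial velocity. -/
  initial : ∀ a i, x a 0 i = (a i : 𝕜)
  initial_velocity : ∀ a i, deriv (x a) 0 i = (v0 a i : 𝕜)
  /-- The displacement is space-periodic. -/
  periodic : ∀ t ∈ D, IsPeriodic (fun a i => x a t i - (a i : 𝕜))
  /-- Trajectories are analytic functions of time. -/
  analytic : ∀ a, AnalyticOnNhd 𝕜 (x a) D
  /-- The map and the velocity are continuously differentiable in space and time jointly. -/
  contDiffOn : ContDiffOn ℝ 1 (fun q : R3 × 𝕜 => x q.1 q.2) (Set.univ ×ˢ D)
  contDiffOn_velocity :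
    ContDiffOn ℝ 1 (fun q : R3 × 𝕜 => deriv (x q.1) q.2) (Set.univ ×ˢ D)
  /-- The Cauchy invariants keep their initial value, the initial vorticity. -/
  cauchy : ∀ t ∈ D, ∀ a i,
    (∑ k : Fin 3, crossProduct (grad (fun b => deriv (x b) t k) a)
      (grad (fun b => x b t k) a)) i = (curl v0 a i : 𝕜)
  /-- Volume is conserved. -/
  volume : ∀ t ∈ D, ∀ a,
    Matrix.det (Matrix.of (fun i j : Fin 3 => pd i (fun b => x b t j) a)) = 1

/-! ### Generating functions and critical times -/

/-- The generating function `ζ(t) = ∑_s (∑_p |p| |ξ̂_p^{(s)}|) t^s`. -/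
def genFun (ξ : ℕ → R3 → R3) (t : ℝ) : ℝ :=
  ∑' s : ℕ, (∑' p : Fin 3 → ℤ, waveNorm p * ‖vCoeff (ξ s) p‖) * t ^ s

/-- The generating function `∑_s ‖∇ξ^{(s)}‖ t^s` of the gradient norms. -/
def gradGenFun (ξ : ℕ → R3 → R3) (t : ℝ) : ℝ :=
  ∑' s : ℕ, gradNorm (ξ s) * t ^ s

/-- The critical dimensionless time `(8 - 5√2)/3 ≈ 0.3096`. -/
def Tc : ℝ := (8 - 5 * √2) / 3

/-- The critical dimensionless time of the normed-space variant: the value `T ≈ 0.0204` for which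
`6 z³ + 12 z² - z + T` has a positive double root. -/
def TcNorm : ℝ := 3 * √2 - 38 / 9

end

end EulerLagrange

namespace EulerLagrange

noncomputable section

open MeasureTheory Filter Topology

section

/-! ### Plane waves -/

/-! For a periodic field, Lagrange's identity `|p|²|û|² = |p × û|² + |p · û|²` holds at each
frequency. The mass `∑ |p||û_p|` (`gradMass`) is therefore exactly the ℓ¹ norm of the Fourier
coefficients of the four-component vector (curl, divergence): `norm_coef_curlDiv`. Recovering a
field from its curl and divergence loses nothing, and for the divergence-free initial velocity the
mass is `Γ`.

The recurrence expresses (curl, divergence) at order `s` through products of gradients of lower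
order. Once the sums over orders are symmetrised, two waves `q, r` with amplitudes `U, W` interact
through `α (U · W) q × r`, `|α| ≤ 1/2`, in the curl and through `(q × r) · (U × W) / 2` in the
divergence. Three waves interact through a product of two 3×3 determinants divided by 6. This gives
the constants `1/√2` and `1/6` (`norm_quadAmp_le`, `norm_triAmp_le`). The same formulas give the
solvability conditions: the curl part is orthogonal to `q + r`, and the zero mode vanishes. Hence
each order is solved by `potential`, and the solution is unique because curl, divergence and mean
determine a periodic field.

The masses `A_s` thus satisfy `A_s ≤ Γ δ + (1/√2) ∑ A A + (1/6) ∑ A A A`. Since `A_0 = 0`, each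
partial sum of `∑ A_s t^s` is bounded by `T + S²/√2 + S³/6`, with `S` the previous partial sum.
Induction keeps all of them below any `z ≥ 0` with `T + z²/√2 + z³/6 ≤ z` (`majorant`). Such a `z`
exists while `T` is at most the maximum of `z - z²/√2 - z³/6`, attained at `2 - √2` with value
`T_c`. The convergent majorant also controls sup norms of the coefficients and of their gradients,
so the time series may be differentiated termwise. Cauchy's equations then follow by comparing
Cauchy products with the recurrence order by order.

In the normed variant the cubic inequality has constants 12 and 6. Existence of the solution on its
disk needs no second argument, because `Γ ≤ 6N` and `6 T̃_c < T_c` put that disk inside the first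
one. -/

lemma wave_add (p q : Fin 3 → ℤ) (a : R3) : wave (p + q) a = wave p a * wave q a := by
  simp only [wave, ← Complex.exp_add, ← mul_add, ← Complex.ofReal_add, ← Finset.sum_add_distrib,
    Pi.add_apply, Int.cast_add, add_mul]

@[simp] lemma wave_zero (a : R3) : wave 0 a = 1 := by simp [wave]

@[simp] lemma norm_wave (p : Fin 3 → ℤ) (a : R3) : ‖wave p a‖ = 1 := by
  rw [wave, mul_comm, Complex.norm_exp_ofReal_mul_I]

lemma wave_neg (p : Fin 3 → ℤ) (a : R3) : wave (-p) a = (starRingEnd ℂ) (wave p a) := by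
  simp [wave, ← Complex.exp_conj, Finset.sum_neg_distrib]

lemma wave_periodic (p : Fin 3 → ℤ) : IsPeriodic (wave p) := by
  intro a n
  rw [wave, wave, Complex.exp_eq_exp_iff_exists_int]
  refine ⟨∑ i, p i * n i, ?_⟩
  push_cast
  simp only [Fin.sum_univ_three]
  ring

lemma contDiff_wave (p : Fin 3 → ℤ) : ContDiff ℝ 1 (wave p) := by
  have h : ContDiff ℝ 1 fun a : R3 => ∑ i, (p i : ℝ) * a i :=
    ContDiff.sum fun i _ => contDiff_const.mul (contDiff_apply ℝ ℝ i)
  exact ContDiff.cexp (contDiff_const.mul (Complex.ofRealCLM.contDiff.comp h))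

lemma continuous_wave (p : Fin 3 → ℤ) : Continuous (wave p) := (contDiff_wave p).continuous

lemma pd_wave (p : Fin 3 → ℤ) (i : Fin 3) (a : R3) :
    pd i (wave p) a = Complex.I * (p i : ℂ) * wave p a := by
  have h1 : HasFDerivAt (fun a : R3 => ∑ i, (p i : ℝ) * a i)
      (∑ i, (p i : ℝ) • (ContinuousLinearMap.proj i : R3 →L[ℝ] ℝ)) a :=
    HasFDerivAt.fun_sum fun i _ => (hasFDerivAt_apply i a).const_mul _
  have h2 := ((Complex.ofRealCLM.hasFDerivAt.comp a h1).const_mul Complex.I).cexp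
  have h3 := h2.fderiv
  simp only [pd, Function.comp_def, Complex.ofRealCLM_apply] at h3 ⊢
  unfold wave
  rw [h3]
  simp [Pi.single_apply]
  ring

/-! ### Fourier coefficients of complex functions -/

variable {E : Type*} [NormedAddCommGroup E] [NormedSpace ℂ E]

/-- The fundamental box of the period lattice. -/
abbrev box : Set R3 := Set.Icc (0 : R3) (fun _ => 2 * Real.pi)

lemma integrableOn_box {F : Type*} [NormedAddCommGroup F] {f : R3 → F} (hf : Continuous f) :
    IntegrableOn f box :=
  hf.continuousOn.integrableOn_compact isCompact_Icc

lemma volume_real_box : volume.real box = (2 * Real.pi) ^ 3 := by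
  rw [Measure.real, Real.volume_Icc_pi]
  simp [Real.pi_pos.le, ENNReal.toReal_ofReal]

/-- The Fourier coefficient of a function with values in a complex normed space. -/
def coef (f : R3 → E) (p : Fin 3 → ℤ) : E :=
  (((2 * Real.pi) ^ 3 : ℝ) : ℂ)⁻¹ • ∫ a in box, wave (-p) a • f a

lemma fCoeff_eq_coef (f : R3 → ℝ) (p : Fin 3 → ℤ) :
    fCoeff f p = coef (fun a => (f a : ℂ)) p := by
  simp only [fCoeff, coef, smul_eq_mul, mul_comm (wave _ _)]

lemma box_const_ne : (((2 * Real.pi) ^ 3 : ℝ) : ℂ) ≠ 0 := by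
  have := Real.pi_pos
  exact_mod_cast (by positivity : ((2 * Real.pi) ^ 3 : ℝ) ≠ 0)

/-- Integrals over the box of the partial derivatives of a periodic function vanish. -/
lemma integral_pd_eq_zero {h : R3 → ℂ} (hc : ContDiff ℝ 1 h) (hp : IsPeriodic h) (i : Fin 3) :
    ∫ a in box, pd i h a = 0 := by
  have hd : Differentiable ℝ h := hc.differentiable (by norm_num)
  have hpd : Continuous fun a => pd i h a :=
    (hc.continuous_fderiv (by norm_num)).clm_apply continuous_const
  have hsum : (fun x => ∑ j, (if j = i then fderiv ℝ h x else 0) (Pi.single j (1 : ℝ)))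
      = fun a => pd i h a := by
    ext a
    rw [Finset.sum_eq_single i] <;> simp +contextual [pd]
  -- Divergence theorem for the vector field whose only nonzero component is the `i`-th, equal to
  -- `h`; the two opposite faces cancel by periodicity.
  have key := integral_divergence_of_hasFDerivAt_off_countable' (E := ℂ) (n := 2) (0 : R3)
    (fun _ => 2 * Real.pi) (fun _ => Real.two_pi_pos.le)
    (fun j a => if j = i then h a else 0) (fun j a => if j = i then fderiv ℝ h a else 0)
    ∅ Set.countable_empty
    (fun j => by
      by_cases hj : j = i
      · simpa [hj] using hc.continuous.continuousOn
      · simpa [hj] using continuousOn_const)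
    (fun x _ j => by
      by_cases hj : j = i
      · simpa [hj] using (hd x).hasFDerivAt
      · simpa [hj] using hasFDerivAt_const (0 : ℂ) x)
    (by rw [hsum]; exact integrableOn_box hpd)
  rw [hsum] at key
  rw [key]
  refine Finset.sum_eq_zero fun j _ => ?_
  by_cases hj : j = i
  · subst hj
    simp only [if_true]
    rw [sub_eq_zero]
    congr 1
    ext x
    rw [← hp (j.insertNth ((0 : R3) j) x) (Pi.single j 1)]
    congr 1
    ext k
    refine Fin.succAboveCases j ?_ (fun k => ?_) k <;> simp
  · simp [hj]

lemma pd_mul {f g : R3 → ℂ} {a : R3} (hf : DifferentiableAt ℝ f a) (hg : DifferentiableAt ℝ g a)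
    (i : Fin 3) : pd i (fun b => f b * g b) a = f a * pd i g a + g a * pd i f a := by
  simp only [pd]
  rw [fderiv_fun_mul hf hg]
  simp

lemma coef_pd {f : R3 → ℂ} (hc : ContDiff ℝ 1 f) (hp : IsPeriodic f) (i : Fin 3)
    (p : Fin 3 → ℤ) : coef (fun a => pd i f a) p = Complex.I * (p i : ℂ) * coef f p := by
  have hd : Differentiable ℝ f := hc.differentiable (by norm_num)
  have hw := contDiff_wave (-p)
  have hpd : Continuous fun a => pd i f a :=
    (hc.continuous_fderiv (by norm_num)).clm_apply continuous_const
  have h0 := integral_pd_eq_zero (hw.mul hc)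
    (fun a n => congrArg₂ (· * ·) (wave_periodic (-p) a n) (hp a n)) i
  have h1 : (fun a => pd i (fun b => wave (-p) b * f b) a) =
      fun a => wave (-p) a • pd i f a - (Complex.I * (p i : ℂ)) * (wave (-p) a • f a) := by
    ext a
    rw [pd_mul ((hw.differentiable (by norm_num)) a) (hd a), pd_wave]
    simp only [smul_eq_mul, Pi.neg_apply, Int.cast_neg]
    ring
  have i1 : IntegrableOn (fun a => wave (-p) a • pd i f a) box :=
    integrableOn_box ((continuous_wave (-p)).smul hpd)
  have i2 : IntegrableOn (fun a => (Complex.I * (p i : ℂ)) * (wave (-p) a • f a)) box :=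
    integrableOn_box (((continuous_wave (-p)).smul hc.continuous).const_smul
    (Complex.I * (p i : ℂ)))
  rw [h1, integral_sub i1 i2, integral_const_mul, sub_eq_zero] at h0
  rw [coef, coef, h0]
  simp only [smul_eq_mul]
  ring

/-- Orthogonality of the waves without computing an integral: the derivative of a constant is zero,
so `i p_i` times the coefficient vanishes, and some `p_i` is nonzero when `p ≠ 0`. -/
lemma coef_const (p : Fin 3 → ℤ) : coef (fun _ => (1 : ℂ)) p = if p = 0 then 1 else 0 := by
  split_ifs with h
  · subst h
    simp only [coef, neg_zero, wave_zero, smul_eq_mul, mul_one]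
    rw [setIntegral_const, volume_real_box, Complex.real_smul, mul_one,
      inv_mul_cancel₀ box_const_ne]
  · obtain ⟨i, hi⟩ := Function.ne_iff.mp h
    have := coef_pd (f := fun _ => (1 : ℂ)) contDiff_const (fun _ _ => rfl) i p
    have h0 : (fun a => pd i (fun _ : R3 => (1 : ℂ)) a) = fun _ => 0 := by
      ext a; simp [pd]
    rw [h0] at this
    simp only [coef, smul_zero, integral_zero] at this
    have := this.symm
    simp only [mul_eq_zero, Complex.I_ne_zero, false_or, Int.cast_eq_zero] at this
    rcases this with h | h
    · exact absurd h hi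
    · simpa [coef, box_const_ne] using h

lemma integral_wave (p : Fin 3 → ℤ) :
    ∫ a in box, wave p a = if p = 0 then (((2 * Real.pi) ^ 3 : ℝ) : ℂ) else 0 := by
  have h := coef_const (-p)
  simp only [coef, neg_neg, smul_eq_mul, mul_one, neg_eq_zero] at h
  rw [inv_mul_eq_iff_eq_mul₀ box_const_ne] at h
  rw [h]; simp

/-- The coefficients of an absolutely convergent Fourier series. -/
lemma coef_of_hasSum [CompleteSpace E] {f : R3 → E} {c : (Fin 3 → ℤ) → E}
    (hc : Summable fun p => ‖c p‖) (hf : ∀ a, HasSum (fun p => wave p a • c p) (f a)) :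
    coef f = c := by
  ext p
  have hcont : ∀ q, Continuous fun a => wave (-p) a • wave q a • c q := fun q =>
    (continuous_wave _).smul ((continuous_wave q).smul continuous_const)
  have h := hasSum_integral_of_summable_integral_norm (μ := volume.restrict box)
    (F := fun q a => wave (-p) a • wave q a • c q)
    (fun q => integrableOn_box (hcont q))
    (by
      simp only [norm_smul, norm_wave, one_mul]
      simp only [integral_const]
      exact hc.const_smul _)
  have h1 : ∀ a, ∑' q, wave (-p) a • wave q a • c q = wave (-p) a • f a := fun a =>
    ((hf a).const_smul (wave (-p) a)).tsum_eq
  simp only [h1] at h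
  have h2 : ∀ q, ∫ a in box, wave (-p) a • wave q a • c q =
      if q = p then (((2 * Real.pi) ^ 3 : ℝ) : ℂ) • c q else 0 := by
    intro q
    have : ∀ a, wave (-p) a • wave q a • c q = wave (-p + q) a • c q := fun a => by
      rw [wave_add, smul_smul]
    simp only [this]
    rw [integral_smul_const, integral_wave]
    by_cases hq : q = p
    · subst hq; simp
    · have : -p + q ≠ 0 := fun h => hq (by rw [neg_add_eq_zero] at h; exact h.symm)
      simp [hq, this]
  simp only [h2] at h
  have h3 := h.unique (hasSum_ite_eq p ((((2 * Real.pi) ^ 3 : ℝ) : ℂ) • c p) |>.congr_fun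
    (by intro q; by_cases hq : q = p <;> simp [hq]))
  rw [coef, h3, smul_smul, inv_mul_cancel₀ box_const_ne, one_smul]

end

section

open scoped Pointwise

/-! ### Fourier inversion -/

lemma mFourier_coe (n : Fin 3 → ℤ) (x : R3) :
    UnitAddTorus.mFourier n (fun i => ((x i : ℝ) : UnitAddCircle)) =
      wave n ((2 * Real.pi) • x) := by
  simp only [UnitAddTorus.mFourier, ContinuousMap.coe_mk, fourier_coe_apply, wave,
    ← Complex.exp_sum]
  congr 1
  push_cast
  rw [Finset.mul_sum]
  refine Finset.sum_congr rfl fun i _ => ?_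
  simp
  ring

lemma smul_pi_Ioc {c : ℝ} (hc : 0 < c) :
    c • {x : R3 | ∀ i, x i ∈ Set.Ioc (0 : ℝ) (0 + 1)} =
      Set.pi Set.univ fun _ => Set.Ioc 0 c := by
  ext y
  simp only [Set.mem_smul_set_iff_inv_smul_mem₀ hc.ne', Set.mem_ofPred_eq, Set.mem_pi,
    Set.mem_univ, true_imp_iff, Pi.smul_apply, smul_eq_mul, Set.mem_Ioc, zero_add]
  refine forall_congr' fun i => and_congr ?_ ?_
  · rw [inv_mul_eq_div, lt_div_iff₀ hc, zero_mul]
  · rw [inv_mul_eq_div, div_le_one hc]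

/-- A continuous periodic function is the sum of its Fourier series if that is absolutely
convergent. -/
lemma hasSum_coef {f : R3 → ℂ} (hf : Continuous f) (hp : IsPeriodic f)
    (hs : Summable fun p => ‖coef f p‖) (a : R3) :
    HasSum (fun p => wave p a • coef f p) (f a) := by
  have hpi := Real.two_pi_pos
  let π : C(R3, UnitAddTorus (Fin 3)) :=
    ⟨fun x i => ((x i : ℝ) : UnitAddCircle), by fun_prop⟩
  have hπ : IsQuotientMap π :=
    (IsOpenQuotientMap.piMap (f := fun (_ : Fin 3) (x : ℝ) => (x : UnitAddCircle))
      fun _ => QuotientAddGroup.isOpenQuotientMap_mk).isQuotientMap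
  -- Rescaling by `2π` makes the function ℤ³-periodic, so that it descends to a continuous function
  -- on the unit torus, where Fourier inversion for summable coefficients applies.
  let F : C(R3, ℂ) := ⟨fun x => f ((2 * Real.pi) • x), hf.comp (continuous_const_smul _)⟩
  have hF : Function.FactorsThrough F π := by
    intro x y (hxy : (fun i => ((x i : ℝ) : UnitAddCircle)) = fun i => ((y i : ℝ) : UnitAddCircle))
    have h : ∀ i, ∃ m : ℤ, x i = y i + m := by
      intro i
      have := congrFun hxy i
      rw [← sub_eq_zero, ← AddCircle.coe_sub, AddCircle.coe_eq_zero_iff] at this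
      obtain ⟨m, hm⟩ := this
      exact ⟨m, by simp at hm; linarith⟩
    choose m hm using h
    change f _ = f _
    rw [← hp ((2 * Real.pi) • y) m]
    congr 1
    ext i
    simp only [Pi.smul_apply, smul_eq_mul, hm i]
    ring
  let g : C(UnitAddTorus (Fin 3), ℂ) := hπ.lift F hF
  have hg : ∀ x, g (π x) = f ((2 * Real.pi) • x) := fun x =>
    congrArg (fun G : C(R3, ℂ) => G x) (hπ.lift_comp F hF)
  have hcoef : ∀ n, UnitAddTorus.mFourierCoeff g n = coef f n := by
    intro n
    rw [UnitAddTorus.mFourierCoeff_eq_integral g n 0]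
    have h1 : ∀ x : R3, UnitAddTorus.mFourier (-n) (fun i => ((x i : ℝ) : UnitAddCircle)) •
        g (fun i => ((x i : ℝ) : UnitAddCircle)) =
        (fun y => wave (-n) y • f y) ((2 * Real.pi) • x) := fun x => by
      rw [mFourier_coe]; exact congrArg _ (hg x)
    have h3 := Measure.setIntegral_comp_smul_of_pos volume (fun y => wave (-n) y • f y)
      {x : R3 | ∀ i, x i ∈ Set.Ioc (0 : ℝ) (0 + 1)} hpi
    simp only [← h1] at h3
    simp only [Pi.zero_apply]
    rw [h3, smul_pi_Ioc hpi, coef, box]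
    have h2 := Measure.univ_pi_Ioc_ae_eq_Icc (μ := fun _ : Fin 3 => (volume : Measure ℝ))
      (f := 0) (g := fun _ => 2 * Real.pi)
    rw [← volume_pi] at h2
    simp only [Pi.zero_apply] at h2
    rw [setIntegral_congr_set h2]
    simp [Complex.real_smul]
  have key := UnitAddTorus.hasSum_mFourier_series_apply_of_summable (f := g)
    (by simp only [funext hcoef]; exact hs.of_norm) (π ((2 * Real.pi)⁻¹ • a))
  rw [hg, smul_smul, mul_inv_cancel₀ hpi.ne', one_smul] at key
  refine key.congr_fun fun p => ?_
  have h4 := mFourier_coe p ((2 * Real.pi)⁻¹ • a)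
  rw [smul_smul, mul_inv_cancel₀ hpi.ne', one_smul] at h4
  rw [hcoef, ← h4, smul_eq_mul, smul_eq_mul, mul_comm]
  rfl

lemma coef_injective {f : R3 → ℂ} (hf : Continuous f) (hp : IsPeriodic f)
    (h : ∀ p, coef f p = 0) : f = 0 := by
  ext a
  have := hasSum_coef hf hp (by simp [h]) a
  simpa [h, eq_comm] using this.tsum_eq

/-! ### Functions given by absolutely convergent Fourier series -/

section WaveBound

variable {E : Type*} [NormedAddCommGroup E] [NormedSpace ℂ E]

/-- `f` is the sum of a Fourier series whose coefficients lie in the subspaces `S p` and have norms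
of sum at most `B`. -/
def WaveBound (S : (Fin 3 → ℤ) → Submodule ℂ E) (f : R3 → E) (B : ℝ) : Prop :=
  ∃ c : (Fin 3 → ℤ) → E, (∀ p, c p ∈ S p) ∧ (Summable fun p => ‖c p‖) ∧ ∑' p, ‖c p‖ ≤ B ∧
    ∀ a, HasSum (fun p => wave p a • c p) (f a)

variable {S : (Fin 3 → ℤ) → Submodule ℂ E} {f g : R3 → E} {B C : ℝ}

lemma WaveBound.coef [CompleteSpace E] (h : WaveBound S f B) :
    (∀ p, coef f p ∈ S p) ∧ (Summable fun p => ‖coef f p‖) ∧ ∑' p, ‖coef f p‖ ≤ B ∧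
      ∀ a, HasSum (fun p => wave p a • coef f p) (f a) := by
  obtain ⟨c, h1, h2, h3, h4⟩ := h
  rw [coef_of_hasSum h2 h4]
  exact ⟨h1, h2, h3, h4⟩

lemma WaveBound.mono (h : WaveBound S f B) (hBC : B ≤ C) : WaveBound S f C := by
  obtain ⟨c, h1, h2, h3, h4⟩ := h
  exact ⟨c, h1, h2, h3.trans hBC, h4⟩

lemma WaveBound.zero : WaveBound S (fun _ => (0 : E)) 0 :=
  ⟨0, fun p => (S p).zero_mem, by simp, by simp,
    fun a => by simp⟩

lemma WaveBound.add (hf : WaveBound S f B) (hg : WaveBound S g C) :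
    WaveBound S (fun a => f a + g a) (B + C) := by
  obtain ⟨c, h1, h2, h3, h4⟩ := hf
  obtain ⟨d, g1, g2, g3, g4⟩ := hg
  have hs : Summable fun p => ‖c p + d p‖ :=
    Summable.of_nonneg_of_le (fun _ => norm_nonneg _) (fun p => norm_add_le _ _) (h2.add g2)
  refine ⟨fun p => c p + d p, fun p => (S p).add_mem (h1 p) (g1 p), hs, ?_, fun a => ?_⟩
  · calc _ ≤ ∑' p, (‖c p‖ + ‖d p‖) := hs.tsum_le_tsum (fun p => norm_add_le _ _) (h2.add g2)
      _ = _ := h2.tsum_add g2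
      _ ≤ _ := add_le_add h3 g3
  · simpa only [smul_add] using (h4 a).add (g4 a)

lemma WaveBound.const_smul (hf : WaveBound S f B) (k : ℂ) :
    WaveBound S (fun a => k • f a) (‖k‖ * B) := by
  obtain ⟨c, h1, h2, h3, h4⟩ := hf
  refine ⟨fun p => k • c p, fun p => (S p).smul_mem _ (h1 p), ?_, ?_, fun a => ?_⟩
  · simpa only [norm_smul] using h2.mul_left ‖k‖
  · simp only [norm_smul, tsum_mul_left]
    exact mul_le_mul_of_nonneg_left h3 (norm_nonneg _)
  · simpa only [smul_comm (wave _ _)] using (h4 a).const_smul k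

lemma WaveBound.neg (hf : WaveBound S f B) : WaveBound S (fun a => -f a) B := by
  simpa using hf.const_smul (-1)

lemma WaveBound.sub (hf : WaveBound S f B) (hg : WaveBound S g C) :
    WaveBound S (fun a => f a - g a) (B + C) := by
  simpa only [sub_eq_add_neg] using hf.add hg.neg

lemma WaveBound.sum {ι : Type*} (s : Finset ι) {f : ι → R3 → E} {B : ι → ℝ}
    (h : ∀ i ∈ s, WaveBound S (f i) (B i)) :
    WaveBound S (fun a => ∑ i ∈ s, f i a) (∑ i ∈ s, B i) := by
  classical
  induction s using Finset.induction_on with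
  | empty => simpa using WaveBound.zero
  | insert i s hi ih =>
    simp only [Finset.sum_insert hi]
    exact (h i (Finset.mem_insert_self _ _)).add
      (ih fun j hj => h j (Finset.mem_insert_of_mem hj))

/-- A sum of waves indexed by an arbitrary family is a Fourier series: collect the terms of equal
frequency. -/
lemma WaveBound.of_family [FiniteDimensional ℂ E] {ι : Type*} (φ : ι → Fin 3 → ℤ) (b : ι → E)
    (hS : ∀ i, b i ∈ S (φ i)) (hb : Summable fun i => ‖b i‖) (hB : ∑' i, ‖b i‖ ≤ B)
    (hf : ∀ a, HasSum (fun i => wave (φ i) a • b i) (f a)) : WaveBound S f B := by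
  have : CompleteSpace E := FiniteDimensional.complete ℂ E
  let e := Equiv.sigmaFiberEquiv φ
  have hbe : Summable fun x : (Σ p, {i // φ i = p}) => ‖b (e x)‖ := e.summable_iff.mpr hb
  have hfib : ∀ p, Summable fun i : {i // φ i = p} => ‖b i‖ := fun p =>
    hbe.sigma_factor p
  have hle : ∀ p, ‖∑' i : {i // φ i = p}, b i‖ ≤ ∑' i : {i // φ i = p}, ‖b i‖ := fun p =>
    norm_tsum_le_tsum_norm (hfib p)
  have hsig : Summable fun p => ∑' i : {i // φ i = p}, ‖b i‖ := hbe.sigma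
  have hs : Summable fun p => ‖∑' i : {i // φ i = p}, b i‖ :=
    Summable.of_nonneg_of_le (fun _ => norm_nonneg _) hle hsig
  refine ⟨fun p => ∑' i : {i // φ i = p}, b i, fun p => ?_, hs, ?_, fun a => ?_⟩
  · have hcl : IsClosed (S p : Set E) := (S p).closed_of_finiteDimensional
    refine hcl.mem_of_tendsto (hfib p).of_norm.hasSum (Eventually.of_forall fun s => ?_)
    exact (S p).sum_mem fun i _ => by
      have := hS i
      rwa [i.2] at this
  · calc _ ≤ ∑' p, ∑' i : {i // φ i = p}, ‖b i‖ := hs.tsum_le_tsum hle hsig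
      _ = ∑' x : (Σ p, {i // φ i = p}), ‖b (e x)‖ := (hbe.tsum_sigma).symm
      _ = ∑' i, ‖b i‖ := e.tsum_eq (fun i => ‖b i‖)
      _ ≤ B := hB
  · have h1 : HasSum (fun x : (Σ p, {i // φ i = p}) => wave (φ (e x)) a • b (e x)) (f a) :=
      (e.hasSum_iff (f := fun i => wave (φ i) a • b i)).mpr (hf a)
    refine h1.sigma fun p => ?_
    refine (((hfib p).of_norm.hasSum).const_smul (wave p a)).congr_fun fun i => ?_
    have : φ (e ⟨p, i⟩) = p := i.2
    simp only [this]
    rfl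

end WaveBound

/-- Products of scalar functions with absolutely convergent Fourier series. -/
lemma WaveBound.mul {f g : R3 → ℂ} {B C : ℝ} (hf : WaveBound (fun _ => ⊤) f B)
    (hg : WaveBound (fun _ => ⊤) g C) : WaveBound (fun _ => ⊤) (fun a => f a * g a) (B * C) := by
  obtain ⟨c, -, h2, h3, h4⟩ := hf
  obtain ⟨d, -, g2, g3, g4⟩ := hg
  have hs : Summable fun x : (Fin 3 → ℤ) × (Fin 3 → ℤ) => ‖c x.1‖ * ‖d x.2‖ :=
    h2.mul_of_nonneg g2 (fun _ => norm_nonneg _) (fun _ => norm_nonneg _)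
  refine WaveBound.of_family (fun x : (Fin 3 → ℤ) × (Fin 3 → ℤ) => x.1 + x.2)
    (fun x => c x.1 * d x.2) (fun _ => Submodule.mem_top) (by simpa only [norm_mul] using hs) ?_
    fun a => ?_
  · simp only [norm_mul]
    rw [← h2.tsum_mul_tsum g2 hs]
    exact mul_le_mul h3 g3 (tsum_nonneg fun _ => norm_nonneg _)
      ((tsum_nonneg fun _ => norm_nonneg _).trans h3)
  · have hsum : Summable fun x : (Fin 3 → ℤ) × (Fin 3 → ℤ) =>
        (wave x.1 a • c x.1) * (wave x.2 a • d x.2) := by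
      refine Summable.of_norm ?_
      simpa only [norm_mul, norm_smul, norm_wave, one_mul] using hs
    refine ((h4 a).mul (g4 a) hsum).congr_fun fun x => ?_
    rw [wave_add]
    simp only [smul_eq_mul]
    ring

end

section

/-! ### Algebraic inequalities for real wave vectors and complex amplitudes -/

section Algebra

open Complex
open scoped ComplexConjugate

/-- Lagrange's identity with one real factor. As a wave vector is real, no conjugate appears, and
the curl and divergence amplitudes together carry exactly the norm of the gradient. -/
lemma normSq_cross_add_normSq_dot (x : Fin 3 → ℝ) (u : Fin 3 → ℂ) :
    normSq (x 1 * u 2 - x 2 * u 1) + normSq (x 2 * u 0 - x 0 * u 2) +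
      normSq (x 0 * u 1 - x 1 * u 0) + normSq (x 0 * u 0 + x 1 * u 1 + x 2 * u 2) =
    (x 0 ^ 2 + x 1 ^ 2 + x 2 ^ 2) * (normSq (u 0) + normSq (u 1) + normSq (u 2)) := by
  simp only [normSq_apply, add_re, add_im, sub_re, sub_im, mul_re, mul_im, ofReal_re, ofReal_im]
  ring

/-- Lagrange's identity with the conjugate of one factor. -/
lemma normSq_cross_add_normSq_dot_conj (u w : Fin 3 → ℂ) :
    normSq (u 1 * w 2 - u 2 * w 1) + normSq (u 2 * w 0 - u 0 * w 2) +
      normSq (u 0 * w 1 - u 1 * w 0) +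
      normSq (u 0 * conj (w 0) + u 1 * conj (w 1) + u 2 * conj (w 2)) =
    (normSq (u 0) + normSq (u 1) + normSq (u 2)) *
      (normSq (w 0) + normSq (w 1) + normSq (w 2)) := by
  simp only [normSq_apply, add_re, add_im, sub_re, sub_im, mul_re, mul_im, conj_re, conj_im]
  ring

lemma normSq_cross_le (u w : Fin 3 → ℂ) :
    normSq (u 1 * w 2 - u 2 * w 1) + normSq (u 2 * w 0 - u 0 * w 2) +
      normSq (u 0 * w 1 - u 1 * w 0) ≤
    (normSq (u 0) + normSq (u 1) + normSq (u 2)) *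
      (normSq (w 0) + normSq (w 1) + normSq (w 2)) := by
  rw [← normSq_cross_add_normSq_dot_conj]
  exact le_add_of_nonneg_right (normSq_nonneg _)

lemma normSq_dot_le (u w : Fin 3 → ℂ) :
    normSq (u 0 * w 0 + u 1 * w 1 + u 2 * w 2) ≤
    (normSq (u 0) + normSq (u 1) + normSq (u 2)) *
      (normSq (w 0) + normSq (w 1) + normSq (w 2)) := by
  have h := normSq_cross_add_normSq_dot_conj u (fun i => conj (w i))
  simp only [conj_conj, normSq_conj] at h
  rw [← h]
  refine le_add_of_nonneg_left ?_
  have := normSq_nonneg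
  exact add_nonneg (add_nonneg (this _) (this _)) (this _)

lemma cross_sq_le (x y : Fin 3 → ℝ) :
    (x 1 * y 2 - x 2 * y 1) ^ 2 + (x 2 * y 0 - x 0 * y 2) ^ 2 + (x 0 * y 1 - x 1 * y 0) ^ 2 ≤
    (x 0 ^ 2 + x 1 ^ 2 + x 2 ^ 2) * (y 0 ^ 2 + y 1 ^ 2 + y 2 ^ 2) := by
  nlinarith [sq_nonneg (x 0 * y 0 + x 1 * y 1 + x 2 * y 2)]

lemma dot_sq_le (x y : Fin 3 → ℝ) :
    (x 0 * y 0 + x 1 * y 1 + x 2 * y 2) ^ 2 ≤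
    (x 0 ^ 2 + x 1 ^ 2 + x 2 ^ 2) * (y 0 ^ 2 + y 1 ^ 2 + y 2 ^ 2) := by
  nlinarith [sq_nonneg (x 1 * y 2 - x 2 * y 1), sq_nonneg (x 2 * y 0 - x 0 * y 2),
    sq_nonneg (x 0 * y 1 - x 1 * y 0)]

lemma normSq_real_dot_le (x : Fin 3 → ℝ) (u : Fin 3 → ℂ) :
    normSq (x 0 * u 0 + x 1 * u 1 + x 2 * u 2) ≤
    (x 0 ^ 2 + x 1 ^ 2 + x 2 ^ 2) * (normSq (u 0) + normSq (u 1) + normSq (u 2)) := by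
  have h := normSq_cross_add_normSq_dot x u
  have := normSq_nonneg
  rw [← h]
  exact le_add_of_nonneg_left (add_nonneg (add_nonneg (this _) (this _)) (this _))

end Algebra

lemma waveNorm_sq (p : Fin 3 → ℤ) :
    waveNorm p ^ 2 = (p 0 : ℝ) ^ 2 + (p 1 : ℝ) ^ 2 + (p 2 : ℝ) ^ 2 := by
  rw [waveNorm, EuclideanSpace.norm_sq_eq]
  simp [Fin.sum_univ_three]

lemma waveNorm_nonneg (p : Fin 3 → ℤ) : 0 ≤ waveNorm p := norm_nonneg _

lemma norm_sq_eucl3 (u : EuclideanSpace ℂ (Fin 3)) :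
    ‖u‖ ^ 2 = Complex.normSq (u 0) + Complex.normSq (u 1) + Complex.normSq (u 2) := by
  rw [EuclideanSpace.norm_sq_eq]
  simp [Fin.sum_univ_three, Complex.normSq_eq_norm_sq]

lemma norm_sq_eucl4 (u : EuclideanSpace ℂ (Fin 4)) :
    ‖u‖ ^ 2 = Complex.normSq (u 0) + Complex.normSq (u 1) + Complex.normSq (u 2) +
      Complex.normSq (u 3) := by
  rw [EuclideanSpace.norm_sq_eq]
  simp [Fin.sum_univ_four, Complex.normSq_eq_norm_sq]

lemma abs_le_waveNorm (p : Fin 3 → ℤ) (i : Fin 3) : |(p i : ℝ)| ≤ waveNorm p := by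
  have := PiLp.norm_apply_le (WithLp.toLp 2 (fun i => (p i : ℝ)) : EuclideanSpace ℝ (Fin 3)) i
  simpa [waveNorm] using this

lemma one_le_waveNorm {p : Fin 3 → ℤ} (hp : p ≠ 0) : 1 ≤ waveNorm p := by
  obtain ⟨i, hi⟩ := Function.ne_iff.mp hp
  refine le_trans ?_ (abs_le_waveNorm p i)
  exact_mod_cast Int.one_le_abs hi

lemma hasSum_euclidean {n : ℕ} {ι : Type*} {f : ι → EuclideanSpace ℂ (Fin n)}
    {x : EuclideanSpace ℂ (Fin n)} (h : ∀ j, HasSum (fun i => f i j) (x j)) : HasSum f x := by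
  have := (Pi.hasSum (f := fun i => WithLp.ofLp (f i)) (g := WithLp.ofLp x)).mpr h
  exact (PiLp.continuousLinearEquiv 2 ℂ (fun _ : Fin n => ℂ)).hasSum.mp this

/-! ### Periodic fields whose gradient has an absolutely convergent Fourier series -/

lemma pd_ofReal (𝕜 : Type*) [RCLike 𝕜] {f : R3 → ℝ} {a : R3} (hf : DifferentiableAt ℝ f a)
    (i : Fin 3) : pd i (fun b => (f b : 𝕜)) a = ((pd i f a : ℝ) : 𝕜) := by
  have h := ((RCLike.ofRealCLM (K := 𝕜)).hasFDerivAt.comp a hf.hasFDerivAt).fderiv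
  simp only [Function.comp_def, RCLike.ofRealCLM_apply] at h
  simp [pd, h]

/-- Continuously differentiable periodic fields `u` with `∑_p |p| |û_p| < ∞`. -/
structure WienerField (u : R3 → R3) : Prop where
  contDiff : ContDiff ℝ 1 u
  periodic : IsPeriodic u
  summable : Summable fun p => waveNorm p * ‖vCoeff u p‖

/-- The sum `∑_p |p| |û_p|`. -/
def gradMass (u : R3 → R3) : ℝ := ∑' p, waveNorm p * ‖vCoeff u p‖

lemma gradMass_nonneg (u : R3 → R3) : 0 ≤ gradMass u :=
  tsum_nonneg fun p => mul_nonneg (waveNorm_nonneg p) (norm_nonneg _)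

/-- The curl and the divergence of a field, as a vector with four complex components. -/
def curlDiv (u : R3 → R3) (a : R3) : EuclideanSpace ℂ (Fin 4) :=
  WithLp.toLp 2 ![(curl u a 0 : ℂ), (curl u a 1 : ℂ), (curl u a 2 : ℂ), (divergence u a : ℂ)]

/-! ### Derivatives, curl and divergence on the Fourier side. -/

section Field

variable {u : R3 → R3}

lemma contDiff_comp_apply (hu : ContDiff ℝ 1 u) (j : Fin 3) : ContDiff ℝ 1 fun a => u a j :=
  (contDiff_pi.mp hu) j

lemma differentiable_comp_apply (hu : ContDiff ℝ 1 u) (j : Fin 3) :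
    Differentiable ℝ fun a => u a j :=
  (contDiff_comp_apply hu j).differentiable (by norm_num)

lemma continuous_pd (hu : ContDiff ℝ 1 u) (i j : Fin 3) :
    Continuous fun a => pd i (fun b => u b j) a :=
  ((contDiff_comp_apply hu j).continuous_fderiv (by norm_num)).clm_apply continuous_const

lemma continuous_pd_ofReal (hu : ContDiff ℝ 1 u) (i j : Fin 3) :
    Continuous fun a => ((pd i (fun b => u b j) a : ℝ) : ℂ) :=
  Complex.continuous_ofReal.comp (continuous_pd hu i j)

lemma IsPeriodic.pd {F : Type*} [NormedAddCommGroup F] [NormedSpace ℝ F] {f : R3 → F}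
    (hf : IsPeriodic f) (i : Fin 3) : IsPeriodic fun a => pd i f a := by
  intro a n
  have h : (fun b : R3 => f (b + fun i => 2 * Real.pi * (n i : ℝ))) = f := funext fun b => hf b n
  change fderiv ℝ f (a + fun i => 2 * Real.pi * (n i : ℝ)) _ = fderiv ℝ f a _
  rw [← fderiv_comp_add_right, h]

lemma IsPeriodic.comp_apply (hu : IsPeriodic u) (j : Fin 3) : IsPeriodic fun a => u a j :=
  fun a n => congrFun (hu a n) j

lemma coef_pd_apply (hu : ContDiff ℝ 1 u) (hp : IsPeriodic u) (i j : Fin 3) (p : Fin 3 → ℤ) :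
    coef (fun a => ((pd i (fun b => u b j) a : ℝ) : ℂ)) p =
      Complex.I * (p i : ℂ) * vCoeff u p j := by
  have h1 : (fun a => ((pd i (fun b => u b j) a : ℝ) : ℂ)) =
      fun a => pd i (fun b => (u b j : ℂ)) a :=
    funext fun a => (pd_ofReal ℂ (differentiable_comp_apply hu j a) i).symm
  have h2 : vCoeff u p j = coef (fun a => (u a j : ℂ)) p := fCoeff_eq_coef _ _
  rw [h1, h2]
  refine coef_pd (Complex.ofRealCLM.contDiff.comp (contDiff_comp_apply hu j)) ?_ i p
  intro a n
  exact congrArg Complex.ofReal (hp.comp_apply j a n)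

lemma coef_add {E : Type*} [NormedAddCommGroup E] [NormedSpace ℂ E] {f g : R3 → E}
    (hf : Continuous f) (hg : Continuous g) (p : Fin 3 → ℤ) :
    coef (fun a => f a + g a) p = coef f p + coef g p := by
  have h1 : IntegrableOn (fun a => wave (-p) a • f a) box :=
    integrableOn_box ((continuous_wave _).smul hf)
  have h2 : IntegrableOn (fun a => wave (-p) a • g a) box :=
    integrableOn_box ((continuous_wave _).smul hg)
  simp only [coef, smul_add]
  rw [integral_add h1 h2, smul_add]

lemma coef_sub {E : Type*} [NormedAddCommGroup E] [NormedSpace ℂ E] {f g : R3 → E}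
    (hf : Continuous f) (hg : Continuous g) (p : Fin 3 → ℤ) :
    coef (fun a => f a - g a) p = coef f p - coef g p := by
  have h1 : IntegrableOn (fun a => wave (-p) a • f a) box :=
    integrableOn_box ((continuous_wave _).smul hf)
  have h2 : IntegrableOn (fun a => wave (-p) a • g a) box :=
    integrableOn_box ((continuous_wave _).smul hg)
  simp only [coef, smul_sub]
  rw [integral_sub h1 h2, smul_sub]

lemma coef_euclidean {n : ℕ} {f : R3 → EuclideanSpace ℂ (Fin n)} (hf : Continuous f)
    (p : Fin 3 → ℤ) (j : Fin n) : coef f p j = coef (fun a => f a j) p := by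
  have h := (EuclideanSpace.proj (𝕜 := ℂ) j : EuclideanSpace ℂ (Fin n) →L[ℂ] ℂ).integral_comp_comm
    (integrableOn_box ((continuous_wave (-p)).smul hf))
  simp only [coef, PiLp.smul_apply]
  congr 1
  exact h.symm

lemma continuous_curlDiv (hu : ContDiff ℝ 1 u) : Continuous (curlDiv u) := by
  refine (PiLp.continuous_toLp 2 _).comp (continuous_pi fun j => ?_)
  have h := continuous_pd hu
  fin_cases j
  · exact Complex.continuous_ofReal.comp ((h 1 2).sub (h 2 1))
  · exact Complex.continuous_ofReal.comp ((h 2 0).sub (h 0 2))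
  · exact Complex.continuous_ofReal.comp ((h 0 1).sub (h 1 0))
  · exact Complex.continuous_ofReal.comp (continuous_finsetSum _ fun i _ => h i i)

/-- The Fourier coefficients of the curl and of the divergence. -/
lemma coef_curlDiv (hu : ContDiff ℝ 1 u) (hp : IsPeriodic u) (p : Fin 3 → ℤ) :
    coef (curlDiv u) p = WithLp.toLp 2 ![
      Complex.I * (p 1 * vCoeff u p 2 - p 2 * vCoeff u p 1),
      Complex.I * (p 2 * vCoeff u p 0 - p 0 * vCoeff u p 2),
      Complex.I * (p 0 * vCoeff u p 1 - p 1 * vCoeff u p 0),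
      Complex.I * (p 0 * vCoeff u p 0 + p 1 * vCoeff u p 1 + p 2 * vCoeff u p 2)] := by
  have h := continuous_pd_ofReal hu
  have hc := coef_pd_apply hu hp
  ext j
  rw [coef_euclidean (continuous_curlDiv hu)]
  fin_cases j
  · simp [curlDiv, curl, coef_sub (h _ _) (h _ _), hc]; ring
  · simp [curlDiv, curl, coef_sub (h _ _) (h _ _), hc]; ring
  · simp [curlDiv, curl, coef_sub (h _ _) (h _ _), hc]; ring
  · have h1 : Continuous fun a => ((pd 0 (fun b => u b 0) a : ℝ) : ℂ) +
        ((pd 1 (fun b => u b 1) a : ℝ) : ℂ) := (h 0 0).add (h 1 1)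
    simp [curlDiv, divergence, Fin.sum_univ_three, coef_add h1 (h 2 2),
      coef_add (h 0 0) (h 1 1), hc]
    ring

/-- This isometry is why no constant is lost when a field is reconstructed from its curl and
divergence. -/
lemma norm_coef_curlDiv (hu : ContDiff ℝ 1 u) (hp : IsPeriodic u) (p : Fin 3 → ℤ) :
    ‖coef (curlDiv u) p‖ = waveNorm p * ‖vCoeff u p‖ := by
  rw [← sq_eq_sq₀ (norm_nonneg _) (mul_nonneg (waveNorm_nonneg p) (norm_nonneg _)), mul_pow,
    waveNorm_sq, norm_sq_eucl3, norm_sq_eucl4, coef_curlDiv hu hp]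
  have := normSq_cross_add_normSq_dot (fun i => (p i : ℝ)) (fun i => vCoeff u p i)
  rw [← this]
  simp [Complex.normSq_mul]

lemma norm_coef_pd_le (hu : ContDiff ℝ 1 u) (hp : IsPeriodic u) (i j : Fin 3) (p : Fin 3 → ℤ) :
    ‖coef (fun a => ((pd i (fun b => u b j) a : ℝ) : ℂ)) p‖ ≤ waveNorm p * ‖vCoeff u p‖ := by
  rw [coef_pd_apply hu hp, norm_mul, norm_mul, Complex.norm_I, one_mul, Complex.norm_intCast]
  exact mul_le_mul (abs_le_waveNorm p i) (PiLp.norm_apply_le _ j) (norm_nonneg _)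
    (waveNorm_nonneg p)

end Field

namespace WienerField

variable {u v w : R3 → R3}

lemma summable_pd (hu : WienerField u) (i j : Fin 3) :
    Summable fun p => ‖coef (fun a => ((pd i (fun b => u b j) a : ℝ) : ℂ)) p‖ :=
  Summable.of_nonneg_of_le (fun _ => norm_nonneg _)
    (norm_coef_pd_le hu.contDiff hu.periodic i j) hu.summable

lemma hasSum_pd (hu : WienerField u) (i j : Fin 3) (a : R3) :
    HasSum (fun p => wave p a * (Complex.I * (p i : ℂ) * vCoeff u p j))
      ((pd i (fun b => u b j) a : ℝ) : ℂ) := by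
  have h := hasSum_coef (continuous_pd_ofReal hu.contDiff i j)
    (fun a n => congrArg _ ((hu.periodic.comp_apply j).pd i a n)) (hu.summable_pd i j) a
  simpa only [coef_pd_apply hu.contDiff hu.periodic, smul_eq_mul] using h

lemma norm_pd_le (hu : WienerField u) (i j : Fin 3) (a : R3) :
    |pd i (fun b => u b j) a| ≤ gradMass u := by
  have h := hasSum_coef (continuous_pd_ofReal hu.contDiff i j)
    (fun a n => congrArg _ ((hu.periodic.comp_apply j).pd i a n)) (hu.summable_pd i j) a
  have hle := norm_coef_pd_le hu.contDiff hu.periodic i j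
  have h1 : ‖((pd i (fun b => u b j) a : ℝ) : ℂ)‖ ≤ gradMass u := by
    rw [← h.tsum_eq]
    refine tsum_of_norm_bounded hu.summable.hasSum fun p => ?_
    rw [norm_smul, norm_wave, one_mul]
    exact hle p
  simpa using h1

lemma summable_term (hu : WienerField u) (i j : Fin 3) (a : R3) :
    Summable fun p => ‖wave p a * (Complex.I * (p i : ℂ) * vCoeff u p j)‖ := by
  have := hu.summable_pd i j
  simpa only [coef_pd_apply hu.contDiff hu.periodic, norm_mul, norm_wave, one_mul] using this

lemma hasSum_pd_mul (hu : WienerField u) (hw : WienerField w) (i j k l : Fin 3) (a : R3) :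
    HasSum (fun x : (Fin 3 → ℤ) × (Fin 3 → ℤ) =>
      wave (x.1 + x.2) a * -((x.1 i * vCoeff u x.1 j) * (x.2 k * vCoeff w x.2 l)))
      (((pd i (fun b => u b j) a : ℝ) : ℂ) * ((pd k (fun b => w b l) a : ℝ) : ℂ)) := by
  have hs := summable_mul_of_summable_norm (hu.summable_term i j a) (hw.summable_term k l a)
  refine ((hu.hasSum_pd i j a).mul (hw.hasSum_pd k l a) hs).congr_fun fun x => ?_
  rw [wave_add]
  linear_combination -(wave x.1 a * wave x.2 a * (x.1 i * vCoeff u x.1 j) *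
    (x.2 k * vCoeff w x.2 l)) * Complex.I_sq

lemma hasSum_pd_mul_mul (hu : WienerField u) (hv : WienerField v) (hw : WienerField w)
    (i j k l m n : Fin 3) (a : R3) :
    HasSum (fun x : (Fin 3 → ℤ) × (Fin 3 → ℤ) × (Fin 3 → ℤ) =>
      wave (x.1 + (x.2.1 + x.2.2)) a * -(Complex.I * (x.1 i * vCoeff u x.1 j) *
        (x.2.1 k * vCoeff v x.2.1 l) * (x.2.2 m * vCoeff w x.2.2 n)))
      (((pd i (fun b => u b j) a : ℝ) : ℂ) * (((pd k (fun b => v b l) a : ℝ) : ℂ) *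
        ((pd m (fun b => w b n) a : ℝ) : ℂ))) := by
  have hs1 := (hv.summable_term k l a).mul_norm (hw.summable_term m n a)
  have hs := summable_mul_of_summable_norm (hu.summable_term i j a) hs1
  refine ((hu.hasSum_pd i j a).mul ((hv.hasSum_pd k l a).mul (hw.hasSum_pd m n a) hs1.of_norm)
    hs).congr_fun fun x => ?_
  rw [wave_add, wave_add]
  linear_combination -(wave x.1 a * wave x.2.1 a * wave x.2.2 a * (x.1 i * vCoeff u x.1 j) *
    (x.2.1 k * vCoeff v x.2.1 l) * (x.2.2 m * vCoeff w x.2.2 n)) *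
    (Complex.I * Complex.I_sq)

end WienerField

end

section

/-! ### The nonlinear terms of the recurrence relations -/

lemma HasSum.congr_both {ι M : Type*} [AddCommMonoid M] [TopologicalSpace M] {f g : ι → M}
    {x y : M} (h : HasSum f x) (hf : ∀ i, g i = f i) (hy : y = x) : HasSum g y := by
  rw [hy]; exact h.congr_fun hf

/-- The bilinear term `∑_k ∇u_k × ∇w_k` of the curl equation. -/
def curlQuad (u w : R3 → R3) (a : R3) : R3 :=
  ∑ k : Fin 3, crossProduct (grad (fun b => u b k) a) (grad (fun b => w b k) a)

/-- The bilinear term of the divergence equation. -/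
def divQuad (u w : R3 → R3) (a : R3) : ℝ :=
  ∑ ij : Fin 3 × Fin 3 with ij.1 < ij.2,
    (pd ij.2 (fun b => u b ij.1) a * pd ij.1 (fun b => w b ij.2) a -
      pd ij.1 (fun b => u b ij.1) a * pd ij.2 (fun b => w b ij.2) a)

/-- The trilinear term of the divergence equation. -/
def divTri (u v w : R3 → R3) (a : R3) : ℝ :=
  dotProduct (grad (fun b => u b 0) a)
    (crossProduct (grad (fun b => v b 1) a) (grad (fun b => w b 2) a))

section Explicit

variable (u v w : R3 → R3) (a : R3)

lemma sum_lt_fin3 {M : Type*} [AddCommMonoid M] (f : Fin 3 × Fin 3 → M) :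
    ∑ ij : Fin 3 × Fin 3 with ij.1 < ij.2, f ij = f (0, 1) + f (0, 2) + f (1, 2) := by
  have : (Finset.univ.filter fun ij : Fin 3 × Fin 3 => ij.1 < ij.2) =
      {(0, 1), (0, 2), (1, 2)} := by decide
  rw [this, Finset.sum_insert (by decide), Finset.sum_insert (by decide), Finset.sum_singleton,
    add_assoc]

lemma curlQuad_zero : curlQuad u w a 0 = ∑ k, (pd 1 (fun b => u b k) a * pd 2 (fun b => w b k) a -
    pd 2 (fun b => u b k) a * pd 1 (fun b => w b k) a) := by
  simp [curlQuad, grad, cross_apply]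

lemma curlQuad_one : curlQuad u w a 1 = ∑ k, (pd 2 (fun b => u b k) a * pd 0 (fun b => w b k) a -
    pd 0 (fun b => u b k) a * pd 2 (fun b => w b k) a) := by
  simp [curlQuad, grad, cross_apply]

lemma curlQuad_two : curlQuad u w a 2 = ∑ k, (pd 0 (fun b => u b k) a * pd 1 (fun b => w b k) a -
    pd 1 (fun b => u b k) a * pd 0 (fun b => w b k) a) := by
  simp [curlQuad, grad, cross_apply]

lemma divQuad_eq : divQuad u w a =
    (pd 1 (fun b => u b 0) a * pd 0 (fun b => w b 1) a -
      pd 0 (fun b => u b 0) a * pd 1 (fun b => w b 1) a) +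
    (pd 2 (fun b => u b 0) a * pd 0 (fun b => w b 2) a -
      pd 0 (fun b => u b 0) a * pd 2 (fun b => w b 2) a) +
    (pd 2 (fun b => u b 1) a * pd 1 (fun b => w b 2) a -
      pd 1 (fun b => u b 1) a * pd 2 (fun b => w b 2) a) := by
  rw [divQuad, sum_lt_fin3]

lemma divTri_eq : divTri u v w a =
    pd 0 (fun b => u b 0) a * (pd 1 (fun b => v b 1) a * pd 2 (fun b => w b 2) a -
      pd 2 (fun b => v b 1) a * pd 1 (fun b => w b 2) a) +
    pd 1 (fun b => u b 0) a * (pd 2 (fun b => v b 1) a * pd 0 (fun b => w b 2) a -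
      pd 0 (fun b => v b 1) a * pd 2 (fun b => w b 2) a) +
    pd 2 (fun b => u b 0) a * (pd 0 (fun b => v b 1) a * pd 1 (fun b => w b 2) a -
      pd 1 (fun b => v b 1) a * pd 0 (fun b => w b 2) a) := by
  simp [divTri, grad, cross_apply, dotProduct, Fin.sum_univ_three]

end Explicit

/-- The mean of `divTri` over the permutations of its arguments. -/
def symTri (u v w : R3 → R3) (a : R3) : ℝ :=
  (divTri u v w a + divTri v w u a + divTri w u v a + divTri u w v a + divTri v u w a +
    divTri w v u a) / 6

/-- The symmetrised bilinear terms of both equations. -/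
def quadVec (α : ℝ) (u w : R3 → R3) (a : R3) : EuclideanSpace ℂ (Fin 4) :=
  WithLp.toLp 2 ![((α * curlQuad u w a 0 : ℝ) : ℂ), ((α * curlQuad u w a 1 : ℝ) : ℂ),
    ((α * curlQuad u w a 2 : ℝ) : ℂ), (((divQuad u w a + divQuad w u a) / 2 : ℝ) : ℂ)]

/-- The symmetrised trilinear terms of both equations. -/
def triVec (u v w : R3 → R3) (a : R3) : EuclideanSpace ℂ (Fin 4) :=
  WithLp.toLp 2 ![0, 0, 0, (symTri u v w a : ℂ)]

/-- The pairs of a curl and a divergence of frequency `p` that belong to a field. -/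
def compat (p : Fin 3 → ℤ) : Submodule ℂ (EuclideanSpace ℂ (Fin 4)) where
  carrier := {c | (p 0 * c 0 + p 1 * c 1 + p 2 * c 2 : ℂ) = 0 ∧ (p = 0 → c = 0)}
  add_mem' := by
    rintro c d ⟨h1, h2⟩ ⟨g1, g2⟩
    refine ⟨?_, fun hp => by rw [h2 hp, g2 hp, add_zero]⟩
    simp only [PiLp.add_apply]
    linear_combination h1 + g1
  zero_mem' := by simp
  smul_mem' := by
    rintro k c ⟨h1, h2⟩
    refine ⟨?_, fun hp => by rw [h2 hp, smul_zero]⟩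
    simp only [PiLp.smul_apply, smul_eq_mul]
    linear_combination k * h1

lemma mem_compat {p : Fin 3 → ℤ} {c : EuclideanSpace ℂ (Fin 4)} :
    c ∈ compat p ↔ (p 0 * c 0 + p 1 * c 1 + p 2 * c 2 : ℂ) = 0 ∧ (p = 0 → c = 0) := Iff.rfl

/-- The amplitude of the interaction of two waves in `quadVec`. -/
def quadAmp (α : ℝ) (q r : Fin 3 → ℤ) (U W : EuclideanSpace ℂ (Fin 3)) :
    EuclideanSpace ℂ (Fin 4) :=
  WithLp.toLp 2 ![
    -(α * (U 0 * W 0 + U 1 * W 1 + U 2 * W 2)) * ((q 1 * r 2 - q 2 * r 1 : ℝ) : ℂ),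
    -(α * (U 0 * W 0 + U 1 * W 1 + U 2 * W 2)) * ((q 2 * r 0 - q 0 * r 2 : ℝ) : ℂ),
    -(α * (U 0 * W 0 + U 1 * W 1 + U 2 * W 2)) * ((q 0 * r 1 - q 1 * r 0 : ℝ) : ℂ),
    (((q 1 * r 2 - q 2 * r 1 : ℝ) : ℂ) * (U 1 * W 2 - U 2 * W 1) +
      ((q 2 * r 0 - q 0 * r 2 : ℝ) : ℂ) * (U 2 * W 0 - U 0 * W 2) +
      ((q 0 * r 1 - q 1 * r 0 : ℝ) : ℂ) * (U 0 * W 1 - U 1 * W 0)) / 2]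

/-- By Cauchy–Schwarz the curl part and the divergence part are each at most `|q||r||U||W|/2`, and
their squares add to one half of the squared product. Since `U · W` carries no conjugate, `U · W`
and `U × W` can both have modulus `|U||W|`, as for `U = (1, i, 0)`, `W = (1, -i, 0)`; hence they are
bounded separately. -/
lemma norm_quadAmp_le {α : ℝ} (hα : |α| ≤ 1 / 2) (q r : Fin 3 → ℤ)
    (U W : EuclideanSpace ℂ (Fin 3)) :
    ‖quadAmp α q r U W‖ ≤ (waveNorm q * ‖U‖) * (waveNorm r * ‖W‖) / √2 := by
  have hq := waveNorm_nonneg q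
  have hr := waveNorm_nonneg r
  refine abs_le_of_sq_le_sq' ?_ (by positivity) |>.2
  have hX := cross_sq_le (fun i => (q i : ℝ)) (fun i => (r i : ℝ))
  rw [← waveNorm_sq, ← waveNorm_sq] at hX
  have hS := normSq_dot_le U W
  have hY := normSq_cross_le U W
  have hXY := normSq_real_dot_le
    ![(q 1 * r 2 - q 2 * r 1 : ℝ), (q 2 * r 0 - q 0 * r 2 : ℝ), (q 0 * r 1 - q 1 * r 0 : ℝ)]
    ![U 1 * W 2 - U 2 * W 1, U 2 * W 0 - U 0 * W 2, U 0 * W 1 - U 1 * W 0]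
  rw [← norm_sq_eucl3, ← norm_sq_eucl3] at hS hY
  simp only [Matrix.cons_val_zero, Matrix.cons_val_one, Matrix.cons_val] at hXY
  have hα2 : α ^ 2 ≤ 1 / 4 := by
    have := sq_le_sq' (by linarith [abs_nonneg α]) hα
    rw [sq_abs] at this; linarith
  rw [norm_sq_eucl4, quadAmp, div_pow, Real.sq_sqrt (by norm_num : (0 : ℝ) ≤ 2), mul_pow, mul_pow,
    mul_pow]
  simp only [Matrix.cons_val_zero, Matrix.cons_val_one, Matrix.cons_val, Complex.normSq_mul,
    Complex.normSq_neg, Complex.normSq_ofReal, Complex.normSq_div, Complex.normSq_ofNat]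
  set X0 : ℝ := q 1 * r 2 - q 2 * r 1
  set X1 : ℝ := q 2 * r 0 - q 0 * r 2
  set X2 : ℝ := q 0 * r 1 - q 1 * r 0
  set S := Complex.normSq (U 0 * W 0 + U 1 * W 1 + U 2 * W 2)
  set Y := Complex.normSq (U 1 * W 2 - U 2 * W 1) + Complex.normSq (U 2 * W 0 - U 0 * W 2) +
    Complex.normSq (U 0 * W 1 - U 1 * W 0)
  set D := Complex.normSq ((X0 : ℂ) * (U 1 * W 2 - U 2 * W 1) + (X1 : ℂ) * (U 2 * W 0 - U 0 * W 2) +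
    (X2 : ℂ) * (U 0 * W 1 - U 1 * W 0))
  have hS0 : 0 ≤ S := Complex.normSq_nonneg _
  have hY0 : 0 ≤ Y :=
    add_nonneg (add_nonneg (Complex.normSq_nonneg _) (Complex.normSq_nonneg _))
      (Complex.normSq_nonneg _)
  have hXn : 0 ≤ X0 ^ 2 + X1 ^ 2 + X2 ^ 2 := by positivity
  calc _ = α ^ 2 * (S * (X0 ^ 2 + X1 ^ 2 + X2 ^ 2)) + D / 4 := by ring
    _ ≤ 1 / 4 * (S * (X0 ^ 2 + X1 ^ 2 + X2 ^ 2)) + ((X0 ^ 2 + X1 ^ 2 + X2 ^ 2) * Y) / 4 := by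
      gcongr
    _ = (X0 ^ 2 + X1 ^ 2 + X2 ^ 2) * ((S + Y) / 4) := by ring
    _ ≤ (waveNorm q ^ 2 * waveNorm r ^ 2) * ((‖U‖ ^ 2 * ‖W‖ ^ 2 + ‖U‖ ^ 2 * ‖W‖ ^ 2) / 4) := by
      gcongr
    _ = _ := by ring

/-- Solvability of the curl equation: `q × r` is orthogonal to `q + r`, and it vanishes when `r =
-q`. -/
lemma quadAmp_mem_compat (α : ℝ) (q r : Fin 3 → ℤ) (U W : EuclideanSpace ℂ (Fin 3)) :
    quadAmp α q r U W ∈ compat (q + r) := by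
  refine mem_compat.mpr ⟨?_, fun h => ?_⟩
  · simp [quadAmp]
    ring
  · have h' : ∀ i, (r i : ℝ) = -q i := fun i => by
      have := congrFun h i
      simp only [Pi.add_apply, Pi.zero_apply] at this
      have : r i = -q i := by linarith
      exact_mod_cast this
    ext j
    fin_cases j <;> simp [quadAmp, h', mul_comm]

lemma quadVec_waveBound {α : ℝ} (hα : |α| ≤ 1 / 2) {u w : R3 → R3} (hu : WienerField u)
    (hw : WienerField w) :
    WaveBound compat (quadVec α u w) (gradMass u * gradMass w / √2) := by
  have hs := hu.summable.mul_of_nonneg hw.summable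
    (fun p => mul_nonneg (waveNorm_nonneg p) (norm_nonneg _))
    (fun p => mul_nonneg (waveNorm_nonneg p) (norm_nonneg _))
  have hle := fun x : (Fin 3 → ℤ) × (Fin 3 → ℤ) =>
    norm_quadAmp_le hα x.1 x.2 (vCoeff u x.1) (vCoeff w x.2)
  have hb := Summable.of_nonneg_of_le (fun _ => norm_nonneg _) hle (hs.div_const _)
  refine WaveBound.of_family (fun x : (Fin 3 → ℤ) × (Fin 3 → ℤ) => x.1 + x.2)
    (fun x => quadAmp α x.1 x.2 (vCoeff u x.1) (vCoeff w x.2))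
    (fun x => quadAmp_mem_compat _ _ _ _ _) hb ?_ fun a => hasSum_euclidean fun j => ?_
  · refine (hb.tsum_le_tsum hle (hs.div_const _)).trans ?_
    rw [tsum_div_const, ← hu.summable.tsum_mul_tsum hw.summable hs]
    rfl
  · have P := fun i k l => hu.hasSum_pd_mul hw i k l k a
    have Q := fun i j k l => hu.hasSum_pd_mul hw i j k l a
    fin_cases j
    · refine HasSum.congr_both (((((P 1 0 2).sub (P 2 0 1)).add ((P 1 1 2).sub (P 2 1 1))).add
        ((P 1 2 2).sub (P 2 2 1))).mul_left (α : ℂ)) (fun x => ?_) ?_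
      · simp [quadAmp]; ring
      · simp [quadVec, curlQuad_zero, Fin.sum_univ_three]; left; ring
    · refine HasSum.congr_both (((((P 2 0 0).sub (P 0 0 2)).add ((P 2 1 0).sub (P 0 1 2))).add
        ((P 2 2 0).sub (P 0 2 2))).mul_left (α : ℂ)) (fun x => ?_) ?_
      · simp [quadAmp]; ring
      · simp [quadVec, curlQuad_one, Fin.sum_univ_three]; left; ring
    · refine HasSum.congr_both (((((P 0 0 1).sub (P 1 0 0)).add ((P 0 1 1).sub (P 1 1 0))).add
        ((P 0 2 1).sub (P 1 2 0))).mul_left (α : ℂ)) (fun x => ?_) ?_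
      · simp [quadAmp]; ring
      · simp [quadVec, curlQuad_two, Fin.sum_univ_three]; left; ring
    -- The divergence term is symmetrised in the two fields; summed over `i < j`, the four products
    -- per pair collapse to `(q × r) · (U × W)`.
    · have R := fun i j => (((Q j i i j).sub (Q i i j j)).add ((Q i j j i).sub (Q j j i i)))
      refine HasSum.congr_both ((((R 0 1).add (R 0 2)).add (R 1 2)).mul_left (2⁻¹ : ℂ))
        (fun x => ?_) ?_
      · simp [quadAmp]; ring
      · simp [quadVec, divQuad_eq]; ring

/-- The amplitude of the interaction of three waves in `triVec`. -/
def triAmp (q r k : Fin 3 → ℤ) (U V W : EuclideanSpace ℂ (Fin 3)) : EuclideanSpace ℂ (Fin 4) :=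
  WithLp.toLp 2 ![0, 0, 0, -Complex.I / 6 *
    ((q 0 * (r 1 * k 2 - r 2 * k 1) + q 1 * (r 2 * k 0 - r 0 * k 2) +
      q 2 * (r 0 * k 1 - r 1 * k 0) : ℝ) : ℂ) *
    (U 0 * (V 1 * W 2 - V 2 * W 1) + U 1 * (V 2 * W 0 - V 0 * W 2) +
      U 2 * (V 0 * W 1 - V 1 * W 0))]

/-- Averaging over the six permutations of the fields separates frequencies from amplitudes: what
remains is `det(q, r, k) det(U, V, W) / 6`, and each determinant is bounded by the product of the
lengths of its vectors. -/
lemma norm_triAmp_le (q r k : Fin 3 → ℤ) (U V W : EuclideanSpace ℂ (Fin 3)) :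
    ‖triAmp q r k U V W‖ ≤
      (waveNorm q * ‖U‖) * ((waveNorm r * ‖V‖) * (waveNorm k * ‖W‖)) / 6 := by
  have hq := waveNorm_nonneg q
  have hr := waveNorm_nonneg r
  have hk := waveNorm_nonneg k
  refine abs_le_of_sq_le_sq' ?_ (by positivity) |>.2
  have h1 := cross_sq_le (fun i => (r i : ℝ)) (fun i => (k i : ℝ))
  have h2 := dot_sq_le (fun i => (q i : ℝ))
    ![(r 1 * k 2 - r 2 * k 1 : ℝ), (r 2 * k 0 - r 0 * k 2 : ℝ), (r 0 * k 1 - r 1 * k 0 : ℝ)]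
  have h3 := normSq_cross_le V W
  have h4 := normSq_dot_le U ![V 1 * W 2 - V 2 * W 1, V 2 * W 0 - V 0 * W 2, V 0 * W 1 - V 1 * W 0]
  rw [← norm_sq_eucl3, ← norm_sq_eucl3] at h3
  rw [← norm_sq_eucl3] at h4
  rw [← waveNorm_sq, ← waveNorm_sq] at h1
  rw [← waveNorm_sq] at h2
  simp only [Matrix.cons_val_zero, Matrix.cons_val_one, Matrix.cons_val] at h2 h4
  have h5 := h2.trans (mul_le_mul_of_nonneg_left h1 (sq_nonneg _))
  have h6 := h4.trans (mul_le_mul_of_nonneg_left h3 (sq_nonneg _))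
  rw [norm_sq_eucl4, triAmp]
  simp only [Matrix.cons_val_zero, Matrix.cons_val_one, Matrix.cons_val, Complex.normSq_mul,
    Complex.normSq_neg, Complex.normSq_ofReal, Complex.normSq_div, Complex.normSq_ofNat,
    Complex.normSq_I, Complex.normSq_zero, zero_add, ← sq]
  refine (mul_le_mul (mul_le_mul_of_nonneg_left h5 (by norm_num)) h6 (Complex.normSq_nonneg _)
    (by positivity)).trans (le_of_eq (by ring))

/-- Only the zero mode needs an argument: if `q + r + k = 0`, the three frequencies are linearly
dependent and their determinant vanishes. -/
lemma triAmp_mem_compat (q r k : Fin 3 → ℤ) (U V W : EuclideanSpace ℂ (Fin 3)) :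
    triAmp q r k U V W ∈ compat (q + (r + k)) := by
  refine mem_compat.mpr ⟨by simp [triAmp], fun h => ?_⟩
  have h' : ∀ i, (q i : ℝ) = -(r i + k i) := fun i => by
    have := congrFun h i
    simp only [Pi.add_apply, Pi.zero_apply] at this
    have : q i = -(r i + k i) := by linarith
    exact_mod_cast this
  have h0 : (q 0 * (r 1 * k 2 - r 2 * k 1) + q 1 * (r 2 * k 0 - r 0 * k 2) +
      q 2 * (r 0 * k 1 - r 1 * k 0) : ℝ) = 0 := by
    rw [h', h', h']; ring
  ext j
  fin_cases j
  · simp [triAmp]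
  · simp [triAmp]
  · simp [triAmp]
  · simp [triAmp, -Complex.ofReal_add, -Complex.ofReal_mul, -Complex.ofReal_sub, h0]

lemma triVec_waveBound {u v w : R3 → R3} (hu : WienerField u) (hv : WienerField v)
    (hw : WienerField w) :
    WaveBound compat (triVec u v w) (gradMass u * (gradMass v * gradMass w) / 6) := by
  have hn : ∀ f : R3 → R3, ∀ p, 0 ≤ waveNorm p * ‖vCoeff f p‖ := fun f p =>
    mul_nonneg (waveNorm_nonneg p) (norm_nonneg _)
  have hs1 := hv.summable.mul_of_nonneg hw.summable (hn v) (hn w)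
  have hs := hu.summable.mul_of_nonneg hs1 (hn u) (fun x => mul_nonneg (hn v _) (hn w _))
  have hle := fun x : (Fin 3 → ℤ) × (Fin 3 → ℤ) × (Fin 3 → ℤ) =>
    norm_triAmp_le x.1 x.2.1 x.2.2 (vCoeff u x.1) (vCoeff v x.2.1) (vCoeff w x.2.2)
  have hb := Summable.of_nonneg_of_le (fun _ => norm_nonneg _) hle (hs.div_const _)
  refine WaveBound.of_family
    (fun x : (Fin 3 → ℤ) × (Fin 3 → ℤ) × (Fin 3 → ℤ) => x.1 + (x.2.1 + x.2.2))
    (fun x => triAmp x.1 x.2.1 x.2.2 (vCoeff u x.1) (vCoeff v x.2.1) (vCoeff w x.2.2))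
    (fun x => triAmp_mem_compat _ _ _ _ _ _) hb ?_ fun a => hasSum_euclidean fun j => ?_
  · refine (hb.tsum_le_tsum hle (hs.div_const _)).trans ?_
    rw [tsum_div_const, ← hu.summable.tsum_mul_tsum hs1 hs,
      ← hv.summable.tsum_mul_tsum hw.summable hs1]
    rfl
  · fin_cases j
    · simp [triAmp, triVec]
    · simp [triAmp, triVec]
    · simp [triAmp, triVec]
    · have P := fun i j k l m n => hu.hasSum_pd_mul_mul hv hw i j k l m n a
      have R := fun j l n => (((P 0 j 1 l 2 n).sub (P 0 j 2 l 1 n)).add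
        ((P 1 j 2 l 0 n).sub (P 1 j 0 l 2 n))).add ((P 2 j 0 l 1 n).sub (P 2 j 1 l 0 n))
      refine HasSum.congr_both (((((R 0 1 2).sub (R 0 2 1)).add ((R 1 2 0).sub (R 1 0 2))).add
        ((R 2 0 1).sub (R 2 1 0))).mul_left (6⁻¹ : ℂ)) (fun x => ?_) ?_
      · simp [triAmp]; ring
      · simp [triVec, symTri, divTri_eq]; ring

end

section

open Finset

/-! ### Sums over antidiagonals -/

section Antidiagonal

variable {M : Type*} [AddCommMonoid M]

/-- Terms of order 0 vanish, so the sums of the recurrence become full Cauchy products, the form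
needed both for symmetrisation and for multiplying power series. -/
lemma sum_Ioo_eq_antidiagonal (F : ℕ → ℕ → M) (h1 : ∀ n, F 0 n = 0) (h2 : ∀ n, F n 0 = 0)
    (s : ℕ) : ∑ m ∈ Ioo 0 s, F m (s - m) = ∑ x ∈ antidiagonal s, F x.1 x.2 := by
  rw [Nat.sum_antidiagonal_eq_sum_range_succ F]
  refine sum_subset (fun m hm => ?_) fun m hm hm' => ?_
  · simp only [mem_Ioo, mem_range] at *; omega
  · simp only [mem_Ioo, mem_range, not_and, not_lt] at *
    rcases Nat.eq_zero_or_pos m with rfl | h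
    · exact h1 _
    · rw [show s - m = 0 by have := hm' h; omega, h2]

lemma sum_Ioo_Ioo_eq_antidiagonal (F : ℕ → ℕ → ℕ → M) (h1 : ∀ m n, F 0 m n = 0)
    (h2 : ∀ l n, F l 0 n = 0) (h3 : ∀ l m, F l m 0 = 0) (s : ℕ) :
    ∑ l ∈ Ioo 0 s, ∑ m ∈ Ioo 0 (s - l), F l m (s - l - m) =
      ∑ x ∈ antidiagonal s, ∑ y ∈ antidiagonal x.2, F x.1 y.1 y.2 := by
  rw [sum_Ioo_eq_antidiagonal (fun l r => ∑ m ∈ Ioo 0 r, F l m (r - m))]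
  · exact sum_congr rfl fun x _ => sum_Ioo_eq_antidiagonal (F x.1) (h2 _) (h3 _) _
  · simp [h1]
  · simp

lemma sum_antidiagonal_rotate (F : ℕ → ℕ → ℕ → M) (s : ℕ) :
    ∑ x ∈ antidiagonal s, ∑ y ∈ antidiagonal x.2, F x.1 y.1 y.2 =
      ∑ x ∈ antidiagonal s, ∑ y ∈ antidiagonal x.2, F y.1 y.2 x.1 := by
  rw [sum_sigma', sum_sigma']
  refine sum_nbij' (fun z => ⟨(z.2.2, z.1.1 + z.2.1), (z.1.1, z.2.1)⟩)
    (fun z => ⟨(z.2.1, z.2.2 + z.1.1), (z.2.2, z.1.1)⟩) ?_ ?_ ?_ ?_ ?_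
  · rintro ⟨⟨a, b⟩, c, d⟩; simp; omega
  · rintro ⟨⟨a, b⟩, c, d⟩; simp; omega
  · rintro ⟨⟨a, b⟩, c, d⟩; simp +contextual
  · rintro ⟨⟨a, b⟩, c, d⟩; simp +contextual
  · rintro ⟨⟨a, b⟩, c, d⟩; simp

lemma sum_antidiagonal_inner_swap (F : ℕ → ℕ → ℕ → M) (s : ℕ) :
    ∑ x ∈ antidiagonal s, ∑ y ∈ antidiagonal x.2, F x.1 y.1 y.2 =
      ∑ x ∈ antidiagonal s, ∑ y ∈ antidiagonal x.2, F x.1 y.2 y.1 :=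
  sum_congr rfl fun x _ => (Nat.sum_antidiagonal_swap (f := fun y => F x.1 y.1 y.2)).symm

lemma sum_antidiagonal_symm2 (F : ℕ → ℕ → ℝ) (s : ℕ) :
    ∑ x ∈ antidiagonal s, F x.1 x.2 = ∑ x ∈ antidiagonal s, (F x.1 x.2 + F x.2 x.1) / 2 := by
  have h := Nat.sum_antidiagonal_swap (n := s) (f := fun y => F y.1 y.2)
  simp only [Prod.fst_swap, Prod.snd_swap] at h
  rw [← sum_div, sum_add_distrib, h]
  ring

/-- Rotations of the three indices and the exchange of the inner two generate all six permutations.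
-/
lemma sum_antidiagonal_symm3 (F : ℕ → ℕ → ℕ → ℝ) (s : ℕ) :
    ∑ x ∈ antidiagonal s, ∑ y ∈ antidiagonal x.2, F x.1 y.1 y.2 =
      ∑ x ∈ antidiagonal s, ∑ y ∈ antidiagonal x.2, (F x.1 y.1 y.2 + F y.1 y.2 x.1 +
        F y.2 x.1 y.1 + F x.1 y.2 y.1 + F y.1 x.1 y.2 + F y.2 y.1 x.1) / 6 := by
  have h1 := sum_antidiagonal_rotate F s
  have h2 := sum_antidiagonal_rotate (fun l m n => F m n l) s
  have h3 := sum_antidiagonal_inner_swap F s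
  have h4 := sum_antidiagonal_inner_swap (fun l m n => F m n l) s
  have h5 := sum_antidiagonal_inner_swap (fun l m n => F n l m) s
  simp only [← sum_div, sum_add_distrib]
  rw [← h3, ← h4, ← h5, ← h2, ← h1]
  ring

end Antidiagonal

/-! ### The right-hand sides of the recurrence relations -/

section RHS

variable {u v w : R3 → R3} {η : ℕ → R3 → R3} (v0 : R3 → R3)

lemma pd_zero_apply (i j : Fin 3) (a : R3) : pd i (fun b => (0 : R3 → R3) b j) a = 0 := by
  simp [pd]

lemma curlQuad_zero_left (w : R3 → R3) (a : R3) : curlQuad 0 w a = 0 := by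
  ext i
  fin_cases i
  · simp [curlQuad_zero, pd_zero_apply, -Pi.zero_apply, -Pi.ofNat_apply]; rfl
  · simp [curlQuad_one, pd_zero_apply, -Pi.zero_apply, -Pi.ofNat_apply]; rfl
  · simp [curlQuad_two, pd_zero_apply, -Pi.zero_apply, -Pi.ofNat_apply]; rfl

lemma curlQuad_antisymm (u w : R3 → R3) (a : R3) : curlQuad w u a = -curlQuad u w a := by
  ext i
  fin_cases i
  · simp only [Fin.zero_eta, Pi.neg_apply, curlQuad_zero, Fin.sum_univ_three]; ring
  · simp only [Fin.mk_one, Pi.neg_apply, curlQuad_one, Fin.sum_univ_three]; ring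
  · simp only [Fin.reduceFinMk, Pi.neg_apply, curlQuad_two, Fin.sum_univ_three]; ring

lemma curlQuad_zero_right (u : R3 → R3) (a : R3) : curlQuad u 0 a = 0 := by
  rw [curlQuad_antisymm, curlQuad_zero_left, neg_zero]

lemma divQuad_zero_left (w : R3 → R3) (a : R3) : divQuad 0 w a = 0 := by
  simp [divQuad_eq, pd_zero_apply, -Pi.zero_apply, -Pi.ofNat_apply]

lemma divQuad_zero_right (u : R3 → R3) (a : R3) : divQuad u 0 a = 0 := by
  simp [divQuad_eq, pd_zero_apply, -Pi.zero_apply, -Pi.ofNat_apply]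

lemma divTri_of_zero {u v w : R3 → R3} (h : u = 0 ∨ v = 0 ∨ w = 0) (a : R3) :
    divTri u v w a = 0 := by
  rcases h with rfl | rfl | rfl <;>
    simp [divTri_eq, pd_zero_apply, -Pi.zero_apply, -Pi.ofNat_apply]

lemma curlRHS_eq (h0 : η 0 = 0) (s : ℕ) (a : R3) : curlRHS v0 η s a =
    (if s = 1 then curl v0 a else 0) -
      ∑ x ∈ antidiagonal s, ((x.1 : ℝ) / s) • curlQuad (η x.1) (η x.2) a := by
  rw [curlRHS, sum_comm, ← sum_Ioo_eq_antidiagonal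
    (fun m n => ((m : ℝ) / s) • curlQuad (η m) (η n) a) (by simp)
    (by simp [h0, curlQuad_zero_right])]
  simp only [← smul_sum]
  rfl

/-- `curlQuad` is antisymmetric, so only the antisymmetric part `(m - n)/(2s)` of the weight `m/s`
contributes. Its modulus is at most 1/2 instead of 1, which both critical times depend on. -/
lemma curlRHS_apply (h0 : η 0 = 0) (s : ℕ) (a : R3) (i : Fin 3) : curlRHS v0 η s a i =
    (if s = 1 then curl v0 a i else 0) +
      ∑ x ∈ antidiagonal s, (((x.2 : ℝ) - x.1) / (2 * s)) * curlQuad (η x.1) (η x.2) a i := by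
  rw [curlRHS_eq v0 h0, Pi.sub_apply, Finset.sum_apply, sub_eq_add_neg]
  congr 1
  · split_ifs <;> rfl
  · simp only [Pi.smul_apply, smul_eq_mul]
    rw [sum_antidiagonal_symm2 (fun m n => (m : ℝ) / s * curlQuad (η m) (η n) a i),
      ← sum_neg_distrib]
    refine sum_congr rfl fun x _ => ?_
    rw [curlQuad_antisymm (η x.1) (η x.2), Pi.neg_apply]
    ring

lemma divRHS_eq (h0 : η 0 = 0) (s : ℕ) (a : R3) : divRHS η s a =
    ∑ x ∈ antidiagonal s, divQuad (η x.1) (η x.2) a -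
      ∑ x ∈ antidiagonal s, ∑ y ∈ antidiagonal x.2, divTri (η x.1) (η y.1) (η y.2) a := by
  rw [divRHS, sum_comm, ← sum_Ioo_eq_antidiagonal (fun m n => divQuad (η m) (η n) a)
    (by simp [h0, divQuad_zero_left]) (by simp [h0, divQuad_zero_right]),
    ← sum_Ioo_Ioo_eq_antidiagonal (fun l m n => divTri (η l) (η m) (η n) a)
    (fun m n => divTri_of_zero (by simp [h0]) a) (fun m n => divTri_of_zero (by simp [h0]) a)
    (fun m n => divTri_of_zero (by simp [h0]) a)]
  rfl

/-- Both right-hand sides of the recurrence relations as one complex vector. -/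
def recVec (η : ℕ → R3 → R3) (s : ℕ) (a : R3) : EuclideanSpace ℂ (Fin 4) :=
  WithLp.toLp 2 ![(curlRHS v0 η s a 0 : ℂ), (curlRHS v0 η s a 1 : ℂ), (curlRHS v0 η s a 2 : ℂ),
    (divRHS η s a : ℂ)]

lemma recVec_eq (h0 : η 0 = 0) {s : ℕ} (hs : s ≠ 1) (a : R3) : recVec v0 η s a =
    ∑ x ∈ antidiagonal s, quadVec (((x.2 : ℝ) - x.1) / (2 * s)) (η x.1) (η x.2) a -
      ∑ x ∈ antidiagonal s, ∑ y ∈ antidiagonal x.2, triVec (η x.1) (η y.1) (η y.2) a := by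
  ext j
  simp only [PiLp.sub_apply, WithLp.ofLp_sum, Finset.sum_apply]
  fin_cases j
  · simp [recVec, quadVec, triVec, curlRHS_apply v0 h0, hs]
  · simp [recVec, quadVec, triVec, curlRHS_apply v0 h0, hs]
  · simp [recVec, quadVec, triVec, curlRHS_apply v0 h0, hs]
  · have h2 := sum_antidiagonal_symm2 (fun m n => divQuad (η m) (η n) a) s
    have h3 := sum_antidiagonal_symm3 (fun l m n => divTri (η l) (η m) (η n) a) s
    simp only [recVec, quadVec, triVec, divRHS_eq h0, h2, h3]
    simp only [Fin.reduceFinMk, Matrix.cons_val, Complex.ofReal_sub, Complex.ofReal_sum]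
    rfl

lemma abs_antidiagonal_ratio_le {s : ℕ} {x : ℕ × ℕ} (hx : x ∈ antidiagonal s) :
    |((x.2 : ℝ) - x.1) / (2 * s)| ≤ 1 / 2 := by
  rw [HasAntidiagonal.mem_antidiagonal] at hx
  have h1 : (s : ℝ) = x.1 + x.2 := by exact_mod_cast hx.symm
  have h2 : (0 : ℝ) ≤ x.1 := Nat.cast_nonneg _
  have h3 : (0 : ℝ) ≤ x.2 := Nat.cast_nonneg _
  rcases Nat.eq_zero_or_pos s with h | h
  · simp [h]
  · have hs : (0 : ℝ) < s := by exact_mod_cast h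
    rw [abs_div, abs_of_pos (by positivity : (0 : ℝ) < 2 * s), div_le_div_iff₀ (by positivity)
      (by norm_num)]
    have : |(x.2 : ℝ) - x.1| ≤ s := by rw [abs_le]; constructor <;> linarith
    linarith

/-- The bounds on the right-hand sides of the recurrence relations. -/
lemma recVec_waveBound (h0 : η 0 = 0) (hη : ∀ m, WienerField (η m)) {s : ℕ} (hs : s ≠ 1) :
    WaveBound compat (recVec v0 η s)
      (∑ x ∈ antidiagonal s, gradMass (η x.1) * gradMass (η x.2) / √2 +
        ∑ x ∈ antidiagonal s, ∑ y ∈ antidiagonal x.2,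
          gradMass (η x.1) * (gradMass (η y.1) * gradMass (η y.2)) / 6) := by
  rw [funext (recVec_eq v0 h0 hs)]
  refine WaveBound.sub (WaveBound.sum _ fun x hx => ?_)
    (WaveBound.sum _ fun x _ => WaveBound.sum _ fun y _ => ?_)
  · exact quadVec_waveBound (abs_antidiagonal_ratio_le hx) (hη _) (hη _)
  · exact triVec_waveBound (hη _) (hη _) (hη _)

end RHS

end

section

/-! ### Fields with given curl and divergence -/

lemma WienerField.of_curlDiv {u : R3 → R3} (hu : ContDiff ℝ 1 u) (hp : IsPeriodic u)
    (hs : Summable fun p => ‖coef (curlDiv u) p‖) : WienerField u :=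
  ⟨hu, hp, by simpa only [norm_coef_curlDiv hu hp] using hs⟩

lemma gradMass_eq {u : R3 → R3} (hu : ContDiff ℝ 1 u) (hp : IsPeriodic u) :
    gradMass u = ∑' p, ‖coef (curlDiv u) p‖ := by
  simp only [norm_coef_curlDiv hu hp, gradMass]

lemma vCoeff_zero (p : Fin 3 → ℤ) : vCoeff 0 p = 0 := by
  ext j; simp [vCoeff, fCoeff]

lemma gradMass_zero : gradMass 0 = 0 := by
  simp [gradMass, vCoeff_zero]

lemma WienerField.zero : WienerField 0 where
  contDiff := contDiff_const
  periodic _ _ := rfl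
  summable := by simp [vCoeff_zero]

lemma pd_sub_apply {u w : R3 → R3} (hu : ContDiff ℝ 1 u) (hw : ContDiff ℝ 1 w) (i j : Fin 3)
    (a : R3) : pd i (fun b => (u - w) b j) a =
      pd i (fun b => u b j) a - pd i (fun b => w b j) a := by
  simp only [pd, Pi.sub_apply]
  rw [fderiv_fun_sub (differentiable_comp_apply hu j a) (differentiable_comp_apply hw j a)]
  rfl

lemma curlDiv_sub {u w : R3 → R3} (hu : ContDiff ℝ 1 u) (hw : ContDiff ℝ 1 w) (a : R3) :
    curlDiv (u - w) a = curlDiv u a - curlDiv w a := by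
  have h := pd_sub_apply hu hw
  ext j
  fin_cases j
  · simp [curlDiv, curl, h, -Pi.sub_apply]; ring
  · simp [curlDiv, curl, h, -Pi.sub_apply]; ring
  · simp [curlDiv, curl, h, -Pi.sub_apply]; ring
  · simp [curlDiv, divergence, h, -Pi.sub_apply]

lemma vCoeff_sub {u w : R3 → R3} (hu : Continuous u) (hw : Continuous w) (p : Fin 3 → ℤ) :
    vCoeff (u - w) p = vCoeff u p - vCoeff w p := by
  ext j
  have h1 := coef_sub (f := fun a => (u a j : ℂ)) (g := fun a => (w a j : ℂ))
    (Complex.continuous_ofReal.comp ((continuous_apply j).comp hu))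
    (Complex.continuous_ofReal.comp ((continuous_apply j).comp hw)) p
  simpa [vCoeff, fCoeff_eq_coef] using h1

/-- A periodic field is determined by its curl, its divergence, and its mean. -/
lemma eq_of_curlDiv_eq {u w : R3 → R3} (hu : ContDiff ℝ 1 u) (hw : ContDiff ℝ 1 w)
    (hpu : IsPeriodic u) (hpw : IsPeriodic w) (h : curlDiv u = curlDiv w)
    (h0 : vCoeff u 0 = vCoeff w 0) : u = w := by
  have hd : ContDiff ℝ 1 (u - w) := hu.sub hw
  have hp : IsPeriodic (u - w) := fun a n => congrArg₂ (· - ·) (hpu a n) (hpw a n)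
  have hz : ∀ p, vCoeff (u - w) p = 0 := by
    intro p
    by_cases hp0 : p = 0
    · rw [hp0, vCoeff_sub hu.continuous hw.continuous, h0, sub_self]
    · have h1 := norm_coef_curlDiv hd hp p
      have h2 : curlDiv (u - w) = fun _ => 0 := funext fun a => by
        rw [curlDiv_sub hu hw, h, sub_self]
      have h3 : coef (curlDiv (u - w)) p = 0 := by rw [h2]; simp [coef]
      rw [h3, norm_zero, eq_comm, mul_eq_zero, norm_eq_zero] at h1
      exact h1.resolve_left (zero_lt_one.trans_le (one_le_waveNorm hp0)).ne'
  rw [← sub_eq_zero]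
  ext a j
  have hj := coef_injective (f := fun a => ((u - w) a j : ℂ))
    (Complex.continuous_ofReal.comp ((continuous_apply j).comp hd.continuous))
    (fun a n => congrArg Complex.ofReal (hp.comp_apply j a n))
    (fun p => by rw [← fCoeff_eq_coef]; exact congrArg (fun c => c.ofLp j) (hz p))
  exact Complex.ofReal_eq_zero.mp (congrFun hj a)

/-- The Fourier coefficient at `p` of the field with curl and divergence given by `c`. -/
def biotSavart (p : Fin 3 → ℤ) (c : EuclideanSpace ℂ (Fin 4)) : EuclideanSpace ℂ (Fin 3) :=
  (-Complex.I / ((waveNorm p ^ 2 : ℝ) : ℂ)) • WithLp.toLp 2 ![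
    p 0 * c 3 - (p 1 * c 2 - p 2 * c 1),
    p 1 * c 3 - (p 2 * c 0 - p 0 * c 2),
    p 2 * c 3 - (p 0 * c 1 - p 1 * c 0)]

/-- For `p ≠ 0` this is `p × (p × c) = p (p · c) - |p|² c`, where `p · c = 0` is the first condition
in `compat`. At `p = 0` both sides vanish by the second condition. -/
lemma biotSavart_spec {p : Fin 3 → ℤ} {c : EuclideanSpace ℂ (Fin 4)} (hc : c ∈ compat p) :
    Complex.I * (p 1 * biotSavart p c 2 - p 2 * biotSavart p c 1) = c 0 ∧
    Complex.I * (p 2 * biotSavart p c 0 - p 0 * biotSavart p c 2) = c 1 ∧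
    Complex.I * (p 0 * biotSavart p c 1 - p 1 * biotSavart p c 0) = c 2 ∧
    Complex.I * (p 0 * biotSavart p c 0 + p 1 * biotSavart p c 1 + p 2 * biotSavart p c 2) =
      c 3 := by
  obtain ⟨h1, h2⟩ := hc
  by_cases hp : p = 0
  · rw [h2 hp, hp]; simp
  · have hn : waveNorm p ^ 2 ≠ 0 :=
      pow_ne_zero 2 (zero_lt_one.trans_le (one_le_waveNorm hp)).ne'
    have hn' : ((p 0 : ℂ) ^ 2 + (p 1 : ℂ) ^ 2 + (p 2 : ℂ) ^ 2) ≠ 0 := by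
      rw [waveNorm_sq] at hn
      exact_mod_cast hn
    have hI := Complex.I_sq
    have e : ((waveNorm p ^ 2 : ℝ) : ℂ) = (p 0 : ℂ) ^ 2 + (p 1 : ℂ) ^ 2 + (p 2 : ℂ) ^ 2 := by
      rw [waveNorm_sq]; push_cast; rfl
    simp only [biotSavart, e, PiLp.smul_apply, smul_eq_mul, Matrix.cons_val_zero,
      Matrix.cons_val_one, Matrix.cons_val]
    refine ⟨?_, ?_, ?_, ?_⟩ <;> field_simp <;> rw [hI]
    · linear_combination -(p 0 : ℂ) * h1
    · linear_combination -(p 1 : ℂ) * h1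
    · linear_combination -(p 2 : ℂ) * h1
    · ring

lemma waveNorm_mul_norm_biotSavart {p : Fin 3 → ℤ} {c : EuclideanSpace ℂ (Fin 4)}
    (hc : c ∈ compat p) : waveNorm p * ‖biotSavart p c‖ = ‖c‖ := by
  rw [← sq_eq_sq₀ (mul_nonneg (waveNorm_nonneg p) (norm_nonneg _)) (norm_nonneg _), mul_pow,
    waveNorm_sq, norm_sq_eucl3, norm_sq_eucl4]
  have := normSq_cross_add_normSq_dot (fun i => (p i : ℝ)) (fun i => biotSavart p c i)
  obtain ⟨h0, h1, h2, h3⟩ := biotSavart_spec hc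
  rw [← this, ← h0, ← h1, ← h2, ← h3]
  simp [Complex.normSq_mul]

/-- The zero mode is set to zero, which makes the constructed field mean-free. -/
lemma biotSavart_zero (c : EuclideanSpace ℂ (Fin 4)) : biotSavart 0 c = 0 := by
  ext j
  fin_cases j <;> simp [biotSavart]

lemma norm_biotSavart_le {p : Fin 3 → ℤ} {c : EuclideanSpace ℂ (Fin 4)}
    (hc : c ∈ compat p) : ‖biotSavart p c‖ ≤ ‖c‖ := by
  by_cases hp : p = 0
  · rw [hp, biotSavart_zero, norm_zero]; exact norm_nonneg _
  · rw [← waveNorm_mul_norm_biotSavart hc]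
    exact le_mul_of_one_le_left (norm_nonneg _) (one_le_waveNorm hp)

/-- `R3` carries the sup norm, so an operator norm is bounded by the sum of the values on the basis.
The factors 3 in the derivative bounds come from here. -/
lemma norm_clm_le_sum {F : Type*} [NormedAddCommGroup F] [NormedSpace ℝ F] (L : R3 →L[ℝ] F) :
    ‖L‖ ≤ ∑ i, ‖L (Pi.single i 1)‖ := by
  refine L.opNorm_le_bound (Finset.sum_nonneg fun _ _ => norm_nonneg _) fun x => ?_
  have hx : x = ∑ i, x i • (Pi.single i (1 : ℝ) : R3) := by
    ext j; simp [Finset.sum_apply, Pi.single_apply]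
  conv_lhs => rw [hx, map_sum]
  rw [Finset.sum_mul]
  refine norm_sum_le_of_le _ fun i _ => ?_
  rw [map_smul, norm_smul, mul_comm]
  exact mul_le_mul_of_nonneg_left (norm_le_pi_norm x i) (norm_nonneg _)

lemma norm_fderiv_wave_le (p : Fin 3 → ℤ) (a : R3) : ‖fderiv ℝ (wave p) a‖ ≤ 3 * waveNorm p := by
  refine (norm_clm_le_sum _).trans ?_
  have h : ∀ i : Fin 3, ‖fderiv ℝ (wave p) a (Pi.single i 1)‖ ≤ waveNorm p := fun i => by
    have := pd_wave p i a
    rw [pd] at this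
    rw [this, norm_mul, norm_mul, Complex.norm_I, one_mul, norm_wave, mul_one,
      Complex.norm_intCast]
    exact abs_le_waveNorm p i
  calc _ ≤ ∑ _i : Fin 3, waveNorm p := Finset.sum_le_sum fun i _ => h i
    _ = 3 * waveNorm p := by simp

/-! ### Termwise differentiation of wave series. -/

section Synthesis

variable {c : (Fin 3 → ℤ) → ℂ} (hc : Summable fun p => ‖c p‖)
  (hc' : Summable fun p => waveNorm p * ‖c p‖)
include hc hc'

lemma contDiff_wave_series : ContDiff ℝ 1 fun a => ∑' p, wave p a * c p := by
  refine contDiff_tsum (v := fun _ p => ‖c p‖ + 3 * (waveNorm p * ‖c p‖))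
    (fun p => (contDiff_wave p).mul contDiff_const) (fun k _ => hc.add (hc'.mul_left 3))
    fun k p a hk => ?_
  have h0 : 0 ≤ waveNorm p * ‖c p‖ := mul_nonneg (waveNorm_nonneg p) (norm_nonneg _)
  have hk1 : k = 0 ∨ k = 1 := by
    have : k ≤ 1 := by exact_mod_cast hk
    omega
  rcases hk1 with rfl | rfl
  · rw [norm_iteratedFDeriv_zero, norm_mul, norm_wave, one_mul]
    linarith
  · rw [norm_iteratedFDeriv_one,
      fderiv_mul_const ((contDiff_wave p).differentiable (by norm_num) a), norm_smul]
    have := mul_le_mul_of_nonneg_left (norm_fderiv_wave_le p a) (norm_nonneg (c p))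
    linarith [norm_nonneg (c p)]

lemma pd_wave_series (i : Fin 3) (a : R3) :
    pd i (fun a => ∑' p, wave p a * c p) a =
      ∑' p, wave p a * (Complex.I * (p i : ℂ) * c p) := by
  have hd : ∀ p, Differentiable ℝ (wave p) := fun p =>
    (contDiff_wave p).differentiable (by norm_num)
  have hb : ∀ p b, ‖fderiv ℝ (fun a => wave p a * c p) b‖ ≤ 3 * (waveNorm p * ‖c p‖) := by
    intro p b
    rw [fderiv_mul_const (hd p b), norm_smul]
    have := mul_le_mul_of_nonneg_left (norm_fderiv_wave_le p b) (norm_nonneg (c p))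
    linarith
  have hs : Summable fun p => fderiv ℝ (fun a => wave p a * c p) a :=
    Summable.of_norm_bounded (hc'.mul_left 3) fun p => hb p a
  rw [pd, fderiv_tsum_apply (hc'.mul_left 3) (fun p => (hd p).mul_const _) hb (x₀ := a)
    (Summable.of_norm (by simpa using hc))]
  have h1 := (ContinuousLinearMap.apply ℝ ℂ (Pi.single i (1 : ℝ) : R3)).map_tsum hs
  simp only [ContinuousLinearMap.apply_apply] at h1
  rw [h1]
  refine tsum_congr fun p => ?_
  have := pd_wave p i a
  rw [pd] at this
  rw [fderiv_mul_const (hd p a)]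
  simp only [smul_apply, smul_eq_mul, this]
  ring

end Synthesis

/-- The mean-free periodic field with curl and divergence given by the real field `G`. -/
def potential (G : R3 → EuclideanSpace ℂ (Fin 4)) (a : R3) : R3 :=
  fun j => (∑' p, wave p a * biotSavart p (coef G p) j).re

section Potential

variable {G : R3 → EuclideanSpace ℂ (Fin 4)} {B : ℝ} (hG : WaveBound compat G B)
include hG

lemma summable_biotSavart (j : Fin 3) : Summable fun p => ‖biotSavart p (coef G p) j‖ :=
  Summable.of_nonneg_of_le (fun _ => norm_nonneg _)
    (fun p => (PiLp.norm_apply_le _ j).trans (norm_biotSavart_le (hG.coef.1 p))) hG.coef.2.1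

lemma summable_waveNorm_biotSavart (j : Fin 3) :
    Summable fun p => waveNorm p * ‖biotSavart p (coef G p) j‖ :=
  Summable.of_nonneg_of_le (fun _ => mul_nonneg (waveNorm_nonneg _) (norm_nonneg _))
    (fun p => (mul_le_mul_of_nonneg_left (PiLp.norm_apply_le _ j) (waveNorm_nonneg p)).trans
      (waveNorm_mul_norm_biotSavart (hG.coef.1 p)).le) hG.coef.2.1

lemma contDiff_potential : ContDiff ℝ 1 (potential G) :=
  contDiff_pi.mpr fun j => Complex.reCLM.contDiff.comp
    (contDiff_wave_series (summable_biotSavart hG j) (summable_waveNorm_biotSavart hG j))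

omit hG in
lemma periodic_potential : IsPeriodic (potential G) := fun a n => by
  ext j
  simp only [potential, wave_periodic _ a n]

lemma pd_potential (i j : Fin 3) (a : R3) : pd i (fun b => potential G b j) a =
    (∑' p, wave p a * (Complex.I * (p i : ℂ) * biotSavart p (coef G p) j)).re := by
  have hd := (contDiff_wave_series (summable_biotSavart hG j)
    (summable_waveNorm_biotSavart hG j)).differentiable (by norm_num) a
  have h := (Complex.reCLM.hasFDerivAt.comp a hd.hasFDerivAt).fderiv
  rw [← pd_wave_series (summable_biotSavart hG j) (summable_waveNorm_biotSavart hG j), pd, pd]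
  exact congrArg (fun L : R3 →L[ℝ] ℝ => L (Pi.single i 1)) h

lemma hasSum_pd_potential (i j : Fin 3) (a : R3) :
    HasSum (fun p => (wave p a * (Complex.I * (p i : ℂ) * biotSavart p (coef G p) j)).re)
      (pd i (fun b => potential G b j) a) := by
  rw [pd_potential hG]
  refine Complex.hasSum_re (Summable.hasSum (Summable.of_norm_bounded
    (summable_waveNorm_biotSavart hG j) fun p => ?_))
  rw [norm_mul, norm_mul, norm_mul, norm_wave, Complex.norm_I, one_mul, one_mul,
    Complex.norm_intCast]
  exact mul_le_mul_of_nonneg_right (abs_le_waveNorm p i) (norm_nonneg _)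

/-- The potential of a real field has the prescribed curl and divergence. -/
lemma curlDiv_potential (hreal : ∀ a j, ((G a j).re : ℂ) = G a j) :
    curlDiv (potential G) = G := by
  ext a j
  have hS := fun i j => hasSum_pd_potential hG i j a
  have hT : ∀ j, HasSum (fun p => (wave p a * coef G p j).re) (G a j).re := fun j =>
    Complex.hasSum_re ((EuclideanSpace.proj (𝕜 := ℂ) j).hasSum (hG.coef.2.2.2 a))
  have hspec := fun p => biotSavart_spec (hG.coef.1 p)
  -- `potential` is only a real part; since `G` is real, it suffices to compare the real parts of
  -- the series for the derivatives with those of the series for `G`.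
  rw [← hreal]
  fin_cases j
  · refine congrArg Complex.ofReal (((hS 1 2).sub (hS 2 1)).unique ((hT 0).congr_fun fun p => ?_))
    rw [← (hspec p).1, ← Complex.sub_re]; congr 1; ring
  · refine congrArg Complex.ofReal (((hS 2 0).sub (hS 0 2)).unique ((hT 1).congr_fun fun p => ?_))
    rw [← (hspec p).2.1, ← Complex.sub_re]; congr 1; ring
  · refine congrArg Complex.ofReal (((hS 0 1).sub (hS 1 0)).unique ((hT 2).congr_fun fun p => ?_))
    rw [← (hspec p).2.2.1, ← Complex.sub_re]; congr 1; ring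
  · have h3 := ((hS 0 0).add (hS 1 1)).add (hS 2 2)
    refine congrArg Complex.ofReal (Eq.trans ?_ (h3.unique ((hT 3).congr_fun fun p => ?_)))
    · simp [divergence, Fin.sum_univ_three]
    · rw [← (hspec p).2.2.2, ← Complex.add_re, ← Complex.add_re]; congr 1; ring

/-- The coefficient of a real part at `p` is the average of the coefficient at `p` and the conjugate
of the one at `-p`; at `p = 0` both vanish by `biotSavart_zero`. -/
lemma vCoeff_potential_zero : vCoeff (potential G) 0 = 0 := by
  ext j
  have h1 : ∀ a, HasSum (fun p => wave p a * biotSavart p (coef G p) j)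
      (∑' p, wave p a * biotSavart p (coef G p) j) := fun a =>
    (Summable.of_norm (by simpa using summable_biotSavart hG j)).hasSum
  have h2 : ∀ a, HasSum (fun p => wave p a * (starRingEnd ℂ) (biotSavart (-p) (coef G (-p)) j))
      ((starRingEnd ℂ) (∑' p, wave p a * biotSavart p (coef G p) j)) := fun a => by
    have := (Equiv.neg (Fin 3 → ℤ)).hasSum_iff.mpr (Complex.hasSum_conj'.mpr (h1 a))
    refine this.congr_fun fun p => ?_
    simp [wave_neg]
  have h3 : ∀ a, HasSum (fun p => wave p a •
      (2⁻¹ * (biotSavart p (coef G p) j + (starRingEnd ℂ) (biotSavart (-p) (coef G (-p)) j))))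
      (potential G a j : ℂ) := fun a => by
    refine HasSum.congr_both (((h1 a).add (h2 a)).mul_left (2⁻¹ : ℂ)) (fun p => ?_) ?_
    · simp only [smul_eq_mul]; ring
    · rw [potential, Complex.re_eq_add_conj]; ring
  have hs : Summable fun p => ‖(2⁻¹ * (biotSavart p (coef G p) j +
      (starRingEnd ℂ) (biotSavart (-p) (coef G (-p)) j)) : ℂ)‖ := by
    have hn := (Equiv.neg (Fin 3 → ℤ)).summable_iff.mpr (summable_biotSavart hG j)
    refine Summable.of_nonneg_of_le (fun _ => norm_nonneg _) (fun p => ?_)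
      (((summable_biotSavart hG j).add hn).mul_left ‖(2⁻¹ : ℂ)‖)
    rw [norm_mul]
    refine mul_le_mul_of_nonneg_left ((norm_add_le _ _).trans ?_) (norm_nonneg _)
    simp
  have h4 := congrFun (coef_of_hasSum hs h3) 0
  have h5 : vCoeff (potential G) 0 j = coef (fun a => (potential G a j : ℂ)) 0 :=
    fCoeff_eq_coef _ _
  rw [h5, h4]
  simp [biotSavart_zero]

end Potential

end

section

open Finset

/-! ### Construction of the Taylor coefficients -/

section Recurrence

variable {v0 : R3 → R3} {η η' : ℕ → R3 → R3}

lemma curlRHS_congr {s : ℕ} (h : ∀ m < s, η m = η' m) : curlRHS v0 η s = curlRHS v0 η' s := by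
  ext a : 1
  rw [curlRHS, curlRHS]
  congr 1
  refine sum_congr rfl fun k _ => sum_congr rfl fun m hm => ?_
  rw [mem_Ioo] at hm
  rw [h m hm.2, h (s - m) (by omega)]

lemma divRHS_congr {s : ℕ} (h : ∀ m < s, η m = η' m) : divRHS η s = divRHS η' s := by
  ext a
  rw [divRHS, divRHS]
  congr 1
  · refine sum_congr rfl fun k _ => sum_congr rfl fun m hm => ?_
    rw [mem_Ioo] at hm
    rw [h m hm.2, h (s - m) (by omega)]
  · refine sum_congr rfl fun l hl => sum_congr rfl fun m hm => ?_
    rw [mem_Ioo] at hl hm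
    rw [h l hl.2, h m (by omega), h (s - l - m) (by omega)]

lemma recVec_congr {s : ℕ} (h : ∀ m < s, η m = η' m) : recVec v0 η s = recVec v0 η' s := by
  ext a : 1
  rw [recVec, recVec, curlRHS_congr h, divRHS_congr h]

lemma curlDiv_eq_recVec_iff {u : R3 → R3} {s : ℕ} : curlDiv u = recVec v0 η s ↔
    (∀ a, curl u a = curlRHS v0 η s a) ∧ ∀ a, divergence u a = divRHS η s a := by
  constructor
  · intro h
    have h' : ∀ a j, curlDiv u a j = recVec v0 η s a j := fun a j => by rw [h]
    refine ⟨fun a => ?_, fun a => Complex.ofReal_injective (h' a 3)⟩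
    ext i
    fin_cases i
    · exact Complex.ofReal_injective (h' a 0)
    · exact Complex.ofReal_injective (h' a 1)
    · exact Complex.ofReal_injective (h' a 2)
  · rintro ⟨h1, h2⟩
    ext a : 1
    rw [curlDiv, recVec, h1, h2]

lemma recVec_re (s : ℕ) (a : R3) (j : Fin 4) :
    ((recVec v0 η s a j).re : ℂ) = recVec v0 η s a j := by
  fin_cases j <;> rfl

lemma curlDiv_initial (hdiv : ∀ a, divergence v0 a = 0) : curlDiv v0 = recVec v0 η 1 := by
  have h : Ioo 0 1 = (∅ : Finset ℕ) := rfl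
  refine curlDiv_eq_recVec_iff.mpr ⟨fun a => ?_, fun a => ?_⟩
  · simp [curlRHS, h]
  · simp [hdiv, divRHS, h]

end Recurrence

variable (v0 : R3 → R3)

/-- The Taylor coefficients, by recursion on the order. -/
def taylor (s : ℕ) : R3 → R3 :=
  if s = 0 then 0 else if s = 1 then v0 else
    potential (recVec v0 (fun m => if _h : m < s then taylor m else 0) s)
termination_by s

lemma taylor_zero : taylor v0 0 = 0 := by rw [taylor]; simp

lemma taylor_one : taylor v0 1 = v0 := by rw [taylor]; simp

/-- The guard `m < s` in the recursion serves only termination: the right-hand side of order `s`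
sees lower orders only, so the guard can be dropped. -/
lemma taylor_of_two_le {s : ℕ} (hs : 2 ≤ s) :
    taylor v0 s = potential (recVec v0 (taylor v0) s) := by
  rw [taylor, if_neg (by omega), if_neg (by omega)]
  exact congrArg _ (recVec_congr fun m hm => by simp [hm])

variable {v0}

lemma norm_coef_curlDiv_of_divergence_eq_zero (hv0 : ContDiff ℝ 1 v0)
    (hdiv : ∀ a, divergence v0 a = 0) (p : Fin 3 → ℤ) :
    ‖coef (curlDiv v0) p‖ = ‖vCoeff (curl v0) p‖ := by
  rw [← sq_eq_sq₀ (norm_nonneg _) (norm_nonneg _), norm_sq_eucl3, norm_sq_eucl4]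
  simp only [coef_euclidean (continuous_curlDiv hv0), vCoeff, fCoeff_eq_coef]
  have h3 : coef (fun a => curlDiv v0 a 3) p = 0 := by
    simp [curlDiv, hdiv, coef]
  rw [h3, Complex.normSq_zero, add_zero]
  rfl

lemma wienerField_initial (hv0 : ContDiff ℝ 1 v0) (hper : IsPeriodic v0)
    (hdiv : ∀ a, divergence v0 a = 0) (hΓ : Summable fun p => ‖vCoeff (curl v0) p‖) :
    WienerField v0 :=
  WienerField.of_curlDiv hv0 hper
    (by simpa only [norm_coef_curlDiv_of_divergence_eq_zero hv0 hdiv] using hΓ)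

/-- The divergence component is zero, so the isometry turns the mass of the initial velocity into
the Fourier sum of its vorticity. Thus `Γ` is the source term of the cubic inequality. -/
lemma gradMass_initial (hv0 : ContDiff ℝ 1 v0) (hper : IsPeriodic v0)
    (hdiv : ∀ a, divergence v0 a = 0) : gradMass v0 = fourierSum (curl v0) := by
  rw [gradMass_eq hv0 hper, fourierSum]
  simp only [norm_coef_curlDiv_of_divergence_eq_zero hv0 hdiv]

lemma exists_waveBound_taylor {s : ℕ} (hs : 2 ≤ s) (h : ∀ m < s, WienerField (taylor v0 m)) :
    ∃ B, WaveBound compat (recVec v0 (taylor v0) s) B := by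
  -- Truncation above order `s` supplies Wiener fields at every index, while the induction
  -- hypothesis covers only the lower orders.
  have hc : recVec v0 (taylor v0) s =
      recVec v0 (fun m => if m < s then taylor v0 m else 0) s :=
    recVec_congr fun m hm => by simp [hm]
  rw [hc]
  refine ⟨_, recVec_waveBound v0 (by simp [taylor_zero]) (fun m => ?_) (by omega)⟩
  split_ifs with hm
  · exact h m hm
  · exact WienerField.zero

lemma wienerField_taylor (h1 : WienerField v0) (s : ℕ) : WienerField (taylor v0 s) := by
  induction s using Nat.strong_induction_on with
  | _ s ih =>
    rcases Nat.lt_or_ge s 2 with hs | hs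
    · interval_cases s
      · rw [taylor_zero]; exact WienerField.zero
      · rw [taylor_one]; exact h1
    · obtain ⟨B, hB⟩ := exists_waveBound_taylor hs ih
      rw [taylor_of_two_le v0 hs]
      refine WienerField.of_curlDiv (contDiff_potential hB) periodic_potential ?_
      rw [curlDiv_potential hB (recVec_re s)]
      exact hB.coef.2.1

lemma curlDiv_taylor (h1 : WienerField v0) (hdiv : ∀ a, divergence v0 a = 0) {s : ℕ}
    (hs : 1 ≤ s) : curlDiv (taylor v0 s) = recVec v0 (taylor v0) s := by
  rcases Nat.lt_or_ge s 2 with h | h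
  · obtain rfl : s = 1 := by omega
    rw [taylor_one]; exact curlDiv_initial hdiv
  · obtain ⟨B, hB⟩ := exists_waveBound_taylor h fun m _ => wienerField_taylor h1 m
    conv_lhs => rw [taylor_of_two_le v0 h]
    exact curlDiv_potential hB (recVec_re s)

lemma isTaylorCoeffs_taylor (h1 : WienerField v0) (hdiv : ∀ a, divergence v0 a = 0) :
    IsTaylorCoeffs v0 (taylor v0) where
  zero := taylor_zero v0
  contDiff s _ := (wienerField_taylor h1 s).contDiff
  periodic s _ := (wienerField_taylor h1 s).periodic
  mean s hs := by
    split_ifs with h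
    · rw [h, taylor_one]
    · have hs2 : 2 ≤ s := by omega
      obtain ⟨B, hB⟩ := exists_waveBound_taylor hs2 fun m _ => wienerField_taylor h1 m
      rw [taylor_of_two_le v0 hs2]
      exact vCoeff_potential_zero hB
  curl_eq s hs := (curlDiv_eq_recVec_iff.mp (curlDiv_taylor h1 hdiv hs)).1
  div_eq s hs := (curlDiv_eq_recVec_iff.mp (curlDiv_taylor h1 hdiv hs)).2

/-- At each order the right-hand sides agree by induction, and curl, divergence and mean determine
the field. -/
lemma IsTaylorCoeffs.unique {ξ ξ' : ℕ → R3 → R3} (h : IsTaylorCoeffs v0 ξ)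
    (h' : IsTaylorCoeffs v0 ξ') : ξ' = ξ := by
  ext s : 1
  induction s using Nat.strong_induction_on with
  | _ s ih =>
    rcases Nat.eq_zero_or_pos s with rfl | hs
    · rw [h.zero, h'.zero]
    · refine eq_of_curlDiv_eq (h'.contDiff s hs) (h.contDiff s hs) (h'.periodic s hs)
        (h.periodic s hs) ?_ ?_
      · rw [curlDiv_eq_recVec_iff.mpr ⟨h.curl_eq s hs, h.div_eq s hs⟩,
          curlDiv_eq_recVec_iff.mpr ⟨h'.curl_eq s hs, h'.div_eq s hs⟩]
        exact recVec_congr ih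
      · rw [h.mean s hs, h'.mean s hs]

/-- The recursive inequality for the masses of the gradients of the Taylor coefficients. -/
lemma gradMass_taylor_le (h1 : WienerField v0) (hdiv : ∀ a, divergence v0 a = 0) (s : ℕ) :
    gradMass (taylor v0 s) ≤ (if s = 1 then gradMass v0 else 0) +
      (1 / √2) * ∑ x ∈ antidiagonal s, gradMass (taylor v0 x.1) * gradMass (taylor v0 x.2) +
      (1 / 6) * ∑ x ∈ antidiagonal s, gradMass (taylor v0 x.1) *
        ∑ y ∈ antidiagonal x.2, gradMass (taylor v0 y.1) * gradMass (taylor v0 y.2) := by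
  have hn := fun s => gradMass_nonneg (taylor v0 s)
  have h2 : 0 ≤ (1 / √2) * ∑ x ∈ antidiagonal s,
      gradMass (taylor v0 x.1) * gradMass (taylor v0 x.2) :=
    mul_nonneg (by positivity) (sum_nonneg fun x _ => mul_nonneg (hn _) (hn _))
  have h3 : 0 ≤ (1 / 6) * ∑ x ∈ antidiagonal s, gradMass (taylor v0 x.1) *
      ∑ y ∈ antidiagonal x.2, gradMass (taylor v0 y.1) * gradMass (taylor v0 y.2) :=
    mul_nonneg (by norm_num) (sum_nonneg fun x _ => mul_nonneg (hn _)
      (sum_nonneg fun y _ => mul_nonneg (hn _) (hn _)))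
  rcases Nat.lt_or_ge s 2 with hs | hs
  · interval_cases s
    · simp [taylor_zero, gradMass_zero]
    · rw [if_pos rfl, taylor_one]
      linarith
  · have hW := wienerField_taylor h1 s
    rw [gradMass_eq hW.contDiff hW.periodic, curlDiv_taylor h1 hdiv (by omega),
      if_neg (by omega), zero_add]
    refine (recVec_waveBound v0 (taylor_zero v0) (wienerField_taylor h1)
      (by omega : s ≠ 1)).coef.2.2.1.trans (le_of_eq ?_)
    simp only [mul_sum]
    congr 1
    · exact sum_congr rfl fun x _ => by ring
    · exact sum_congr rfl fun x _ => sum_congr rfl fun y _ => by ring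

end

section

open Finset

/-! ### Majorants of power series -/

/-- As the terms with a zero index vanish, two indices of sum at most `n` are both below `n` in
every surviving term. This drop from `n + 1` to `n` lets the induction on partial sums close. -/
lemma sum_range_antidiagonal_le {a b : ℕ → ℝ} (ha : ∀ n, 0 ≤ a n) (hb : ∀ n, 0 ≤ b n)
    (ha0 : a 0 = 0) (hb0 : b 0 = 0) (n : ℕ) :
    ∑ s ∈ range (n + 1), ∑ x ∈ antidiagonal s, a x.1 * b x.2 ≤
      (∑ s ∈ range n, a s) * ∑ s ∈ range n, b s := by
  rw [sum_mul_sum, ← sum_product', sum_sigma',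
    ← sum_image (f := fun x : ℕ × ℕ => a x.1 * b x.2) (g := fun z : (_ : ℕ) × ℕ × ℕ => z.2)]
  · rw [← sum_filter_of_ne (p := fun x => x ∈ range n ×ˢ range n)]
    · exact sum_le_sum_of_subset_of_nonneg (fun x hx => (mem_filter.mp hx).2)
        fun x _ _ => mul_nonneg (ha _) (hb _)
    · rintro ⟨i, j⟩ hx hne
      have hi : i ≠ 0 := fun h => hne (by simp [h, ha0])
      have hj : j ≠ 0 := fun h => hne (by simp [h, hb0])
      simp only [mem_image, mem_sigma, mem_range, HasAntidiagonal.mem_antidiagonal] at hx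
      obtain ⟨⟨s, y⟩, ⟨h1, h2⟩, rfl⟩ := hx
      simp only [mem_product, mem_range] at *
      omega
  · rintro ⟨s, x⟩ hx ⟨s', x'⟩ hx' h
    simp only [coe_sigma, Set.mem_sigma_iff, mem_coe, HasAntidiagonal.mem_antidiagonal] at hx hx' h
    subst h
    obtain rfl : s = s' := by rw [← hx.2, ← hx'.2]
    rfl

section Majorant

variable {A : ℕ → ℝ} {T β γ : ℝ} (hA : ∀ n, 0 ≤ A n) (hA0 : A 0 = 0) (hβ : 0 ≤ β) (hγ : 0 ≤ γ)
  (hrec : ∀ s, A s ≤ (if s = 1 then T else 0) + β * ∑ x ∈ antidiagonal s, A x.1 * A x.2 +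
    γ * ∑ x ∈ antidiagonal s, A x.1 * ∑ y ∈ antidiagonal x.2, A y.1 * A y.2)
include hA hA0 hβ hγ hrec

lemma partialSum_le (hT : 0 ≤ T) (n : ℕ) : ∑ s ∈ range (n + 1), A s ≤
    T + β * (∑ s ∈ range n, A s) ^ 2 + γ * (∑ s ∈ range n, A s) ^ 3 := by
  have hAA : ∀ n, 0 ≤ ∑ y ∈ antidiagonal n, A y.1 * A y.2 := fun n =>
    sum_nonneg fun y _ => mul_nonneg (hA _) (hA _)
  have hS : 0 ≤ ∑ s ∈ range n, A s := sum_nonneg fun s _ => hA s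
  have h1 := sum_range_antidiagonal_le hA hA hA0 hA0 n
  have h2 := sum_range_antidiagonal_le hA hAA hA0 (by simp [hA0]) n
  have h3 : ∑ s ∈ range n, ∑ y ∈ antidiagonal s, A y.1 * A y.2 ≤
      (∑ s ∈ range n, A s) * ∑ s ∈ range n, A s := by
    refine le_trans ?_ h1
    exact sum_le_sum_of_subset_of_nonneg (range_mono (Nat.le_succ n)) fun s _ _ => hAA s
  have h4 : ∑ s ∈ range (n + 1), (if s = 1 then T else 0) ≤ T := by
    rw [sum_ite_eq']
    split_ifs <;> simp [hT]
  calc ∑ s ∈ range (n + 1), A s ≤ ∑ s ∈ range (n + 1), ((if s = 1 then T else 0) +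
        β * ∑ x ∈ antidiagonal s, A x.1 * A x.2 +
        γ * ∑ x ∈ antidiagonal s, A x.1 * ∑ y ∈ antidiagonal x.2, A y.1 * A y.2) :=
      sum_le_sum fun s _ => hrec s
    _ = ∑ s ∈ range (n + 1), (if s = 1 then T else 0) +
        β * ∑ s ∈ range (n + 1), ∑ x ∈ antidiagonal s, A x.1 * A x.2 +
        γ * ∑ s ∈ range (n + 1), ∑ x ∈ antidiagonal s,
          A x.1 * ∑ y ∈ antidiagonal x.2, A y.1 * A y.2 := by
      rw [sum_add_distrib, sum_add_distrib, mul_sum, mul_sum]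
    _ ≤ T + β * ((∑ s ∈ range n, A s) * ∑ s ∈ range n, A s) +
        γ * ((∑ s ∈ range n, A s) * ((∑ s ∈ range n, A s) * ∑ s ∈ range n, A s)) := by
      gcongr
      exact h2.trans (mul_le_mul_of_nonneg_left h3 hS)
    _ = _ := by ring

/-- The increasing map `S ↦ T + β S² + γ S³` sends `[0, z]` into itself, so iterating from 0 never
passes `z`. -/
lemma partialSum_le_of_fixed (hT : 0 ≤ T) {z : ℝ} (hz : 0 ≤ z)
    (hfz : T + β * z ^ 2 + γ * z ^ 3 ≤ z) (n : ℕ) : ∑ s ∈ range n, A s ≤ z := by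
  induction n with
  | zero => simpa using hz
  | succ n ih =>
    have hS : 0 ≤ ∑ s ∈ range n, A s := sum_nonneg fun s _ => hA s
    refine (partialSum_le hA hA0 hβ hγ hrec hT n).trans (le_trans ?_ hfz)
    gcongr

lemma majorant_aux (hT : 0 ≤ T) {z : ℝ} (hz : 0 ≤ z) (hfz : T + β * z ^ 2 + γ * z ^ 3 ≤ z) :
    Summable A ∧ ∑' s, A s ≤ T + β * (∑' s, A s) ^ 2 + γ * (∑' s, A s) ^ 3 ∧
      ∃ z₂, IsLeast {z : ℝ | 0 ≤ z ∧ γ * z ^ 3 + β * z ^ 2 - z + T = 0} z₂ ∧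
        ∑' s, A s ≤ z₂ := by
  have hsum : Summable A := summable_of_sum_range_le hA
    (partialSum_le_of_fixed hA hA0 hβ hγ hrec hT hz hfz)
  have hlim := hsum.hasSum.tendsto_sum_nat
  have hlim' := (tendsto_add_atTop_iff_nat 1).mpr hlim
  refine ⟨hsum, ?_, ?_⟩
  · exact le_of_tendsto_of_tendsto' hlim'
      ((tendsto_const_nhds.add ((hlim.pow 2).const_mul β)).add ((hlim.pow 3).const_mul γ))
      (partialSum_le hA hA0 hβ hγ hrec hT)
  · have hcont : Continuous fun z : ℝ => γ * z ^ 3 + β * z ^ 2 - z + T := by fun_prop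
    have hivt : (0 : ℝ) ∈ (fun z : ℝ => γ * z ^ 3 + β * z ^ 2 - z + T) '' Set.Icc 0 z :=
      intermediate_value_Icc' hz hcont.continuousOn ⟨by linarith, by simpa using hT⟩
    obtain ⟨y, hy, hy0⟩ := hivt
    have hcl : IsClosed {z : ℝ | 0 ≤ z ∧ γ * z ^ 3 + β * z ^ 2 - z + T = 0} :=
      isClosed_Ici.inter (isClosed_eq hcont continuous_const)
    have hleast := hcl.isLeast_csInf ⟨y, hy.1, hy0⟩ ⟨0, fun x hx => hx.1⟩
    refine ⟨_, hleast, ?_⟩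
    -- The smallest root is itself admissible as the barrier `z`, so the partial sums are bounded by
    -- it directly, with no continuity argument in `t`.
    refine hsum.tsum_le_of_sum_range_le fun n => ?_
    exact partialSum_le_of_fixed hA hA0 hβ hγ hrec hT hleast.1.1 (by linarith [hleast.1.2]) n

end Majorant

/-- A power series whose coefficients satisfy a cubic recursive inequality. -/
lemma majorant {A : ℕ → ℝ} {G β γ t : ℝ} (hA : ∀ n, 0 ≤ A n) (hA0 : A 0 = 0) (hβ : 0 ≤ β)
    (hγ : 0 ≤ γ) (hG : 0 ≤ G) (ht : 0 ≤ t)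
    (hrec : ∀ s, A s ≤ (if s = 1 then G else 0) + β * ∑ x ∈ antidiagonal s, A x.1 * A x.2 +
      γ * ∑ x ∈ antidiagonal s, A x.1 * ∑ y ∈ antidiagonal x.2, A y.1 * A y.2)
    {z : ℝ} (hz : 0 ≤ z) (hfz : t * G + β * z ^ 2 + γ * z ^ 3 ≤ z) :
    (Summable fun s => A s * t ^ s) ∧
      ∑' s, A s * t ^ s ≤
        t * G + β * (∑' s, A s * t ^ s) ^ 2 + γ * (∑' s, A s * t ^ s) ^ 3 ∧
      ∃ z₂, IsLeast {z : ℝ | 0 ≤ z ∧ γ * z ^ 3 + β * z ^ 2 - z + t * G = 0} z₂ ∧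
        ∑' s, A s * t ^ s ≤ z₂ := by
  refine majorant_aux (A := fun s => A s * t ^ s) (fun n => mul_nonneg (hA n) (pow_nonneg ht n))
    (by simp [hA0]) hβ hγ (fun s => ?_) (mul_nonneg ht hG) hz hfz
  have h2 : ∀ s, ∑ x ∈ antidiagonal s, A x.1 * t ^ x.1 * (A x.2 * t ^ x.2) =
      (∑ x ∈ antidiagonal s, A x.1 * A x.2) * t ^ s := fun s => by
    rw [sum_mul]
    refine sum_congr rfl fun x hx => ?_
    rw [← HasAntidiagonal.mem_antidiagonal.mp hx, pow_add]; ring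
  have h3 : ∑ x ∈ antidiagonal s, A x.1 * t ^ x.1 *
      ∑ y ∈ antidiagonal x.2, A y.1 * t ^ y.1 * (A y.2 * t ^ y.2) =
      (∑ x ∈ antidiagonal s, A x.1 * ∑ y ∈ antidiagonal x.2, A y.1 * A y.2) * t ^ s := by
    rw [sum_mul]
    refine sum_congr rfl fun x hx => ?_
    rw [h2, ← HasAntidiagonal.mem_antidiagonal.mp hx, pow_add]; ring
  rw [h2, h3]
  refine (mul_le_mul_of_nonneg_right (hrec s) (pow_nonneg ht s)).trans (le_of_eq ?_)
  split_ifs with h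
  · subst h; ring
  · ring

/-! ### The two critical times. -/

lemma sqrt_two_sq : √2 ^ 2 = (2 : ℝ) := Real.sq_sqrt (by norm_num)

lemma sqrt_two_bounds : (1.41421 : ℝ) < √2 ∧ √2 < 1.41422 := by
  constructor
  · rw [Real.lt_sqrt (by norm_num)]; norm_num
  · rw [Real.sqrt_lt' (by norm_num)]; norm_num

/-- The critical time is the maximal value of `z - z²/√2 - z³/6`. -/
lemma Tc_eq : Tc + (1 / √2) * (2 - √2) ^ 2 + (1 / 6) * (2 - √2) ^ 3 = 2 - √2 := by
  have h := sqrt_two_sq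
  have h0 : (1 : ℝ) / √2 = √2 / 2 := by
    rw [div_eq_div_iff (by positivity) (by norm_num), ← sq, h, one_mul]
  rw [h0, Tc]
  linear_combination (√2 / 3 - 1) * h

/-- `(3√2 - 4)/6` is the positive root of `1 - 24 z - 18 z²`, hence the point where `z - 12 z² - 6
z³` is maximal on `z ≥ 0`. -/
lemma TcNorm_eq : TcNorm + 12 * ((3 * √2 - 4) / 6) ^ 2 + 6 * ((3 * √2 - 4) / 6) ^ 3 =
    (3 * √2 - 4) / 6 := by
  have h := sqrt_two_sq
  rw [TcNorm]
  linear_combination (3 / 4 * √2) * h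

lemma Tc_approx : |Tc - 0.3096| < 0.00005 := by
  obtain ⟨h1, h2⟩ := sqrt_two_bounds
  rw [Tc, abs_lt]
  constructor <;> linarith

lemma TcNorm_approx : |TcNorm - 0.0204| < 0.00005 := by
  obtain ⟨h1, h2⟩ := sqrt_two_bounds
  rw [TcNorm, abs_lt]
  constructor <;> linarith

lemma six_TcNorm_lt_Tc : 6 * TcNorm < Tc := by
  have h1 := abs_lt.mp Tc_approx
  have h2 := abs_lt.mp TcNorm_approx
  linarith

end

section

open Finset

/-! ### Power series in time with coefficients depending on a position -/

/-- The series `∑_s f_s(a) t^s`. -/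
def timeSeries (𝕜 : Type*) [RCLike 𝕜] (f : ℕ → R3 → ℝ) (a : R3) (t : 𝕜) : 𝕜 :=
  ∑' s, (f s a : 𝕜) * t ^ s

/-- The radii up to which `M` is a convergent majorant. -/
def majorantDisk (𝕜 : Type*) [RCLike 𝕜] (M : ℕ → ℝ) : Set 𝕜 :=
  {t | ∃ r, ‖t‖ < r ∧ Summable fun s => M s * r ^ s}

/-- `C¹` coefficients which together with their derivatives are bounded by `M`. -/
structure CoeffBound (f : ℕ → R3 → ℝ) (M : ℕ → ℝ) : Prop where
  contDiff : ∀ s, ContDiff ℝ 1 (f s)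
  le : ∀ s a, |f s a| ≤ M s
  fderiv_le : ∀ s a, ‖fderiv ℝ (f s) a‖ ≤ M s

lemma CoeffBound.nonneg {f : ℕ → R3 → ℝ} {M : ℕ → ℝ} (h : CoeffBound f M) (s : ℕ) : 0 ≤ M s :=
  (abs_nonneg _).trans (h.le s 0)

/-- Bernoulli's inequality for `(r'/r)^s`. It absorbs the factor `s` of a time derivative into a
slightly larger radius. -/
lemma nat_mul_pow_le {r r' : ℝ} (hr : 0 < r) (hr' : r < r') (s : ℕ) :
    s * r ^ (s - 1) ≤ r' ^ s / (r' - r) := by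
  have hd : 0 < r' - r := by linarith
  rw [le_div_iff₀ hd]
  rcases Nat.eq_zero_or_pos s with rfl | hs
  · simp
  have h1 := one_add_mul_le_pow (a := r' / r - 1) (by
    have : 0 ≤ r' / r := div_nonneg (hr.trans hr').le hr.le
    linarith) s
  have h2 : 1 + (r' / r - 1) = r' / r := by ring
  rw [h2, div_pow, le_div_iff₀ (pow_pos hr s)] at h1
  have h3 : r ^ s = r ^ (s - 1) * r := by rw [← pow_succ]; congr 1; omega
  have h4 : (1 + s * (r' / r - 1)) * r ^ s = r ^ s + s * r ^ (s - 1) * (r' - r) := by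
    rw [h3]; field_simp
  rw [h4] at h1
  linarith [pow_pos hr s]

variable {𝕜 : Type*} [RCLike 𝕜] {f g : ℕ → R3 → ℝ} {M : ℕ → ℝ}

/-- The coefficients of the time derivative. -/
def timeDeriv {M : Type*} [SMul ℝ M] (f : ℕ → M) (s : ℕ) : M := ((s : ℝ) + 1) • f (s + 1)

/-- Differentiation in time does not shrink the disk: a radius strictly between `‖t‖` and `r` leaves
room for the factor `s`. -/
lemma majorantDisk_timeDeriv (hM : ∀ s, 0 ≤ M s) :
    majorantDisk 𝕜 M ⊆ majorantDisk 𝕜 (timeDeriv M) := by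
  rintro t ⟨r, hr, hs⟩
  obtain ⟨r1, h1, h2⟩ := exists_between hr
  have hr1 : 0 < r1 := (norm_nonneg t).trans_lt h1
  refine ⟨r1, h1, ?_⟩
  have h3 : Summable fun s => M s * (s * r1 ^ (s - 1)) := by
    refine Summable.of_nonneg_of_le (fun s => mul_nonneg (hM s) (by positivity))
      (fun s => mul_le_mul_of_nonneg_left (nat_mul_pow_le hr1 h2 s) (hM s)) ?_
    simpa only [mul_div_assoc] using hs.div_const (r - r1)
  refine ((summable_nat_add_iff 1).mpr h3).congr fun s => ?_
  simp only [timeDeriv, smul_eq_mul, Nat.add_sub_cancel, Nat.cast_add, Nat.cast_one]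
  ring

namespace CoeffBound

variable (h : CoeffBound f M)
include h

lemma timeDeriv : CoeffBound (timeDeriv f) (timeDeriv M) where
  contDiff s := contDiff_const.smul (h.contDiff (s + 1))
  le s a := by
    have hs : (0 : ℝ) ≤ (s : ℝ) + 1 := by positivity
    simp only [EulerLagrange.timeDeriv, Pi.smul_apply, smul_eq_mul, abs_mul, abs_of_nonneg hs]
    exact mul_le_mul_of_nonneg_left (h.le _ a) hs
  fderiv_le s a := by
    have hs : (0 : ℝ) ≤ (s : ℝ) + 1 := by positivity
    simp only [EulerLagrange.timeDeriv]
    rw [fderiv_const_smul ((h.contDiff (s + 1)).differentiable (by norm_num) a), norm_smul,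
      Real.norm_of_nonneg hs, smul_eq_mul]
    exact mul_le_mul_of_nonneg_left (h.fderiv_le _ a) hs

lemma norm_term_le {r : ℝ} {t : 𝕜} (ht : ‖t‖ ≤ r) (a : R3) (s : ℕ) :
    ‖(f s a : 𝕜) * t ^ s‖ ≤ M s * r ^ s := by
  rw [norm_mul, norm_pow, RCLike.norm_ofReal]
  exact mul_le_mul (h.le s a) (pow_le_pow_left₀ (norm_nonneg t) ht s)
    (pow_nonneg (norm_nonneg t) s) (h.nonneg s)

lemma summable_norm {t : 𝕜} (ht : t ∈ majorantDisk 𝕜 M) (a : R3) :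
    Summable fun s => ‖(f s a : 𝕜) * t ^ s‖ := by
  obtain ⟨r, hr, hs⟩ := ht
  exact Summable.of_nonneg_of_le (fun _ => norm_nonneg _) (h.norm_term_le hr.le a) hs

lemma hasDerivAt {t : 𝕜} (ht : t ∈ majorantDisk 𝕜 M) (a : R3) :
    HasDerivAt (timeSeries 𝕜 f a) (timeSeries 𝕜 (EulerLagrange.timeDeriv f) a t) t := by
  have ht' := ht
  obtain ⟨r, hr, hs⟩ := ht
  obtain ⟨r1, h1, h2⟩ := exists_between hr
  have hr1 : 0 < r1 := (norm_nonneg t).trans_lt h1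
  have hball : t ∈ Metric.ball (0 : 𝕜) r1 := by simpa using h1
  have hb : ∀ (s : ℕ) (y : 𝕜), y ∈ Metric.ball (0 : 𝕜) r1 →
      ‖(f s a : 𝕜) * (s * y ^ (s - 1))‖ ≤ M s * (r ^ s / (r - r1)) := by
    intro s y hy
    rw [mem_ball_zero_iff] at hy
    rw [norm_mul, norm_mul, norm_pow, RCLike.norm_ofReal, RCLike.norm_natCast]
    refine mul_le_mul (h.le s a) ?_ (by positivity) (h.nonneg s)
    refine le_trans ?_ (nat_mul_pow_le hr1 h2 s)
    gcongr
  have hu : Summable fun s => M s * (r ^ s / (r - r1)) := by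
    simpa only [mul_div_assoc] using hs.div_const (r - r1)
  have key := hasDerivAt_tsum_of_isPreconnected (𝕜 := 𝕜) (g := fun s y => (f s a : 𝕜) * y ^ s)
    (g' := fun s y => (f s a : 𝕜) * (s * y ^ (s - 1))) hu Metric.isOpen_ball
    (convex_ball (0 : 𝕜) r1).isPreconnected (fun s y _ => (hasDerivAt_pow s y).const_mul _)
    hb hball (h.summable_norm ht' a).of_norm hball
  have hs1 : Summable fun s => (f s a : 𝕜) * (s * t ^ (s - 1)) :=
    Summable.of_norm_bounded hu fun s => hb s t hball
  -- The term of order 0 has factor 0; removing it shifts the index to that of `timeDeriv`.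
  rw [hs1.tsum_eq_zero_add] at key
  simp only [Nat.cast_zero, zero_mul, mul_zero, zero_add, Nat.add_sub_cancel] at key
  convert! key using 1
  refine tsum_congr fun s => ?_
  simp only [EulerLagrange.timeDeriv, Pi.smul_apply, smul_eq_mul]
  push_cast
  ring

lemma analyticAt {t : 𝕜} (ht : t ∈ majorantDisk 𝕜 M) (a : R3) :
    AnalyticAt 𝕜 (timeSeries 𝕜 f a) t := by
  obtain ⟨r, hr, hs⟩ := ht
  have hr0 : 0 < r := (norm_nonneg t).trans_lt hr
  let p := FormalMultilinearSeries.ofScalars 𝕜 (fun s => (f s a : 𝕜))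
  have hrad : ENNReal.ofReal r ≤ p.radius := by
    refine p.le_radius_of_summable (r := r.toNNReal) ?_
    refine Summable.of_nonneg_of_le (fun s => by positivity) (fun s => ?_) hs
    rw [Real.coe_toNNReal r hr0.le]
    refine mul_le_mul_of_nonneg_right ?_ (pow_nonneg hr0.le s)
    rw [FormalMultilinearSeries.ofScalars_norm, RCLike.norm_ofReal]
    exact h.le s a
  have hpos : 0 < p.radius := (ENNReal.ofReal_pos.mpr hr0).trans_le hrad
  have hana := (p.hasFPowerSeriesOnBall hpos).analyticOnNhd
  have hsum : p.sum = timeSeries 𝕜 f a := by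
    ext y
    change FormalMultilinearSeries.ofScalarsSum (fun s => (f s a : 𝕜)) y = _
    rw [FormalMultilinearSeries.ofScalarsSum_eq_tsum]
    simp [timeSeries]
  rw [hsum] at hana
  refine hana t (Metric.eball_subset_eball hrad ?_)
  rw [Metric.mem_eball, edist_zero_right, ← ofReal_norm]
  exact (ENNReal.ofReal_lt_ofReal_iff hr0).mpr hr

lemma pd_timeSeries {t : 𝕜} (ht : t ∈ majorantDisk 𝕜 M) (i : Fin 3) (a : R3) :
    DifferentiableAt ℝ (fun b => timeSeries 𝕜 f b t) a ∧
    pd i (fun b => timeSeries 𝕜 f b t) a = timeSeries 𝕜 (fun s b => pd i (f s) b) a t := by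
  have ht' := ht
  obtain ⟨r, hr, hs⟩ := ht
  have hr0 : 0 ≤ r := (norm_nonneg t).trans hr.le
  have hd : ∀ s b, HasFDerivAt (fun b => (f s b : 𝕜) * t ^ s)
      (t ^ s • ((RCLike.ofRealCLM (K := 𝕜)).comp (fderiv ℝ (f s) b))) b := fun s b =>
    HasFDerivAt.mul_const ((RCLike.ofRealCLM (K := 𝕜)).hasFDerivAt.comp b
      (((h.contDiff s).differentiable (by norm_num)) b).hasFDerivAt) (t ^ s)
  have hb : ∀ s b, ‖t ^ s • ((RCLike.ofRealCLM (K := 𝕜)).comp (fderiv ℝ (f s) b))‖ ≤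
      M s * r ^ s := fun s b => by
    rw [norm_smul, norm_pow, mul_comm]
    refine mul_le_mul ?_ (pow_le_pow_left₀ (norm_nonneg t) hr.le s) (by positivity) (h.nonneg s)
    refine (ContinuousLinearMap.opNorm_comp_le _ _).trans ?_
    rw [RCLike.ofRealCLM_norm, one_mul]
    exact h.fderiv_le s b
  have key := hasFDerivAt_tsum hs hd hb (h.summable_norm ht' a).of_norm a
  refine ⟨key.differentiableAt, ?_⟩
  have hsum : Summable fun s =>
      t ^ s • ((RCLike.ofRealCLM (K := 𝕜)).comp (fderiv ℝ (f s) a)) :=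
    Summable.of_norm_bounded hs fun s => hb s a
  have h1 := (ContinuousLinearMap.apply ℝ 𝕜 (Pi.single i (1 : ℝ) : R3)).map_tsum hsum
  simp only [ContinuousLinearMap.apply_apply] at h1
  have h2 := key.fderiv
  change fderiv ℝ (fun b => timeSeries 𝕜 f b t) a _ = _
  change fderiv ℝ (fun b => timeSeries 𝕜 f b t) a = _ at h2
  rw [h2, h1]
  refine tsum_congr fun s => ?_
  simp [pd, mul_comm]

/-- On all of space times a smaller disk, the total derivatives of the terms are bounded by `M s * r
^ s / (r - r1)` in time plus `M s * r ^ s` in space. This summable bound gives termwise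
differentiation and continuity of the derivative together. -/
lemma contDiffAt {t : 𝕜} (ht : t ∈ majorantDisk 𝕜 M) (a : R3) :
    ContDiffAt ℝ 1 (fun q : R3 × 𝕜 => timeSeries 𝕜 f q.1 q.2) (a, t) := by
  have ht' := ht
  obtain ⟨r, hr, hs⟩ := ht
  obtain ⟨r1, h1, h2⟩ := exists_between hr
  have hr1 : 0 < r1 := (norm_nonneg t).trans_lt h1
  let g' : ℕ → R3 × 𝕜 → R3 × 𝕜 →L[ℝ] 𝕜 := fun s q =>
    (f s q.1 : 𝕜) • (((s : 𝕜) * q.2 ^ (s - 1)) • ContinuousLinearMap.snd ℝ R3 𝕜) +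
      q.2 ^ s • ((RCLike.ofRealCLM (K := 𝕜)).comp
        ((fderiv ℝ (f s) q.1).comp (ContinuousLinearMap.fst ℝ R3 𝕜)))
  have hd : ∀ s q, HasFDerivAt (fun q : R3 × 𝕜 => (f s q.1 : 𝕜) * q.2 ^ s) (g' s q) q := by
    intro s q
    have e1 : HasFDerivAt (fun q : R3 × 𝕜 => (f s q.1 : 𝕜)) _ q :=
      (RCLike.ofRealCLM (K := 𝕜)).hasFDerivAt.comp q
        ((((h.contDiff s).differentiable (by norm_num)) q.1).hasFDerivAt.comp q hasFDerivAt_fst)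
    have e2 : HasFDerivAt (fun q : R3 × 𝕜 => q.2 ^ s)
        (((s : 𝕜) * q.2 ^ (s - 1)) • ContinuousLinearMap.snd ℝ R3 𝕜) q := by
      simpa only [nsmul_eq_mul] using (hasFDerivAt_snd (𝕜 := ℝ) (p := q)).pow s
    exact e1.mul e2
  have hcont : ∀ s, Continuous (g' s) := by
    intro s
    have e1 : Continuous fun q : R3 × 𝕜 => (f s q.1 : 𝕜) :=
      RCLike.continuous_ofReal.comp ((h.contDiff s).continuous.comp continuous_fst)
    have e2 : Continuous fun q : R3 × 𝕜 => fderiv ℝ (f s) q.1 :=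
      ((h.contDiff s).continuous_fderiv (by norm_num)).comp continuous_fst
    refine (e1.smul ((continuous_const.mul (continuous_snd.pow _)).smul continuous_const)).add
      ((continuous_snd.pow s).smul (continuous_const.clm_comp (e2.clm_comp continuous_const)))
  have hb : ∀ s (q : R3 × 𝕜), q ∈ (Set.univ : Set R3) ×ˢ Metric.ball (0 : 𝕜) r1 →
      ‖g' s q‖ ≤ M s * (r ^ s / (r - r1)) + M s * r ^ s := by
    rintro s ⟨b, y⟩ ⟨-, hy⟩
    rw [mem_ball_zero_iff] at hy
    simp only at hy
    refine (norm_add_le _ _).trans (add_le_add ?_ ?_)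
    · rw [norm_smul, norm_smul, norm_mul, norm_pow, RCLike.norm_ofReal, RCLike.norm_natCast]
      refine mul_le_mul (h.le s b) ?_ (by positivity) (h.nonneg s)
      refine (mul_le_of_le_one_right (by positivity)
        (ContinuousLinearMap.norm_snd_le _ _ _)).trans ?_
      refine le_trans ?_ (nat_mul_pow_le hr1 h2 s)
      gcongr
    · rw [norm_smul, norm_pow, mul_comm]
      refine mul_le_mul ?_ (pow_le_pow_left₀ (norm_nonneg y) (hy.le.trans h2.le) s)
        (by positivity) (h.nonneg s)
      refine (ContinuousLinearMap.opNorm_comp_le _ _).trans ?_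
      rw [RCLike.ofRealCLM_norm, one_mul]
      refine (ContinuousLinearMap.opNorm_comp_le _ _).trans ?_
      exact (mul_le_of_le_one_right (norm_nonneg _)
        (ContinuousLinearMap.norm_fst_le _ _ _)).trans (h.fderiv_le s b)
  have hu : Summable fun s => M s * (r ^ s / (r - r1)) + M s * r ^ s := by
    refine Summable.add ?_ hs
    simpa only [mul_div_assoc] using hs.div_const (r - r1)
  have hopen : IsOpen ((Set.univ : Set R3) ×ˢ Metric.ball (0 : 𝕜) r1) :=
    isOpen_univ.prod Metric.isOpen_ball
  have hconn : IsPreconnected ((Set.univ : Set R3) ×ˢ Metric.ball (0 : 𝕜) r1) :=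
    (convex_univ.prod (convex_ball (0 : 𝕜) r1)).isPreconnected
  have hmem : ((a, t) : R3 × 𝕜) ∈ (Set.univ : Set R3) ×ˢ Metric.ball (0 : 𝕜) r1 :=
    ⟨Set.mem_univ _, by simpa using h1⟩
  have key : ∀ q ∈ (Set.univ : Set R3) ×ˢ Metric.ball (0 : 𝕜) r1,
      HasFDerivAt (fun q : R3 × 𝕜 => timeSeries 𝕜 f q.1 q.2) (∑' s, g' s q) q := fun q hq =>
    hasFDerivAt_tsum_of_isPreconnected hu hopen hconn (fun s q _ => hd s q) hb hmem
      (h.summable_norm ht' a).of_norm hq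
  have hcd : ContDiffOn ℝ (0 + 1) (fun q : R3 × 𝕜 => timeSeries 𝕜 f q.1 q.2)
      ((Set.univ : Set R3) ×ˢ Metric.ball (0 : 𝕜) r1) := by
    rw [contDiffOn_succ_iff_fderiv_of_isOpen hopen]
    refine ⟨fun q hq => (key q hq).differentiableAt.differentiableWithinAt,
      fun h0 => absurd h0 (by simp), ?_⟩
    rw [contDiffOn_zero]
    refine (continuousOn_tsum (fun s => (hcont s).continuousOn) hu hb).congr fun q hq => ?_
    exact (key q hq).fderiv
  rw [zero_add] at hcd
  exact hcd.contDiffAt (hopen.mem_nhds hmem)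

end CoeffBound

/-! ### Products of power series -/

/-- The power series with coefficients `p` converges absolutely at `t`, with sum `x`. -/
def PowerSum (p : ℕ → 𝕜) (t x : 𝕜) : Prop :=
  (Summable fun s => ‖p s * t ^ s‖) ∧ ∑' s, p s * t ^ s = x

namespace PowerSum

variable {p q w : ℕ → 𝕜} {t x y z : 𝕜}

lemma add (hp : PowerSum p t x) (hq : PowerSum q t y) :
    PowerSum (fun s => p s + q s) t (x + y) := by
  refine ⟨?_, ?_⟩
  · refine Summable.of_nonneg_of_le (fun _ => norm_nonneg _) (fun s => ?_) (hp.1.add hq.1)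
    rw [add_mul]; exact norm_add_le _ _
  · simp only [add_mul]
    rw [hp.1.of_norm.tsum_add hq.1.of_norm, hp.2, hq.2]

lemma neg (hp : PowerSum p t x) : PowerSum (fun s => -p s) t (-x) := by
  refine ⟨by simpa only [neg_mul, norm_neg] using hp.1, ?_⟩
  simp only [neg_mul, tsum_neg, hp.2]

lemma sub (hp : PowerSum p t x) (hq : PowerSum q t y) :
    PowerSum (fun s => p s - q s) t (x - y) := by
  simpa only [sub_eq_add_neg] using hp.add hq.neg

lemma mul (hp : PowerSum p t x) (hq : PowerSum q t y) :
    PowerSum (fun s => ∑ a ∈ antidiagonal s, p a.1 * q a.2) t (x * y) := by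
  have h : ∀ s, (∑ a ∈ antidiagonal s, p a.1 * q a.2) * t ^ s =
      ∑ a ∈ antidiagonal s, (p a.1 * t ^ a.1) * (q a.2 * t ^ a.2) := fun s => by
    rw [sum_mul]
    refine sum_congr rfl fun a ha => ?_
    rw [← HasAntidiagonal.mem_antidiagonal.mp ha, pow_add]; ring
  refine ⟨?_, ?_⟩
  · simp only [h]
    exact summable_norm_sum_mul_antidiagonal_of_summable_norm (f := fun s => p s * t ^ s)
      (g := fun s => q s * t ^ s) hp.1 hq.1
  · simp only [h]
    rw [← tsum_mul_tsum_eq_tsum_sum_antidiagonal_of_summable_norm (f := fun s => p s * t ^ s)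
      (g := fun s => q s * t ^ s) hp.1 hq.1, hp.2, hq.2]

lemma congr (hp : PowerSum p t x) (h : ∀ s, q s = p s) : PowerSum q t x := by
  rwa [funext h]

lemma eq_of_forall (hp : PowerSum p t x) (h : ∀ s, p s = if s = 0 then y else 0) : x = y := by
  rw [← hp.2, tsum_eq_single 0 fun s hs => by simp [h, hs]]
  simp [h]

end PowerSum

lemma CoeffBound.powerSum_pd (h : CoeffBound f M) {t : 𝕜} (ht : t ∈ majorantDisk 𝕜 M)
    (i : Fin 3) (a : R3) : PowerSum (fun s => ((pd i (f s) a : ℝ) : 𝕜)) t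
      (pd i (fun b => timeSeries 𝕜 f b t) a) := by
  rw [(h.pd_timeSeries ht i a).2]
  refine ⟨?_, rfl⟩
  obtain ⟨r, hr, hs⟩ := ht
  refine Summable.of_nonneg_of_le (fun _ => norm_nonneg _) (fun s => ?_) hs
  rw [norm_mul, norm_pow, RCLike.norm_ofReal]
  refine mul_le_mul ?_ (pow_le_pow_left₀ (norm_nonneg t) hr.le s)
    (pow_nonneg (norm_nonneg t) s) (h.nonneg s)
  refine ((fderiv ℝ (f s) a).le_opNorm _).trans ?_
  rw [Pi.norm_single, norm_one, mul_one]
  exact h.fderiv_le s a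

end

section

open Finset

/-! ### The Lagrangian map -/

/-- The Cauchy invariants, order by order. -/
lemma IsTaylorCoeffs.cauchy_coeff {v0 : R3 → R3} {ξ : ℕ → R3 → R3} (hξ : IsTaylorCoeffs v0 ξ)
    (n : ℕ) (a : R3) (i : Fin 3) : ((n : ℝ) + 1) * curl (ξ (n + 1)) a i +
      ∑ x ∈ antidiagonal n, ((x.1 : ℝ) + 1) * curlQuad (ξ (x.1 + 1)) (ξ x.2) a i =
        if n = 0 then curl v0 a i else 0 := by
  have hn : ((n : ℝ) + 1) ≠ 0 := by positivity
  -- The term `m = 0` has weight 0; writing the others as `m + 1` and multiplying by `n + 1` turns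
  -- the weights `m/s` into those of the time derivative.
  rw [hξ.curl_eq (n + 1) (by omega) a, curlRHS_eq v0 hξ.zero, Nat.sum_antidiagonal_succ]
  simp only [Nat.cast_zero, zero_div, zero_smul, zero_add, Pi.sub_apply, Finset.sum_apply,
    Pi.smul_apply, smul_eq_mul, mul_sub, mul_sum]
  have h : ∀ x ∈ antidiagonal n, ((n : ℝ) + 1) * (((x.1 + 1 : ℕ) : ℝ) / ((n + 1 : ℕ) : ℝ) *
      curlQuad (ξ (x.1 + 1)) (ξ x.2) a i) =
      ((x.1 : ℝ) + 1) * curlQuad (ξ (x.1 + 1)) (ξ x.2) a i := fun x _ => by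
    push_cast; field_simp
  rw [sum_congr rfl h, sub_add_cancel]
  rcases Nat.eq_zero_or_pos n with rfl | hp
  · simp
  · simp [hp.ne']

/-- The conservation of volume, order by order. -/
lemma IsTaylorCoeffs.volume_coeff {v0 : R3 → R3} {ξ : ℕ → R3 → R3} (hξ : IsTaylorCoeffs v0 ξ)
    (n : ℕ) (a : R3) : divergence (ξ n) a - ∑ x ∈ antidiagonal n, divQuad (ξ x.1) (ξ x.2) a +
      ∑ x ∈ antidiagonal n, ∑ y ∈ antidiagonal x.2, divTri (ξ x.1) (ξ y.1) (ξ y.2) a = 0 := by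
  rcases Nat.eq_zero_or_pos n with rfl | hp
  · simp [hξ.zero, divergence, pd_zero_apply, divQuad_zero_left, divTri_of_zero, -Pi.zero_apply,
      -Pi.ofNat_apply]
  · rw [hξ.div_eq n hp a, divRHS_eq hξ.zero]
    ring

section Solution

variable {𝕜 : Type*} [RCLike 𝕜] {v0 : R3 → R3} {ξ : ℕ → R3 → R3} {M : ℕ → ℝ}
  (hM : ∀ j, CoeffBound (fun s a => ξ s a j) M) {t : 𝕜} (ht : t ∈ majorantDisk 𝕜 M)
include hM ht

lemma hasDerivAt_lagrangianMap (a : R3) : HasDerivAt (lagrangianMap 𝕜 ξ a)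
    (fun j => timeSeries 𝕜 (timeDeriv fun s a => ξ s a j) a t) t :=
  hasDerivAt_pi.mpr fun j => ((hM j).hasDerivAt ht a).const_add _

lemma deriv_lagrangianMap_apply (a : R3) (j : Fin 3) : deriv (lagrangianMap 𝕜 ξ a) t j =
    timeSeries 𝕜 (timeDeriv fun s a => ξ s a j) a t :=
  congrFun (hasDerivAt_lagrangianMap hM ht a).deriv j

lemma pd_lagrangianMap (i j : Fin 3) (a : R3) : pd i (fun b => lagrangianMap 𝕜 ξ b t j) a =
    (if i = j then 1 else 0) + pd i (fun b => timeSeries 𝕜 (fun s a => ξ s a j) b t) a := by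
  have h1 : HasFDerivAt (fun b : R3 => ((b j : ℝ) : 𝕜))
      ((RCLike.ofRealCLM (K := 𝕜)).comp (ContinuousLinearMap.proj j)) a :=
    (RCLike.ofRealCLM (K := 𝕜)).hasFDerivAt.comp a (hasFDerivAt_apply j a)
  have h2 := ((hM j).pd_timeSeries ht i a).1
  have h3 := (h1.add h2.hasFDerivAt).fderiv
  have h4 : fderiv ℝ (fun b => lagrangianMap 𝕜 ξ b t j) a = _ := h3
  rw [pd, h4, add_apply]
  congr 1
  by_cases hij : i = j
  · subst hij; simp
  · simp [hij]

lemma powerSum_velocity_pd (i j : Fin 3) (a : R3) :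
    PowerSum (fun s => ((s : 𝕜) + 1) * ((pd i (fun b => ξ (s + 1) b j) a : ℝ) : 𝕜)) t
      (pd i (fun b => timeSeries 𝕜 (timeDeriv fun s a => ξ s a j) b t) a) := by
  refine ((hM j).timeDeriv.powerSum_pd (majorantDisk_timeDeriv (hM j).nonneg ht) i a).congr
    fun s => ?_
  have h : pd i (timeDeriv (fun s a => ξ s a j) s) a =
      ((s : ℝ) + 1) * pd i (fun b => ξ (s + 1) b j) a := by
    simp only [pd, timeDeriv]
    rw [fderiv_const_smul (((hM j).contDiff (s + 1)).differentiable (by norm_num) a)]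
    rfl
  rw [h]
  push_cast
  rfl

/-- With `∇x_k = e_k + ∇ξ_k` the left side is `curl ξ̇ + ∑ ∇ξ̇_k × ∇ξ_k`. As a power series in time
its coefficients are those of `cauchy_coeff`, so only the constant term survives. -/
lemma lagrangianMap_cauchy (hξ : IsTaylorCoeffs v0 ξ) (a : R3) (i : Fin 3) :
    (∑ k : Fin 3, crossProduct (grad (fun b => deriv (lagrangianMap 𝕜 ξ b) t k) a)
      (grad (fun b => lagrangianMap 𝕜 ξ b t k) a)) i = (curl v0 a i : 𝕜) := by
  have X := fun i j => (hM j).powerSum_pd ht i a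
  have Y := fun i j => powerSum_velocity_pd hM ht i j a
  have R := fun p q => ((Y p q).sub (Y q p)).add (((((Y p 0).mul (X q 0)).sub
    ((Y q 0).mul (X p 0))).add (((Y p 1).mul (X q 1)).sub ((Y q 1).mul (X p 1)))).add
    (((Y p 2).mul (X q 2)).sub ((Y q 2).mul (X p 2))))
  have hc := fun n => congrArg (RCLike.ofReal (K := 𝕜)) (hξ.cauchy_coeff n a i)
  simp only [deriv_lagrangianMap_apply hM ht]
  rw [Finset.sum_apply, Fin.sum_univ_three]
  simp only [cross_apply, grad, pd_lagrangianMap hM ht]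
  fin_cases i
  · refine Eq.trans ?_ ((R 1 2).eq_of_forall (y := (curl v0 a 0 : 𝕜)) fun n => ?_)
    · simp; ring
    · have h := hc n
      simp only [← sum_sub_distrib, ← sum_add_distrib]
      simp only [Fin.zero_eta, curlQuad_zero, Fin.sum_univ_three, curl, Matrix.cons_val_zero,
        apply_ite (RCLike.ofReal (K := 𝕜)), RCLike.ofReal_zero] at h ⊢
      rw [← h]
      push_cast
      congr 1
      · ring
      · exact sum_congr rfl fun x _ => by ring
  · refine Eq.trans ?_ ((R 2 0).eq_of_forall (y := (curl v0 a 1 : 𝕜)) fun n => ?_)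
    · simp; ring
    · have h := hc n
      simp only [← sum_sub_distrib, ← sum_add_distrib]
      simp only [Fin.mk_one, curlQuad_one, Fin.sum_univ_three, curl, Matrix.cons_val_one,
        Matrix.cons_val_zero, apply_ite (RCLike.ofReal (K := 𝕜)), RCLike.ofReal_zero] at h ⊢
      rw [← h]
      push_cast
      congr 1
      · ring
      · exact sum_congr rfl fun x _ => by ring
  · refine Eq.trans ?_ ((R 0 1).eq_of_forall (y := (curl v0 a 2 : 𝕜)) fun n => ?_)
    · simp; ring
    · have h := hc n
      simp only [← sum_sub_distrib, ← sum_add_distrib]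
      simp only [Fin.reduceFinMk, curlQuad_two, Fin.sum_univ_three, curl, Matrix.cons_val,
        apply_ite (RCLike.ofReal (K := 𝕜)), RCLike.ofReal_zero] at h ⊢
      rw [← h]
      push_cast
      congr 1
      · ring
      · exact sum_congr rfl fun x _ => by ring

/-- The expansion of `det (I + ∇ξ) - 1` into trace, principal 2×2 minors and determinant is
`divergence - divQuad + divTri`, and `volume_coeff` kills it at every order. -/
lemma lagrangianMap_volume (hξ : IsTaylorCoeffs v0 ξ) (a : R3) :
    Matrix.det (Matrix.of (fun i j : Fin 3 => pd i (fun b => lagrangianMap 𝕜 ξ b t j) a)) = 1 := by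
  have X := fun i j => (hM j).powerSum_pd ht i a
  have Q := fun i j => ((X j i).mul (X i j)).sub ((X i i).mul (X j j))
  have P := fun i j k => (X i 0).mul ((X j 1).mul (X k 2))
  have R := ((((X 0 0).add (X 1 1)).add (X 2 2)).sub (((Q 0 1).add (Q 0 2)).add (Q 1 2))).add
    ((((P 0 1 2).sub (P 0 2 1)).add ((P 1 2 0).sub (P 1 0 2))).add ((P 2 0 1).sub (P 2 1 0)))
  have h0 := R.eq_of_forall (y := 0) fun n => ?_
  · rw [Matrix.det_fin_three]
    simp only [Matrix.of_apply, pd_lagrangianMap hM ht]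
    simp
    linear_combination h0
  · have h := congrArg (RCLike.ofReal (K := 𝕜)) (hξ.volume_coeff n a)
    simp only [divQuad_eq, divTri_eq, divergence, Fin.sum_univ_three, RCLike.ofReal_zero] at h
    rw [ite_self, ← h]
    push_cast
    simp only [← sum_sub_distrib, ← sum_add_distrib, mul_sum]
    congr 1
    exact sum_congr rfl fun x _ => sum_congr rfl fun y _ => by ring

end Solution

/-- The sum of the Taylor series solves Cauchy's equations wherever a majorant converges. -/
lemma isAnalyticCauchySolution {𝕜 : Type*} [RCLike 𝕜] {v0 : R3 → R3} {ξ : ℕ → R3 → R3}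
    {M : ℕ → ℝ} (hM : ∀ j, CoeffBound (fun s a => ξ s a j) M) (hξ : IsTaylorCoeffs v0 ξ)
    (h1 : ξ 1 = v0) {D : Set 𝕜} (hD : IsOpen D) (hD0 : (0 : 𝕜) ∈ D) (hDM : D ⊆ majorantDisk 𝕜 M) :
    IsAnalyticCauchySolution v0 D (lagrangianMap 𝕜 ξ) where
  isOpen := hD
  zero_mem := hD0
  initial a i := by
    have : ∑' s : ℕ, (ξ s a i : 𝕜) * 0 ^ s = (ξ 0 a i : 𝕜) := by
      rw [tsum_eq_single 0 fun s hs => by simp [hs]]; simp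
    simp [lagrangianMap, displacement, this, hξ.zero]
  initial_velocity a i := by
    rw [deriv_lagrangianMap_apply hM (hDM hD0), timeSeries,
      tsum_eq_single 0 fun s hs => by simp [hs]]
    simp [timeDeriv, h1]
  periodic t _ a n := by
    ext i
    have hp : ∀ s, ξ s (fun i => a i + 2 * Real.pi * (n i : ℝ)) = ξ s a := fun s => by
      rcases Nat.eq_zero_or_pos s with rfl | hs
      · rw [hξ.zero]; rfl
      · exact hξ.periodic s hs a n
    simp only [lagrangianMap, displacement, hp, add_sub_cancel_left]
  analytic a t ht := by
    rw [analyticAt_pi_iff]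
    exact fun j => analyticAt_const.add ((hM j).analyticAt (hDM ht) a)
  contDiffOn := by
    rintro ⟨a, t⟩ ⟨-, ht⟩
    refine ContDiffAt.contDiffWithinAt (contDiffAt_pi.mpr fun j => ?_)
    refine ContDiffAt.add ?_ ((hM j).contDiffAt (hDM ht) a)
    exact (RCLike.ofRealCLM (K := 𝕜)).contDiff.contDiffAt.comp _
      ((contDiff_apply ℝ ℝ j).comp contDiff_fst).contDiffAt
  contDiffOn_velocity := by
    refine ContDiffOn.congr (f := fun q : R3 × 𝕜 => fun j =>
      timeSeries 𝕜 (timeDeriv fun s a => ξ s a j) q.1 q.2) ?_ fun q hq => ?_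
    · rintro ⟨a, t⟩ ⟨-, ht⟩
      exact ContDiffAt.contDiffWithinAt (contDiffAt_pi.mpr fun j =>
        (hM j).timeDeriv.contDiffAt (majorantDisk_timeDeriv (hM j).nonneg (hDM ht)) a)
    · exact (hasDerivAt_lagrangianMap hM (hDM hq.2) q.1).deriv
  cauchy t ht a i := lagrangianMap_cauchy hM (hDM ht) hξ a i
  volume t ht a := lagrangianMap_volume hM (hDM ht) hξ a

end

section

open Finset

/-! ### The norm of the gradient in the Wiener algebra -/

lemma wienerNorm_eq (f : R3 → ℝ) : wienerNorm f = ∑' p, ‖coef (fun a => (f a : ℂ)) p‖ := by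
  simp only [wienerNorm, fCoeff_eq_coef]

lemma wienerNorm_pd_le_gradNorm (u : R3 → R3) (i j : Fin 3) :
    wienerNorm (fun a => pd i (fun b => u b j) a) ≤ gradNorm u :=
  le_ciSup (f := fun ij : Fin 3 × Fin 3 => wienerNorm (fun a => pd ij.1 (fun b => u b ij.2) a))
    (Set.finite_range _).bddAbove (i, j)

lemma gradNorm_le {u : R3 → R3} {B : ℝ}
    (h : ∀ i j, wienerNorm (fun a => pd i (fun b => u b j) a) ≤ B) : gradNorm u ≤ B :=
  ciSup_le fun ij => h ij.1 ij.2

lemma gradNorm_nonneg (u : R3 → R3) : 0 ≤ gradNorm u :=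
  le_trans (tsum_nonneg fun _ => norm_nonneg _) (wienerNorm_pd_le_gradNorm u 0 0)

lemma gradNorm_zero : gradNorm 0 = 0 := by
  refine le_antisymm (gradNorm_le fun i j => ?_) (gradNorm_nonneg 0)
  simp only [pd_zero_apply]
  simp [wienerNorm, fCoeff]

section Bounds

variable {u v w : R3 → R3}

lemma WienerField.waveBound_pd (hu : WienerField u) (i j : Fin 3) :
    WaveBound (fun _ => ⊤) (fun a => ((pd i (fun b => u b j) a : ℝ) : ℂ)) (gradNorm u) := by
  refine ⟨_, fun _ => Submodule.mem_top, hu.summable_pd i j, ?_,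
    hasSum_coef (continuous_pd_ofReal hu.contDiff i j)
      (fun a n => congrArg _ ((hu.periodic.comp_apply j).pd i a n)) (hu.summable_pd i j)⟩
  rw [← wienerNorm_eq]
  exact wienerNorm_pd_le_gradNorm u i j

/-- The 6 counts products: two for each of the three values of `k`, each estimated in the Wiener
algebra. -/
lemma waveBound_curlQuad (hu : WienerField u) (hw : WienerField w) (i : Fin 3) :
    WaveBound (fun _ => ⊤) (fun a => (curlQuad u w a i : ℂ)) (6 * (gradNorm u * gradNorm w)) := by
  have h := fun p q => (WaveBound.sum univ fun k _ =>
    ((hu.waveBound_pd p k).mul (hw.waveBound_pd q k)).sub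
      ((hu.waveBound_pd q k).mul (hw.waveBound_pd p k))).mono
    (C := 6 * (gradNorm u * gradNorm w)) (by simp; linarith)
  fin_cases i
  · refine cast (congrArg₂ _ (funext fun a => ?_) rfl) (h 1 2)
    simp [curlQuad_zero]
  · refine cast (congrArg₂ _ (funext fun a => ?_) rfl) (h 2 0)
    simp [curlQuad_one]
  · refine cast (congrArg₂ _ (funext fun a => ?_) rfl) (h 0 1)
    simp [curlQuad_two]

lemma waveBound_divQuad (hu : WienerField u) (hw : WienerField w) :
    WaveBound (fun _ => ⊤) (fun a => (divQuad u w a : ℂ)) (6 * (gradNorm u * gradNorm w)) := by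
  have h := fun i j => ((hu.waveBound_pd j i).mul (hw.waveBound_pd i j)).sub
    ((hu.waveBound_pd i i).mul (hw.waveBound_pd j j))
  refine cast (congrArg₂ _ (funext fun a => ?_) ?_) (((h 0 1).add (h 0 2)).add (h 1 2))
  · simp [divQuad_eq]
  · ring

lemma waveBound_divTri (hu : WienerField u) (hv : WienerField v) (hw : WienerField w) :
    WaveBound (fun _ => ⊤) (fun a => (divTri u v w a : ℂ))
      (6 * (gradNorm u * (gradNorm v * gradNorm w))) := by
  have h := fun i j k => (hu.waveBound_pd i 0).mul
    (((hv.waveBound_pd j 1).mul (hw.waveBound_pd k 2)).sub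
      ((hv.waveBound_pd k 1).mul (hw.waveBound_pd j 2)))
  refine cast (congrArg₂ _ (funext fun a => ?_) ?_) (((h 0 1 2).add (h 1 2 0)).add (h 2 0 1))
  · simp [divTri_eq]
  · ring

variable {η : ℕ → R3 → R3} (v0 : R3 → R3)

/-- The antisymmetrised weights, at most 1/2, reduce the 6 of `waveBound_curlQuad` to 3. -/
lemma waveBound_curlRHS (h0 : η 0 = 0) (hη : ∀ m, WienerField (η m)) {s : ℕ} (hs : s ≠ 1)
    (i : Fin 3) : WaveBound (fun _ => ⊤) (fun a => (curlRHS v0 η s a i : ℂ))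
      (3 * ∑ x ∈ antidiagonal s, gradNorm (η x.1) * gradNorm (η x.2)) := by
  have h := WaveBound.sum (antidiagonal s) fun x hx => (((waveBound_curlQuad (hη x.1) (hη x.2)
    i).const_smul ((((x.2 : ℝ) - x.1) / (2 * s) : ℝ) : ℂ))).mono
    (C := 3 * (gradNorm (η x.1) * gradNorm (η x.2))) (by
      have h1 := abs_antidiagonal_ratio_le hx
      have h2 := mul_nonneg (gradNorm_nonneg (η x.1)) (gradNorm_nonneg (η x.2))
      rw [Complex.norm_real, Real.norm_eq_abs]
      nlinarith)
  refine cast (congrArg₂ _ (funext fun a => ?_) ?_) h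
  · simp [curlRHS_apply v0 h0, hs]
  · rw [mul_sum]

lemma waveBound_divRHS (h0 : η 0 = 0) (hη : ∀ m, WienerField (η m)) (s : ℕ) :
    WaveBound (fun _ => ⊤) (fun a => (divRHS η s a : ℂ))
      (6 * ∑ x ∈ antidiagonal s, gradNorm (η x.1) * gradNorm (η x.2) +
        6 * ∑ x ∈ antidiagonal s, gradNorm (η x.1) *
          ∑ y ∈ antidiagonal x.2, gradNorm (η y.1) * gradNorm (η y.2)) := by
  have h := (WaveBound.sum (antidiagonal s) fun x _ =>
    waveBound_divQuad (hη x.1) (hη x.2)).sub (WaveBound.sum (antidiagonal s) fun x _ =>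
      WaveBound.sum (antidiagonal x.2) fun y _ =>
        waveBound_divTri (hη x.1) (hη y.1) (hη y.2))
  refine cast (congrArg₂ _ (funext fun a => ?_) ?_) h
  · simp [divRHS_eq h0]
  · simp only [mul_sum]

/-- The gradient is controlled by the curl and the divergence. -/
lemma wienerNorm_pd_le {u : R3 → R3} (hu : ContDiff ℝ 1 u) (hp : IsPeriodic u) {B C : ℝ}
    (hC : ∀ i, WaveBound (fun _ => ⊤) (fun a => (curl u a i : ℂ)) C)
    (hB : WaveBound (fun _ => ⊤) (fun a => (divergence u a : ℂ)) B) (i j : Fin 3) :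
    wienerNorm (fun a => pd i (fun b => u b j) a) ≤ B + 2 * C := by
  let c : Fin 3 → (Fin 3 → ℤ) → ℂ := fun k => coef (fun a => (curl u a k : ℂ))
  let d : (Fin 3 → ℤ) → ℂ := coef (fun a => (divergence u a : ℂ))
  have hZ := fun p => coef_curlDiv hu hp p
  have hc : ∀ p, c 0 p = Complex.I * (p 1 * vCoeff u p 2 - p 2 * vCoeff u p 1) ∧
      c 1 p = Complex.I * (p 2 * vCoeff u p 0 - p 0 * vCoeff u p 2) ∧
      c 2 p = Complex.I * (p 0 * vCoeff u p 1 - p 1 * vCoeff u p 0) ∧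
      d p = Complex.I * (p 0 * vCoeff u p 0 + p 1 * vCoeff u p 1 + p 2 * vCoeff u p 2) := by
    intro p
    have h := fun j => (coef_euclidean (continuous_curlDiv hu) p j).symm
    rw [hZ p] at h
    exact ⟨h 0, h 1, h 2, h 3⟩
  have hbound : ∀ (p : Fin 3 → ℤ) (k l m : Fin 3) (x y z : ℂ),
      (((p 0 : ℂ) ^ 2 + (p 1 : ℂ) ^ 2 + (p 2 : ℂ) ^ 2) * vCoeff u p j =
        -Complex.I * (p k * x + p l * y + p m * z)) →
      ‖Complex.I * (p i : ℂ) * vCoeff u p j‖ ≤ ‖x‖ + ‖y‖ + ‖z‖ := by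
    intro p k l m x y z h
    by_cases hp0 : p = 0
    · subst hp0; simp; positivity
    · have hpos : 0 < waveNorm p := zero_lt_one.trans_le (one_le_waveNorm hp0)
      have e : ((waveNorm p ^ 2 : ℝ) : ℂ) = (p 0 : ℂ) ^ 2 + (p 1 : ℂ) ^ 2 + (p 2 : ℂ) ^ 2 := by
        rw [waveNorm_sq]; push_cast; rfl
      rw [← e] at h
      have h2 := congrArg norm h
      rw [norm_mul, norm_mul, norm_neg, Complex.norm_I, one_mul, Complex.norm_real,
        Real.norm_of_nonneg (by positivity)] at h2
      have h3 : ‖(p k * x + p l * y + p m * z : ℂ)‖ ≤ waveNorm p * (‖x‖ + ‖y‖ + ‖z‖) := by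
        refine (norm_add₃_le).trans ?_
        rw [norm_mul, norm_mul, norm_mul, Complex.norm_intCast, Complex.norm_intCast,
          Complex.norm_intCast, mul_add, mul_add]
        have hk := abs_le_waveNorm p
        gcongr <;> exact hk _
      have h4 : waveNorm p * ‖vCoeff u p j‖ ≤ ‖x‖ + ‖y‖ + ‖z‖ := by
        rw [← h2] at h3
        refine le_of_mul_le_mul_left ?_ hpos
        linarith
      rw [norm_mul, norm_mul, Complex.norm_I, one_mul, Complex.norm_intCast]
      exact (mul_le_mul_of_nonneg_right (abs_le_waveNorm p i) (norm_nonneg _)).trans h4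
  -- In `|p|² û = p (p · û) - p × (p × û)` the `j`-th component involves the divergence and only the
  -- two curl components of index other than `j`, hence the bound `B + 2 * C`.
  have hkl : ∃ k l, ∀ p, ‖coef (fun a => ((pd i (fun b => u b j) a : ℝ) : ℂ)) p‖ ≤
      ‖d p‖ + ‖c k p‖ + ‖c l p‖ := by
    have hI := Complex.I_sq
    simp only [coef_pd_apply hu hp]
    fin_cases j
    · refine ⟨2, 1, fun p => ?_⟩
      rw [← norm_neg (c 2 p)]
      refine hbound p 0 1 2 _ _ _ ?_
      obtain ⟨h0, h1, h2, h3⟩ := hc p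
      rw [h1, h2, h3]
      simp only [Fin.zero_eta]
      linear_combination ((p 0 : ℂ) ^ 2 + (p 1 : ℂ) ^ 2 + (p 2 : ℂ) ^ 2) * vCoeff u p 0 * hI
    · refine ⟨0, 2, fun p => ?_⟩
      rw [← norm_neg (c 0 p)]
      refine hbound p 1 2 0 _ _ _ ?_
      obtain ⟨h0, h1, h2, h3⟩ := hc p
      rw [h0, h2, h3]
      simp only [Fin.mk_one]
      linear_combination ((p 0 : ℂ) ^ 2 + (p 1 : ℂ) ^ 2 + (p 2 : ℂ) ^ 2) * vCoeff u p 1 * hI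
    · refine ⟨1, 0, fun p => ?_⟩
      rw [← norm_neg (c 1 p)]
      refine hbound p 2 0 1 _ _ _ ?_
      obtain ⟨h0, h1, h2, h3⟩ := hc p
      rw [h0, h1, h3]
      simp only [Fin.reduceFinMk]
      linear_combination ((p 0 : ℂ) ^ 2 + (p 1 : ℂ) ^ 2 + (p 2 : ℂ) ^ 2) * vCoeff u p 2 * hI
  obtain ⟨k, l, hkl⟩ := hkl
  have s1 := hB.coef.2.1
  have s2 := (hC k).coef.2.1
  have s3 := (hC l).coef.2.1
  have s := (s1.add s2).add s3
  rw [wienerNorm_eq]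
  refine ((Summable.of_nonneg_of_le (fun _ => norm_nonneg _) hkl s).tsum_le_tsum hkl s).trans ?_
  rw [(s1.add s2).tsum_add s3, s1.tsum_add s2]
  linarith [hB.coef.2.2.1, (hC k).coef.2.2.1, (hC l).coef.2.2.1]

end Bounds

/-- The recursive inequality for the norms of the gradients of the Taylor coefficients. -/
lemma gradNorm_taylor_le {v0 : R3 → R3} (h1 : WienerField v0)
    (hdiv : ∀ a, divergence v0 a = 0) (s : ℕ) :
    gradNorm (taylor v0 s) ≤ (if s = 1 then gradNorm v0 else 0) +
      12 * ∑ x ∈ antidiagonal s, gradNorm (taylor v0 x.1) * gradNorm (taylor v0 x.2) +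
      6 * ∑ x ∈ antidiagonal s, gradNorm (taylor v0 x.1) *
        ∑ y ∈ antidiagonal x.2, gradNorm (taylor v0 y.1) * gradNorm (taylor v0 y.2) := by
  have hn := fun s => gradNorm_nonneg (taylor v0 s)
  have h2 : 0 ≤ 12 * ∑ x ∈ antidiagonal s,
      gradNorm (taylor v0 x.1) * gradNorm (taylor v0 x.2) :=
    mul_nonneg (by norm_num) (sum_nonneg fun x _ => mul_nonneg (hn _) (hn _))
  have h3 : 0 ≤ 6 * ∑ x ∈ antidiagonal s, gradNorm (taylor v0 x.1) *
      ∑ y ∈ antidiagonal x.2, gradNorm (taylor v0 y.1) * gradNorm (taylor v0 y.2) :=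
    mul_nonneg (by norm_num) (sum_nonneg fun x _ => mul_nonneg (hn _)
      (sum_nonneg fun y _ => mul_nonneg (hn _) (hn _)))
  rcases Nat.lt_or_ge s 2 with hs | hs
  · interval_cases s
    · simp [taylor_zero, gradNorm_zero]
    · rw [if_pos rfl, taylor_one]
      linarith
  · have hW := wienerField_taylor h1
    have hT := isTaylorCoeffs_taylor h1 hdiv
    have hC := fun i => waveBound_curlRHS v0 (taylor_zero v0) hW (by omega : s ≠ 1) i
    have hB := waveBound_divRHS (taylor_zero v0) hW s
    simp only [← hT.curl_eq s (by omega)] at hC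
    simp only [← hT.div_eq s (by omega)] at hB
    rw [if_neg (by omega), zero_add]
    -- The quadratic constant is `6 + 2 · 3 = 12`; the cubic 6 comes from the divergence alone.
    refine gradNorm_le fun i j =>
      (wienerNorm_pd_le (hW s).contDiff (hW s).periodic hC hB i j).trans (le_of_eq ?_)
    ring

lemma norm_eucl3_le (x : EuclideanSpace ℂ (Fin 3)) : ‖x‖ ≤ ‖x 0‖ + ‖x 1‖ + ‖x 2‖ := by
  refine abs_le_of_sq_le_sq' ?_ (by positivity) |>.2
  rw [EuclideanSpace.norm_sq_eq, Fin.sum_univ_three]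
  nlinarith [mul_nonneg (norm_nonneg (x 0)) (norm_nonneg (x 1)),
    mul_nonneg (norm_nonneg (x 0)) (norm_nonneg (x 2)),
    mul_nonneg (norm_nonneg (x 1)) (norm_nonneg (x 2))]

lemma gradNorm_le_gradMass {u : R3 → R3} (hu : WienerField u) : gradNorm u ≤ gradMass u := by
  refine gradNorm_le fun i j => ?_
  rw [wienerNorm_eq]
  exact (hu.summable_pd i j).tsum_le_tsum (norm_coef_pd_le hu.contDiff hu.periodic i j)
    hu.summable

/-- Each of the three curl components is a difference of two derivatives and costs `2N`, and the
Euclidean norm is at most the sum of the moduli. -/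
lemma fourierSum_curl_le {u : R3 → R3} (hu : WienerField u)
    (hs : Summable fun p => ‖vCoeff (curl u) p‖) : fourierSum (curl u) ≤ 6 * gradNorm u := by
  have h : ∀ i, WaveBound (fun _ => ⊤) (fun a => (curl u a i : ℂ)) (2 * gradNorm u) := by
    have h' := fun p q => ((hu.waveBound_pd p q).sub (hu.waveBound_pd q p)).mono
      (C := 2 * gradNorm u) (by linarith)
    intro i
    fin_cases i
    · refine cast (congrArg₂ _ (funext fun a => ?_) rfl) (h' 1 2)
      simp [curl]
    · refine cast (congrArg₂ _ (funext fun a => ?_) rfl) (h' 2 0)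
      simp [curl]
    · refine cast (congrArg₂ _ (funext fun a => ?_) rfl) (h' 0 1)
      simp [curl]
  have hle : ∀ p, ‖vCoeff (curl u) p‖ ≤ ‖coef (fun a => (curl u a 0 : ℂ)) p‖ +
      ‖coef (fun a => (curl u a 1 : ℂ)) p‖ + ‖coef (fun a => (curl u a 2 : ℂ)) p‖ := fun p => by
    simp only [← fCoeff_eq_coef]
    exact norm_eucl3_le _
  have s := fun i => (h i).coef.2.1
  refine (hs.tsum_le_tsum hle (((s 0).add (s 1)).add (s 2))).trans ?_
  rw [((s 0).add (s 1)).tsum_add (s 2), (s 0).tsum_add (s 1)]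
  linarith [(h 0).coef.2.2.1, (h 1).coef.2.2.1, (h 2).coef.2.2.1]

end

section

open Finset

/-! ### Bounds for fields with an absolutely convergent Fourier series -/

section FieldBound

variable {u : R3 → R3}

lemma norm_vCoeff_le (u : R3 → R3) (p : Fin 3 → ℤ) :
    ‖vCoeff u p‖ ≤ (if p = 0 then ‖vCoeff u 0‖ else 0) + waveNorm p * ‖vCoeff u p‖ := by
  split_ifs with hp
  · subst hp
    exact le_add_of_nonneg_right (mul_nonneg (waveNorm_nonneg _) (norm_nonneg _))
  · rw [zero_add]
    exact le_mul_of_one_le_left (norm_nonneg _) (one_le_waveNorm hp)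

lemma WienerField.summable_norm_vCoeff (hu : WienerField u) : Summable fun p => ‖vCoeff u p‖ :=
  Summable.of_nonneg_of_le (fun _ => norm_nonneg _) (norm_vCoeff_le u)
    ((hasSum_ite_eq 0 _).summable.add hu.summable)

lemma WienerField.tsum_norm_vCoeff_le (hu : WienerField u) :
    ∑' p, ‖vCoeff u p‖ ≤ ‖vCoeff u 0‖ + gradMass u := by
  have h := hasSum_ite_eq (0 : Fin 3 → ℤ) ‖vCoeff u 0‖
  refine (hu.summable_norm_vCoeff.tsum_le_tsum (norm_vCoeff_le u)
    (h.summable.add hu.summable)).trans_eq ?_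
  rw [h.summable.tsum_add hu.summable, h.tsum_eq, gradMass]

lemma WienerField.hasSum_apply (hu : WienerField u) (j : Fin 3) (a : R3) :
    HasSum (fun p => vCoeff u p j * wave p a) ((u a j : ℝ) : ℂ) := by
  have hc : ∀ p, vCoeff u p j = coef (fun a => (u a j : ℂ)) p := fun p => fCoeff_eq_coef _ _
  have hs : Summable fun p => ‖coef (fun a => (u a j : ℂ)) p‖ :=
    Summable.of_nonneg_of_le (fun _ => norm_nonneg _)
      (fun p => by rw [← hc]; exact PiLp.norm_apply_le _ j) hu.summable_norm_vCoeff
  have h := hasSum_coef (f := fun a => (u a j : ℂ))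
    (Complex.continuous_ofReal.comp (contDiff_comp_apply hu.contDiff j).continuous)
    (fun a n => congrArg Complex.ofReal (hu.periodic.comp_apply j a n)) hs a
  simpa only [hc, smul_eq_mul, mul_comm] using h

lemma WienerField.abs_apply_le (hu : WienerField u) (j : Fin 3) (a : R3) :
    |u a j| ≤ ‖vCoeff u 0‖ + gradMass u := by
  refine le_trans ?_ hu.tsum_norm_vCoeff_le
  rw [← Real.norm_eq_abs, ← Complex.norm_real, ← (hu.hasSum_apply j a).tsum_eq]
  refine tsum_of_norm_bounded hu.summable_norm_vCoeff.hasSum fun p => ?_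
  rw [norm_mul, norm_wave, mul_one]
  exact PiLp.norm_apply_le _ j

lemma WienerField.norm_fderiv_le (hu : WienerField u) (j : Fin 3) (a : R3) :
    ‖fderiv ℝ (fun b => u b j) a‖ ≤ 3 * gradMass u := by
  refine (norm_clm_le_sum _).trans ((sum_le_sum fun i _ => hu.norm_pd_le i j a).trans_eq ?_)
  simp

/-- A bound for the components of a field and for their derivatives. -/
def fieldBound (u : R3 → R3) : ℝ := ‖vCoeff u 0‖ + 3 * gradMass u

lemma fieldBound_nonneg (u : R3 → R3) : 0 ≤ fieldBound u :=
  add_nonneg (norm_nonneg _) (mul_nonneg (by norm_num) (gradMass_nonneg u))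

lemma coeffBound_of_wienerField {ξ : ℕ → R3 → R3} (hξ : ∀ s, WienerField (ξ s)) (j : Fin 3) :
    CoeffBound (fun s a => ξ s a j) fun s => fieldBound (ξ s) where
  contDiff s := contDiff_comp_apply (hξ s).contDiff j
  le s a := ((hξ s).abs_apply_le j a).trans (by
    rw [fieldBound]; linarith [gradMass_nonneg (ξ s)])
  fderiv_le s a := ((hξ s).norm_fderiv_le j a).trans (le_add_of_nonneg_left (norm_nonneg _))

end FieldBound

lemma summable_mul_pow_fst {ι : Type*} {f : ℕ → ι → ℝ} (hf : ∀ s i, 0 ≤ f s i)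
    (hs : ∀ s, Summable (f s)) {t : ℝ} (ht : 0 ≤ t) (h : Summable fun s => (∑' i, f s i) * t ^ s) :
    Summable fun q : ℕ × ι => f q.1 q.2 * t ^ q.1 := by
  have h0 : ∀ q : ℕ × ι, 0 ≤ f q.1 q.2 * t ^ q.1 := fun q =>
    mul_nonneg (hf _ _) (pow_nonneg ht _)
  rw [summable_prod_of_nonneg h0]
  exact ⟨fun s => (hs s).mul_right (t ^ s), by simpa only [tsum_mul_right] using h⟩

/-! ### Convergence of the constructed Taylor series. -/

section TimeTaylor

variable {v0 : R3 → R3} (h1 : WienerField v0) (hdiv : ∀ a, divergence v0 a = 0)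
include h1 hdiv

lemma gradMass_taylor_majorant {t : ℝ} (ht : 0 ≤ t) (htT : t * gradMass v0 < Tc) :
    (Summable fun s => gradMass (taylor v0 s) * t ^ s) ∧
      genFun (taylor v0) t ≤ t * gradMass v0 + genFun (taylor v0) t ^ 2 / √2 +
        genFun (taylor v0) t ^ 3 / 6 ∧
      ∃ z₂, IsLeast {z : ℝ | 0 ≤ z ∧ z ^ 3 / 6 + z ^ 2 / √2 - z + t * gradMass v0 = 0} z₂ ∧
        genFun (taylor v0) t ≤ z₂ := by
  -- The barrier is the maximiser `2 - √2`; by `Tc_eq` it is admissible for every `T` below `Tc`.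
  have hz : (0 : ℝ) ≤ 2 - √2 := by linarith [sqrt_two_bounds.2]
  have h := majorant (A := fun s => gradMass (taylor v0 s)) (fun s => gradMass_nonneg _)
    (by simp only [taylor_zero, gradMass_zero]) (by positivity) (by norm_num)
    (gradMass_nonneg v0) ht
    (gradMass_taylor_le h1 hdiv) hz (by linarith [Tc_eq])
  have e : ∀ z : ℝ, z ^ 2 / √2 = (1 / √2) * z ^ 2 ∧ z ^ 3 / 6 = (1 / 6) * z ^ 3 := fun z =>
    ⟨by ring, by ring⟩
  simp only [(e _).1, (e _).2]
  exact h

lemma gradNorm_taylor_majorant {t : ℝ} (ht : 0 ≤ t) (htT : t * gradNorm v0 < TcNorm) :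
    (Summable fun s => gradNorm (taylor v0 s) * t ^ s) ∧
      gradGenFun (taylor v0) t ≤ t * gradNorm v0 + 12 * gradGenFun (taylor v0) t ^ 2 +
        6 * gradGenFun (taylor v0) t ^ 3 ∧
      ∃ z₂, IsLeast {z : ℝ | 0 ≤ z ∧ 6 * z ^ 3 + 12 * z ^ 2 - z + t * gradNorm v0 = 0} z₂ ∧
        gradGenFun (taylor v0) t ≤ z₂ := by
  have hz : (0 : ℝ) ≤ (3 * √2 - 4) / 6 := by linarith [sqrt_two_bounds.1]
  exact majorant (A := fun s => gradNorm (taylor v0 s)) (fun s => gradNorm_nonneg _)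
    (by simp only [taylor_zero, gradNorm_zero]) (by norm_num) (by norm_num) (gradNorm_nonneg v0) ht
    (gradNorm_taylor_le h1 hdiv) hz (by linarith [TcNorm_eq])

lemma vCoeff_taylor_zero {s : ℕ} (hs : s ≠ 1) : vCoeff (taylor v0 s) 0 = 0 := by
  rcases Nat.eq_zero_or_pos s with rfl | h
  · rw [taylor_zero, vCoeff_zero]
  · rw [(isTaylorCoeffs_taylor h1 hdiv).mean s h, if_neg hs]

lemma summable_fieldBound_taylor {t : ℝ} (ht : 0 ≤ t) (htT : t * gradMass v0 < Tc) :
    Summable fun s => fieldBound (taylor v0 s) * t ^ s := by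
  -- Only order 1 has a mean, so the zero modes add a single term to the mass series.
  have h : Summable fun s => ‖vCoeff (taylor v0 s) 0‖ * t ^ s :=
    summable_of_ne_finset_zero (s := {1}) fun s hs => by
      rw [vCoeff_taylor_zero h1 hdiv (by simpa using hs), norm_zero, zero_mul]
  refine (h.add ((gradMass_taylor_majorant h1 hdiv ht htT).1.mul_left 3)).congr fun s => ?_
  rw [fieldBound]; ring

/-- The strict inequality persists at a slightly larger radius, where the majorant still converges.
-/
lemma mem_majorantDisk {𝕜 : Type*} [RCLike 𝕜] {t : 𝕜} (ht : ‖t‖ * gradMass v0 < Tc) :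
    t ∈ majorantDisk 𝕜 fun s => fieldBound (taylor v0 s) := by
  have hc : Continuous fun r : ℝ => r * gradMass v0 := by fun_prop
  obtain ⟨r, hr, hr'⟩ := ((hc.tendsto ‖t‖).eventually_lt_const ht |>.filter_mono
    nhdsWithin_le_nhds |>.and (self_mem_nhdsWithin (s := Set.Ioi ‖t‖))).exists
  exact ⟨r, hr', summable_fieldBound_taylor h1 hdiv ((norm_nonneg t).trans hr'.le) hr⟩

/-- The disk is left general so that both critical times are covered: `h` only asks that it lie
inside the disk of the first one. -/
lemma isAnalyticCauchySolution_taylor {𝕜 : Type*} [RCLike 𝕜] {G T : ℝ} (hT : 0 < T)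
    (h : ∀ r : ℝ, 0 ≤ r → r * G < T → r * gradMass v0 < Tc) :
    IsAnalyticCauchySolution v0 {t : 𝕜 | ‖t‖ * G < T} (lagrangianMap 𝕜 (taylor v0)) :=
  isAnalyticCauchySolution (coeffBound_of_wienerField (wienerField_taylor h1))
    (isTaylorCoeffs_taylor h1 hdiv) (taylor_one v0)
    (isOpen_lt (continuous_norm.mul continuous_const) continuous_const) (by simpa using hT)
    fun t ht => mem_majorantDisk h1 hdiv (h ‖t‖ (norm_nonneg t) ht)

lemma summable_waveNorm_taylor {t : ℝ} (ht : 0 ≤ t) (htT : t * gradMass v0 < Tc) :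
    Summable fun q : ℕ × (Fin 3 → ℤ) =>
      waveNorm q.2 * ‖vCoeff (taylor v0 q.1) q.2‖ * t ^ q.1 := by
  exact summable_mul_pow_fst (f := fun s p => waveNorm p * ‖vCoeff (taylor v0 s) p‖)
    (fun s p => mul_nonneg (waveNorm_nonneg p) (norm_nonneg _))
    (fun s => (wienerField_taylor h1 s).summable) ht (gradMass_taylor_majorant h1 hdiv ht htT).1

lemma summable_norm_vCoeff_taylor {t : ℝ} (ht : 0 ≤ t) (htT : t * gradMass v0 < Tc) :
    Summable fun q : ℕ × (Fin 3 → ℤ) => ‖vCoeff (taylor v0 q.1) q.2‖ * t ^ q.1 := by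
  refine summable_mul_pow_fst (f := fun s p => ‖vCoeff (taylor v0 s) p‖)
    (fun s p => norm_nonneg _) (fun s => (wienerField_taylor h1 s).summable_norm_vCoeff) ht ?_
  refine Summable.of_nonneg_of_le
    (fun s => mul_nonneg (tsum_nonneg fun _ => norm_nonneg _) (pow_nonneg ht s))
    (fun s => mul_le_mul_of_nonneg_right ?_ (pow_nonneg ht s))
    (summable_fieldBound_taylor h1 hdiv ht htT)
  refine (wienerField_taylor h1 s).tsum_norm_vCoeff_le.trans ?_
  rw [fieldBound]; linarith [gradMass_nonneg (taylor v0 s)]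

lemma summable_norm_taylor {t : ℝ} (ht : 0 ≤ t) (htT : t * gradMass v0 < Tc) (a : R3) :
    Summable fun s => ‖taylor v0 s a‖ * t ^ s := by
  refine Summable.of_nonneg_of_le (fun s => mul_nonneg (norm_nonneg _) (pow_nonneg ht s))
    (fun s => mul_le_mul_of_nonneg_right ?_ (pow_nonneg ht s))
    (summable_fieldBound_taylor h1 hdiv ht htT)
  exact (pi_norm_le_iff_of_nonneg (fieldBound_nonneg _)).mpr fun j =>
    (coeffBound_of_wienerField (wienerField_taylor h1) j).le s a

lemma hasSum_displacement_taylor {t : ℂ} (ht : ‖t‖ * gradMass v0 < Tc) (a : R3) (i : Fin 3) :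
    HasSum (fun q : ℕ × (Fin 3 → ℤ) => vCoeff (taylor v0 q.1) q.2 i * wave q.2 a * t ^ q.1)
      (displacement ℂ (taylor v0) a t i) := by
  have hs : Summable fun q : ℕ × (Fin 3 → ℤ) =>
      vCoeff (taylor v0 q.1) q.2 i * wave q.2 a * t ^ q.1 := by
    refine Summable.of_norm_bounded (summable_norm_vCoeff_taylor h1 hdiv (norm_nonneg t) ht)
      fun q => ?_
    rw [norm_mul, norm_mul, norm_wave, mul_one, norm_pow]
    exact mul_le_mul_of_nonneg_right (PiLp.norm_apply_le _ i) (pow_nonneg (norm_nonneg t) _)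
  have h := hs.hasSum.prod_fiberwise fun s =>
    ((wienerField_taylor h1 s).hasSum_apply i a).mul_right (t ^ s)
  have h' := h.tsum_eq
  rw [displacement]
  exact h' ▸ hs.hasSum

end TimeTaylor

end

end

end EulerLagrange

/-! ### Assembly of the theorem. -/

theorem mainTheorem1
    (v0 : EulerLagrange.R3 → EulerLagrange.R3)
    (hv0 : ContDiff ℝ 1 v0)
    (hper : EulerLagrange.IsPeriodic v0)
    (hdiv : ∀ a, EulerLagrange.divergence v0 a = 0)
    (hΓ : Summable fun p : Fin 3 → ℤ =>
      ‖EulerLagrange.vCoeff (EulerLagrange.curl v0) p‖)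
    (Γ N : ℝ)
    (hΓ_def : Γ = EulerLagrange.fourierSum (EulerLagrange.curl v0))
    (hN_def : N = EulerLagrange.gradNorm v0) :
    -- the recurrence relations determine the Taylor coefficients
    ∃ ξ : ℕ → EulerLagrange.R3 → EulerLagrange.R3,
      EulerLagrange.IsTaylorCoeffs v0 ξ ∧
      (∀ ξ', EulerLagrange.IsTaylorCoeffs v0 ξ' → ξ' = ξ) ∧
      ξ 1 = v0 ∧
      -- convergence of the generating function up to the critical time, with its bounds
      (∀ t : ℝ, 0 ≤ t → t * Γ < EulerLagrange.Tc →
        (Summable fun q : ℕ × (Fin 3 → ℤ) =>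
          EulerLagrange.waveNorm q.2 * ‖EulerLagrange.vCoeff (ξ q.1) q.2‖ * t ^ q.1) ∧
        (∀ z : ℝ, z = EulerLagrange.genFun ξ t →
          z ≤ t * Γ + z ^ 2 / √2 + z ^ 3 / 6) ∧
        (∃ z₂ : ℝ, IsLeast {z : ℝ | 0 ≤ z ∧ z ^ 3 / 6 + z ^ 2 / √2 - z + t * Γ = 0} z₂ ∧
          EulerLagrange.genFun ξ t ≤ z₂)) ∧
      -- convergence of the Taylor series, and of its Fourier expansion, in the complex disk
      (∀ t : ℂ, ‖t‖ * Γ < EulerLagrange.Tc → ∀ a : EulerLagrange.R3,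
        (Summable fun s : ℕ => ‖ξ s a‖ * ‖t‖ ^ s) ∧
        (Summable fun q : ℕ × (Fin 3 → ℤ) =>
          ‖EulerLagrange.vCoeff (ξ q.1) q.2‖ * ‖t‖ ^ q.1) ∧
        (∀ i : Fin 3, HasSum
          (fun q : ℕ × (Fin 3 → ℤ) =>
            EulerLagrange.vCoeff (ξ q.1) q.2 i * EulerLagrange.wave q.2 a * t ^ q.1)
          (EulerLagrange.displacement ℂ ξ a t i))) ∧
      -- the sum is a classical solution, analytic in real and in complex time
      EulerLagrange.IsAnalyticCauchySolution v0 {t : ℝ | ‖t‖ * Γ < EulerLagrange.Tc}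
        (EulerLagrange.lagrangianMap ℝ ξ) ∧
      EulerLagrange.IsAnalyticCauchySolution v0 {t : ℂ | ‖t‖ * Γ < EulerLagrange.Tc}
        (EulerLagrange.lagrangianMap ℂ ξ) ∧
      -- the normed-space variant
      (∀ (s : ℕ) (i j : Fin 3), Summable fun p : Fin 3 → ℤ =>
        ‖EulerLagrange.fCoeff (fun a => EulerLagrange.pd i (fun b => ξ s b j) a) p‖) ∧
      (∀ t : ℝ, 0 ≤ t → t * N < EulerLagrange.TcNorm →
        (Summable fun s : ℕ => EulerLagrange.gradNorm (ξ s) * t ^ s) ∧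
        (∀ z : ℝ, z = EulerLagrange.gradGenFun ξ t →
          z ≤ t * N + 12 * z ^ 2 + 6 * z ^ 3) ∧
        (∃ z₂ : ℝ, IsLeast {z : ℝ | 0 ≤ z ∧ 6 * z ^ 3 + 12 * z ^ 2 - z + t * N = 0} z₂ ∧
          EulerLagrange.gradGenFun ξ t ≤ z₂)) ∧
      EulerLagrange.IsAnalyticCauchySolution v0 {t : ℝ | ‖t‖ * N < EulerLagrange.TcNorm}
        (EulerLagrange.lagrangianMap ℝ ξ) ∧
      EulerLagrange.IsAnalyticCauchySolution v0 {t : ℂ | ‖t‖ * N < EulerLagrange.TcNorm}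
        (EulerLagrange.lagrangianMap ℂ ξ) ∧
      -- the second time is the weaker one
      N ≤ Γ ∧ Γ ≤ 6 * N ∧ 6 * EulerLagrange.TcNorm < EulerLagrange.Tc ∧
      |EulerLagrange.Tc - 0.3096| < 0.00005 ∧ |EulerLagrange.TcNorm - 0.0204| < 0.00005 := by
  subst hΓ_def hN_def
  have h1 := EulerLagrange.wienerField_initial hv0 hper hdiv hΓ
  have hG := EulerLagrange.gradMass_initial hv0 hper hdiv
  have hGN := EulerLagrange.fourierSum_curl_le h1 hΓ
  have hNG := EulerLagrange.gradNorm_le_gradMass h1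
  have hTN : 0 < EulerLagrange.TcNorm := by
    linarith [(abs_lt.mp EulerLagrange.TcNorm_approx).1]
  have hT : 0 < EulerLagrange.Tc := by linarith [(abs_lt.mp EulerLagrange.Tc_approx).1]
  rw [hG] at hNG
  -- The second disk is inside the first: `r Γ ≤ 6 r N < 6 T̃_c < T_c`.
  have hN : ∀ r : ℝ, 0 ≤ r → r * EulerLagrange.gradNorm v0 < EulerLagrange.TcNorm →
      r * EulerLagrange.gradMass v0 < EulerLagrange.Tc := fun r hr h => by
    rw [hG]
    linarith [mul_le_mul_of_nonneg_left hGN hr, EulerLagrange.six_TcNorm_lt_Tc]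
  rw [← hG] at hGN hNG ⊢
  have hsol := EulerLagrange.isTaylorCoeffs_taylor h1 hdiv
  refine ⟨EulerLagrange.taylor v0, hsol, fun ξ' h => hsol.unique h, EulerLagrange.taylor_one v0,
    fun t ht htT => ?_, fun t ht a => ⟨?_, ?_, ?_⟩,
    EulerLagrange.isAnalyticCauchySolution_taylor h1 hdiv hT fun _ _ h => h,
    EulerLagrange.isAnalyticCauchySolution_taylor h1 hdiv hT fun _ _ h => h,
    fun s i j => ?_, fun t ht htT => ?_,
    EulerLagrange.isAnalyticCauchySolution_taylor h1 hdiv hTN hN,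
    EulerLagrange.isAnalyticCauchySolution_taylor h1 hdiv hTN hN,
    hNG, hGN, EulerLagrange.six_TcNorm_lt_Tc, EulerLagrange.Tc_approx,
    EulerLagrange.TcNorm_approx⟩
  · obtain ⟨-, h, h'⟩ := EulerLagrange.gradMass_taylor_majorant h1 hdiv ht htT
    exact ⟨EulerLagrange.summable_waveNorm_taylor h1 hdiv ht htT, by rintro z rfl; exact h, h'⟩
  · exact EulerLagrange.summable_norm_taylor h1 hdiv (norm_nonneg t) ht a
  · exact EulerLagrange.summable_norm_vCoeff_taylor h1 hdiv (norm_nonneg t) ht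
  · exact EulerLagrange.hasSum_displacement_taylor h1 hdiv ht a
  · simp only [EulerLagrange.fCoeff_eq_coef]
    exact (EulerLagrange.wienerField_taylor h1 s).summable_pd i j
  · obtain ⟨h, h', h''⟩ := EulerLagrange.gradNorm_taylor_majorant h1 hdiv ht htT
    exact ⟨h, by rintro z rfl; exact h', h''⟩
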